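/- Let $d\ge 2$, and for $x\in\mathbb R^d$ and $t\ge 0$ let $\overline B_x(t)$ be the closed Euclidean ball, $\overline B(t):=\overline B_0(t)$, $B(t)$ the open ball centred at $0$, $s_{d-1}=2\pi^{d/2}/\Gamma(d/2)$ and $\widehat d:=\max\{1,d-2\}$. The convention $0\cdot\infty=0$ is used. *Definitions.* A function $u$ is subharmonic on $\overline B(R)$ if it is the restriction of a subharmonic function (with values in $[-\infty,+\infty)$) on an open ball $B(R')$ with $R'>R$. A nontrivial $\delta$-subharmonic function $U\not\equiv\pm\infty$ on $\overline B(R)$ is a difference $U=u-v$ of two functions $u\not\equiv-\infty$, $v\not\equiv-\infty$ subharmonic on $\overline B(R)$; it is defined at the points where $u$ and $v$ are not both $-\infty$. The Riesz measure of $u$ is $\Delta_u=\frac1{s_{d-1}\widehat d}\,\triangle u$ ($\triangle$ is the Laplacian in the sense of distributions), the Riesz charge of $U$ is $\Delta_U=\Delta_u-\Delta_v$, and $\Delta_U^-$ is its lower (negative) variation. Let $\mathsf C_{U^+}(R)$ be the mean of $U^+=\max\{U,0\}$ over the sphere $\partial\overline B(R)$ with respect to the normalized surface measure, and for a Borel measure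 $\nu$ put $$\mathsf N_\nu(r,R)=\widehat d\int_r^R\frac{\nu(\overline B(t))}{t^{d-1}}\,dt .$$ The difference Nevanlinna characteristic of $U$ is $\boldsymbol T_U(r,R)=\mathsf C_{U^+}(R)+\mathsf N_{\Delta_U^-}(r,R)\in[0,+\infty]$ for $0\le r<R$ (only the values of $\Delta_U^-$ inside the open ball $B(R)$ matter). The modulus of continuity of a Borel measure $\mu$ is $\mathsf h_\mu(t)=\sup_y\mu(\overline B_y(t))$. *Theorem.* (1) Let $0<r<R<+\infty$ and let $\mu$ be a Borel measure on $\overline B(r)\subset\mathbb R^d$ of finite total mass $M$ such that $$\int_0\frac{\mathsf h_\mu(t)}{t^{d-1}}\,dt<+\infty$$ (convergence at $0$). Then every nontrivial $\delta$-subharmonic function $U=u-v$ on $\overline B(R)$ is $\mu$-summable, i.e. $u$ and $v$ are finite $\mu$-almost everywhere and $\int U\,d\mu$ exists and is finite, and for every $r_0\in[0,r]$ (in particular for $r_0=r$) $$\int_{\overline B(r)}U^+\,d\mu\le A_d(r,R)\,\boldsymbol T_U(r_0,R)\Bigl(M+\int_0^{R+r}\frac{\mathsf h_\mu(t)}{t^{d-1}}\,dt\Bigr),$$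 where $$A_d(r,R)=2\Bigl(\frac{R+r}{R-r}\Bigr)^{d-1}\max\bigl\{1,(R-r)^{d-2}\bigr\}.$$ (2) Let $d=2$, $\mathbb R^2=\mathbb C$, let $r$, $R$, $\mu$, $M$ be as in (1), and let $f\not\equiv0$ be a meromorphic function on $\mathbb C$. Then $\ln|f|$ is $\mu$-summable, and for every $r_0\in(0,r]$, and also for $r_0=0$ with $N(0,f):=0$ if $f$ has no pole at $0$, $$\int_{\overline B(r)}\ln^+|f|\,d\mu\le 2\,\frac{R+r}{R-r}\bigl(T(R,f)-N(r_0,f)\bigr)\Bigl(M+\int_0^{R+r}\frac{\mathsf h_\mu(t)}{t}\,dt\Bigr).$$ Here $T(R,f)=m(R,f)+N(R,f)$ is the classical Nevanlinna characteristic, $m(R,f)=\frac1{2\pi}\int_0^{2\pi}\ln^+|f(Re^{i\varphi})|\,d\varphi$, $N(\rho,f)=\int_0^\rho\frac{n(t,f)-n(0,f)}t\,dt+n(0,f)\ln\rho$, and $n(t,f)$ is the number of poles of $f$ in $\overline B(t)$ counted with multiplicity. -/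

import Mathlib

open MeasureTheory Metric Set Module
open scoped ENNReal

noncomputable section

namespace DeltaSubharmonic

/-- The modulus of continuity `h_μ(t) = sup_y μ(B̄_y(t))` of a Borel measure. -/
def modulus {X : Type*} [PseudoMetricSpace X] [MeasurableSpace X] (μ : Measure X) (t : ℝ) : ℝ≥0∞ :=
  ⨆ y : X, μ (closedBall y t)

/-- The integral of `h_μ(t) / t ^ (d - 1)` over `0 < t ≤ a`, with values in `[0, +∞]`. -/
def diniIntegral {X : Type*} [PseudoMetricSpace X] [MeasurableSpace X] (d : ℕ) (μ : Measure X)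
    (a : ℝ) : ℝ≥0∞ :=
  ∫⁻ t in Ioc 0 a, modulus μ t / ENNReal.ofReal (t ^ (d - 1))

/-- The Dini-type condition at zero: `∫_0 h_μ(t) / t ^ (d - 1) dt < +∞`. -/
def DiniCondition {X : Type*} [PseudoMetricSpace X] [MeasurableSpace X] (d : ℕ) (μ : Measure X) :
    Prop :=
  ∃ ε > 0, diniIntegral d μ ε < ∞

section

variable {E : Type*} [NormedAddCommGroup E] [InnerProductSpace ℝ E] [FiniteDimensional ℝ E]
  [MeasurableSpace E] [BorelSpace E]

/-- The mean over the sphere with centre `x` and radius `ρ` of the positive part of `u`, with respect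
to the normalized surface measure. -/
def sphereMeanPos (u : E → EReal) (x : E) (ρ : ℝ) : ℝ≥0∞ :=
  ⨍⁻ ω : sphere (0 : E) 1, (u (x + ρ • (ω : E))).toENNReal ∂(volume : Measure E).toSphere

/-- The mean over the sphere with centre `x` and radius `ρ` of an extended real function: the mean of
the positive part minus the mean of the negative part. (For the functions to which it is applied
below the former is finite.) -/
def sphereMean (u : E → EReal) (x : E) (ρ : ℝ) : EReal :=
  (sphereMeanPos u x ρ : EReal) - (sphereMeanPos (fun y => -u y) x ρ : EReal)

/-- Subharmonic functions on an open set `Ω`, with values in `[-∞, +∞)`; the function `-∞` is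
allowed. -/
structure SubharmonicOn (u : E → EReal) (Ω : Set E) : Prop where
  lt_top : ∀ x ∈ Ω, u x < ⊤
  upperSemicontinuousOn : UpperSemicontinuousOn u Ω
  le_sphereMean : ∀ x : E, ∀ ρ : ℝ, 0 < ρ → closedBall x ρ ⊆ Ω → u x ≤ sphereMean u x ρ

/-- `u` is subharmonic on the closed ball of radius `R` centred at zero: there it coincides with a
subharmonic function on a strictly larger open ball. -/
def SubharmonicOnClosedBall (u : E → EReal) (R : ℝ) : Prop :=
  ∃ R' > R, ∃ w : E → EReal, SubharmonicOn w (ball 0 R') ∧ EqOn u w (closedBall 0 R)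

/-- `U` is the `δ`-subharmonic function `u - v`, nontrivial (`U ≢ ±∞`), on the closed ball of radius
`R` centred at zero, represented by the pair `u ≢ -∞`, `v ≢ -∞` of subharmonic functions.
Where `u = v = -∞` the difference is not defined; the value of `U` there is arbitrary. -/
structure IsDeltaSubharmonic (U u v : E → EReal) (R : ℝ) : Prop where
  subharmonic_left : SubharmonicOnClosedBall u R
  subharmonic_right : SubharmonicOnClosedBall v R
  nontrivial_left : ∃ x ∈ closedBall (0 : E) R, u x ≠ ⊥
  nontrivial_right : ∃ x ∈ closedBall (0 : E) R, v x ≠ ⊥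
  eq_sub : ∀ x ∈ closedBall (0 : E) R, (u x ≠ ⊥ ∨ v x ≠ ⊥) → U x = u x - v x

/-- The number `max {1, d - 2}`. -/
def dHat (d : ℕ) : ℕ := max 1 (d - 2)

/-- The area `s_{d-1} = 2 π ^ (d / 2) / Γ(d / 2)` of the unit sphere in dimension `d`. -/
def sphereArea (d : ℕ) : ℝ := 2 * Real.pi ^ ((d : ℝ) / 2) / Real.Gamma ((d : ℝ) / 2)

/-- `ν` is the Riesz measure of `u` on the open set `Ω`: a Borel measure on `Ω`, finite on compact
subsets of `Ω`, equal to `(s_{d-1} max {1, d - 2})⁻¹` times the Laplacian of `u` in the sense of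
distributions on `Ω`. -/
structure IsRieszMeasure (u : E → EReal) (Ω : Set E) (ν : Measure E) : Prop where
  compl_eq_zero : ν Ωᶜ = 0
  lt_top_of_isCompact : ∀ K : Set E, IsCompact K → K ⊆ Ω → ν K < ∞
  integral_eq : ∀ φ : E → ℝ, ContDiff ℝ (⊤ : ℕ∞) φ → HasCompactSupport φ → tsupport φ ⊆ Ω →
    ∫ x, φ x ∂ν = (sphereArea (finrank ℝ E) * dHat (finrank ℝ E))⁻¹ *
      ∫ x in Ω, (u x).toReal * Laplacian.laplacian φ x

open Classical in
/-- The Riesz measure of `u` on `Ω` (zero if there is none). -/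
def rieszMeasure (u : E → EReal) (Ω : Set E) : Measure E :=
  if h : ∃ ν, IsRieszMeasure u Ω ν then h.choose else 0

/-- The lower variation on `Ω` of the Riesz charge `Δ_u - Δ_v` of `U = u - v`, that is, the positive
part of `Δ_v - Δ_u`. Subtraction of measures gives the least measure `τ` with `Δ_v ≤ τ + Δ_u`. -/
def rieszChargeNeg (u v : E → EReal) (Ω : Set E) : Measure E :=
  rieszMeasure v Ω - rieszMeasure u Ω

/-- `N_ν(r, R) = max {1, d - 2} ∫_r^R ν(B̄(t)) / t ^ (d - 1) dt`. -/
def integratedCounting (ν : Measure E) (r R : ℝ) : ℝ≥0∞ :=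
  dHat (finrank ℝ E) *
    ∫⁻ t in Ioo r R, ν (closedBall 0 t) / ENNReal.ofReal (t ^ (finrank ℝ E - 1))

/-- The difference Nevanlinna characteristic `T_U(r, R) = C_{U⁺}(R) + N_{Δ_U⁻}(r, R)` of `U = u - v`.
Only the part of the Riesz charge inside the open ball of radius `R` enters `N`. -/
def nevanlinnaT (U u v : E → EReal) (r R : ℝ) : ℝ≥0∞ :=
  sphereMeanPos U 0 R + integratedCounting (rieszChargeNeg u v (ball 0 R)) r R

end

/-- `A_d(r, R) = 2 ((R + r) / (R - r)) ^ (d - 1) max {1, (R - r) ^ (d - 2)}`. -/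
def constA (d : ℕ) (r R : ℝ) : ℝ :=
  2 * ((R + r) / (R - r)) ^ (d - 1) * max 1 ((R - r) ^ (d - 2))

end DeltaSubharmonic

end

open DeltaSubharmonic

/-! Both parts rest on the Poisson–Jensen formula in the ball of radius `R`. Replace `u` and `v` by
the nonnegative superharmonic functions `C - u` and `C - v`, with a common upper bound `C`;
everything then lives in `[0, ∞]` and no `∞ - ∞` occurs. The formula writes each of them as a
Poisson integral plus `dHat` times the integral of a Green function against the Riesz measure.
Comparing the two formulas gives, at every point where `u` and `v` are finite, that `U⁺` is at most
the Poisson integral of `U⁺` plus `dHat` times the Green potential of the lower variation of the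
Riesz charge.

For `‖x‖ ≤ r` the Poisson kernel is at most `constA`, which yields the term `C_{U⁺}(R)`. The
potential is integrated in `x` against `μ` first. The Green function divided by `dHat` is the
integral of `t ^ (1 - d)` from `‖x - y‖` to the distance to the reflected point (scaled by `‖y‖ /
R`). An elementary comparison (`radialKernel_le_constA_mul`) bounds it by `constA`, times the
integral of `t ^ (1 - d)` over `(max ‖y‖ r, R)`, times `1` plus the integral over `(‖x - y‖, R +
r)`. By layer-cake integration, the last factor integrated in `x` gives at most `M` plus the Dini
integral, and the middle one integrated in `y` gives at most the counting function divided by `dHat`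
(`lintegral_green_le`, `lintegral_radialKernel_max_le`).

The formula itself is proved in three stages. For `C²` functions it is Green's second identity
against the Green function regularized by adding `η²` under the square roots, as `η → 0`
(`poissonJensen_of_contDiff`). The Riesz measure of a superharmonic function is obtained as a weak
limit of the densities `-Δ` of its mollifications (`IsSuperharmonic.exists_measure`). In the general
formula the mollification is then transferred from the function to the Green function and removed in
the limit (`IsSuperharmonic.poissonJensen`).

For a meromorphic function the Riesz charge in the disc is a finite divisor and the Green functions
are logarithms of moduli of canonical factors. The second part therefore uses the canonical
decomposition of `f` in place of the general formula, and the same integrated Green function bound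
with `d = 2`. -/

set_option linter.unusedSectionVars false
open DeltaSubharmonic
open MeasureTheory Metric Set Module Filter Topology
open scoped ENNReal RealInnerProductSpace

namespace DeltaSubharmonic

/-! ### Polar coordinates. -/

section Polar

variable {E : Type*} [NormedAddCommGroup E] [InnerProductSpace ℝ E] [FiniteDimensional ℝ E]
  [MeasurableSpace E] [BorelSpace E] [Nontrivial E]

/-- The surface measure of the unit sphere. -/
noncomputable abbrev surf (E : Type*) [NormedAddCommGroup E] [InnerProductSpace ℝ E]
    [FiniteDimensional ℝ E] [MeasurableSpace E] [BorelSpace E] : Measure (sphere (0 : E) 1) :=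
  (volume : Measure E).toSphere

/-- Polar coordinates for the Lebesgue integral of nonnegative functions. -/
theorem lintegral_polar {f : E → ℝ≥0∞} (hf : Measurable f) :
    ∫⁻ x, f x = ∫⁻ t in Ioi (0 : ℝ), ENNReal.ofReal (t ^ (finrank ℝ E - 1)) *
      ∫⁻ ω : sphere (0 : E) 1, f (t • (ω : E)) ∂(surf E) := by
  have hm : Measurable fun p : sphere (0 : E) 1 × Ioi (0 : ℝ) => f ((p.2 : ℝ) • (p.1 : E)) :=
    hf.comp (by fun_prop)
  calc ∫⁻ x, f x = ∫⁻ x : ({(0 : E)}ᶜ : Set E), f x ∂((volume : Measure E).comap (↑)) := by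
        rw [lintegral_subtype_comap (measurableSet_singleton _).compl, restrict_compl_singleton]
    _ = ∫⁻ p, f ((p.2 : ℝ) • (p.1 : E)) ∂((surf E).prod (.volumeIoiPow (finrank ℝ E - 1))) := by
        rw [← (volume : Measure E).measurePreserving_homeomorphUnitSphereProd.lintegral_comp hm]
        refine lintegral_congr fun x => ?_
        have hx : (x : E) ≠ 0 := x.2
        simp [homeomorphUnitSphereProd, smul_smul, hx]
    _ = ∫⁻ t, ∫⁻ ω : sphere (0 : E) 1, f ((t : ℝ) • (ω : E)) ∂(surf E)
          ∂(Measure.volumeIoiPow (finrank ℝ E - 1)) := by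
        rw [lintegral_prod_symm' _ hm]
    _ = _ := by
        have hm2 : Measurable fun t : ℝ =>
            ∫⁻ ω : sphere (0 : E) 1, f (t • (ω : E)) ∂(surf E) := by
          apply Measurable.lintegral_prod_right' (f := fun p : ℝ × sphere (0 : E) 1 =>
            f (p.1 • (p.2 : E)))
          exact hf.comp (by fun_prop)
        rw [Measure.volumeIoiPow]
        refine (lintegral_withDensity_eq_lintegral_mul _ (by fun_prop)
          (hm2.comp measurable_subtype_coe)).trans ?_
        rw [← lintegral_subtype_comap measurableSet_Ioi]
        rfl

/-- Polar coordinates for the Bochner integral. -/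
theorem integral_polar {f : E → ℝ} (hf : Integrable f) :
    ∫ x, f x = ∫ t in Ioi (0 : ℝ), t ^ (finrank ℝ E - 1) *
      ∫ ω : sphere (0 : E) 1, f (t • (ω : E)) ∂(surf E) := by
  have hmp := (volume : Measure E).measurePreserving_homeomorphUnitSphereProd
  have he : ∀ x : ({(0 : E)}ᶜ : Set E), f x =
      (fun p : sphere (0 : E) 1 × Ioi (0 : ℝ) => f ((p.2 : ℝ) • (p.1 : E)))
        (homeomorphUnitSphereProd E x) := by
    intro x
    have hx : (x : E) ≠ 0 := x.2
    simp [homeomorphUnitSphereProd, smul_smul, hx]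
  have hintg : Integrable (fun p : sphere (0 : E) 1 × Ioi (0 : ℝ) => f ((p.2 : ℝ) • (p.1 : E)))
      ((surf E).prod (.volumeIoiPow (finrank ℝ E - 1))) := by
    rw [← hmp.integrable_comp_emb (Homeomorph.measurableEmbedding _)]
    have h1 : IntegrableOn f ({(0 : E)}ᶜ : Set E) := hf.integrableOn
    rw [integrableOn_iff_comap_subtypeVal (measurableSet_singleton _).compl] at h1
    exact h1.congr (Eventually.of_forall he)
  calc ∫ x, f x = ∫ x : ({(0 : E)}ᶜ : Set E), f x ∂((volume : Measure E).comap (↑)) := by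
        rw [integral_subtype_comap (measurableSet_singleton _).compl, restrict_compl_singleton]
    _ = ∫ p, f ((p.2 : ℝ) • (p.1 : E)) ∂((surf E).prod (.volumeIoiPow (finrank ℝ E - 1))) := by
        rw [← hmp.integral_comp (Homeomorph.measurableEmbedding _)]
        exact integral_congr_ae (Eventually.of_forall he)
    _ = ∫ t, ∫ ω : sphere (0 : E) 1, f ((t : ℝ) • (ω : E)) ∂(surf E)
          ∂(Measure.volumeIoiPow (finrank ℝ E - 1)) := by
        rw [integral_prod_symm _ hintg]
    _ = _ := by
        simp only [Measure.volumeIoiPow, ENNReal.ofReal]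
        rw [integral_withDensity_eq_integral_smul (by fun_prop)]
        rw [integral_subtype_comap measurableSet_Ioi fun t : ℝ =>
          Real.toNNReal (t ^ (finrank ℝ E - 1)) • ∫ ω : sphere (0 : E) 1, f (t • (ω : E)) ∂(surf E)]
        refine setIntegral_congr_fun measurableSet_Ioi fun t ht => ?_
        simp only [NNReal.smul_def, Real.coe_toNNReal _ (pow_nonneg (le_of_lt ht) _), smul_eq_mul]

end Polar

end DeltaSubharmonic

namespace DeltaSubharmonic

/-! ### The one-dimensional kernel `∫ t ^ (1 - d) dt` and the comparison that produces `constA`. -/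

section RadialKernel

/-- The integral of `t ^ (1 - d)` over the interval `(a, b)`. -/
noncomputable def radialKernel (d : ℕ) (a b : ℝ) : ℝ≥0∞ :=
  ∫⁻ t in Ioo a b, (ENNReal.ofReal (t ^ (d - 1)))⁻¹

theorem radialKernel_mono (d : ℕ) {a b a' b' : ℝ} (ha : a' ≤ a) (hb : b ≤ b') :
    radialKernel d a b ≤ radialKernel d a' b' :=
  lintegral_mono_set (Ioo_subset_Ioo ha hb)

theorem radialKernel_eq_zero (d : ℕ) {a b : ℝ} (h : b ≤ a) : radialKernel d a b = 0 := by
  simp [radialKernel, Ioo_eq_empty_of_le h]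

theorem radialKernel_le_add (d : ℕ) (a b c : ℝ) :
    radialKernel d a c ≤ radialKernel d a b + radialKernel d b c := by
  have h : Ioo a c ⊆ Ioc a b ∪ Ioo b c := fun t ht => by
    rcases le_or_gt t b with h | h
    · exact Or.inl ⟨ht.1, h⟩
    · exact Or.inr ⟨h, ht.2⟩
  refine (lintegral_mono_set h).trans ((lintegral_union_le _ _ _).trans_eq ?_)
  rw [radialKernel, radialKernel, setLIntegral_congr (Ioo_ae_eq_Ioc (a := a) (b := b))]

theorem setLIntegral_Ioo_add_right (f : ℝ → ℝ≥0∞) (a b c : ℝ) :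
    ∫⁻ t in Ioo a b, f (t + c) = ∫⁻ t in Ioo (a + c) (b + c), f t := by
  have h := (measurePreserving_add_right (volume : Measure ℝ) c).setLIntegral_comp_preimage_emb
    (MeasurableEquiv.addRight c).measurableEmbedding f (Ioo (a + c) (b + c))
  simpa using h

theorem radialKernel_add_le (d : ℕ) {a b c : ℝ} (ha : 0 ≤ a) (hc : 0 ≤ c) :
    radialKernel d (a + c) (b + c) ≤ radialKernel d a b := by
  rw [radialKernel, ← setLIntegral_Ioo_add_right]
  refine setLIntegral_mono' measurableSet_Ioo fun t ht => ?_
  have : 0 < t := ha.trans_lt ht.1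
  gcongr
  linarith

theorem ofReal_le_radialKernel (d : ℕ) {a b : ℝ} (ha : 0 ≤ a) (hb : 0 < b) :
    ENNReal.ofReal ((b - a) / b ^ (d - 1)) ≤ radialKernel d a b := by
  calc ENNReal.ofReal ((b - a) / b ^ (d - 1))
      = ∫⁻ _ in Ioo a b, (ENNReal.ofReal (b ^ (d - 1)))⁻¹ := by
        rw [setLIntegral_const, Real.volume_Ioo, ENNReal.ofReal_div_of_pos (by positivity),
          div_eq_mul_inv, mul_comm]
    _ ≤ _ := by
        refine setLIntegral_mono' measurableSet_Ioo fun t ht => ?_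
        have : 0 < t := ha.trans_lt ht.1
        gcongr
        exact ht.2.le

theorem constA_pos {d : ℕ} {r R : ℝ} (hr : 0 < r) (hrR : r < R) : 0 < constA d r R := by
  have : 0 < R - r := sub_pos.2 hrR
  have : 0 < R + r := by linarith
  unfold constA
  positivity

theorem two_mul_pow_le_constA {d : ℕ} {r R : ℝ} (hr : 0 < r) (hrR : r < R) :
    2 * ((R + r) / (R - r)) ^ (d - 1) ≤ constA d r R := by
  have : 0 < R - r := sub_pos.2 hrR
  have : 0 < R + r := by linarith
  unfold constA
  exact le_mul_of_one_le_right (by positivity) (le_max_left _ _)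

/-- The integrand decreases, so the interval may be moved left until it starts at `s - r`. It has
length `2 (R - s)`, and its right half contributes no more than its left half `(s - r, R - r)`.
Translating by `r` turns that half into `(s, R)`, where `τ - r` and `τ` are comparable. -/
theorem radialKernel_near_le {d : ℕ} {r R s t : ℝ} (hr : 0 < r) (hrR : r < R)
    (hs : (R + r) / 2 < s) (hsR : s < R) (ht : s - r ≤ t) :
    radialKernel d t (t + 2 * (R - s)) ≤
      ENNReal.ofReal (2 * ((R + r) / (R - r)) ^ (d - 1)) * radialKernel d s R := by
  have hb : 0 < R - r := sub_pos.2 hrR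
  have hRr : 0 < R + r := by linarith
  have h1 : radialKernel d t (t + 2 * (R - s)) ≤
      radialKernel d (s - r) (s - r + 2 * (R - s)) := by
    have := radialKernel_add_le d (a := s - r) (b := s - r + 2 * (R - s)) (c := t - (s - r))
      (by linarith) (by linarith)
    rwa [show s - r + (t - (s - r)) = t by ring,
      show s - r + 2 * (R - s) + (t - (s - r)) = t + 2 * (R - s) by ring] at this
  have h2 : radialKernel d (s - r) (s - r + 2 * (R - s)) ≤
      2 * radialKernel d (s - r) (R - r) := by
    refine (radialKernel_le_add d _ (R - r) _).trans ?_
    rw [two_mul (radialKernel d (s - r) (R - r))]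
    refine add_le_add le_rfl ?_
    have := radialKernel_add_le d (a := s - r) (b := R - r) (c := R - s)
      (by linarith) (by linarith)
    rwa [show s - r + (R - s) = R - r by ring, show R - r + (R - s) = s - r + 2 * (R - s) by ring]
      at this
  have h3 : radialKernel d (s - r) (R - r) ≤
      ENNReal.ofReal (((R + r) / (R - r)) ^ (d - 1)) * radialKernel d s R := by
    have e := setLIntegral_Ioo_add_right (fun t => (ENNReal.ofReal (t ^ (d - 1)))⁻¹) s R (-r)
    rw [← sub_eq_add_neg, ← sub_eq_add_neg] at e
    rw [radialKernel, radialKernel, ← e, ← lintegral_const_mul' _ _ ENNReal.ofReal_ne_top]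
    refine setLIntegral_mono' measurableSet_Ioo fun τ hτ => ?_
    have hτ0 : 0 < τ := by linarith [hτ.1]
    have hτr : 0 < τ + -r := by linarith [hτ.1]
    -- Equality holds exactly at `τ = (R + r) / 2`; this is why the threshold for `s` is the
    -- midpoint of `r` and `R`.
    have hk : (R - r) / (R + r) * τ ≤ τ + -r := by
      rw [div_mul_eq_mul_div, div_le_iff₀ hRr]
      nlinarith [hτ.1]
    rw [← ENNReal.ofReal_inv_of_pos (by positivity), ← ENNReal.ofReal_inv_of_pos (by positivity),
      ← ENNReal.ofReal_mul (by positivity)]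
    apply ENNReal.ofReal_le_ofReal
    rw [← inv_pow, ← inv_pow, ← mul_pow]
    gcongr
    rw [← inv_div, ← mul_inv]
    gcongr
  calc _ ≤ 2 * radialKernel d (s - r) (R - r) := h1.trans h2
    _ ≤ 2 * (ENNReal.ofReal (((R + r) / (R - r)) ^ (d - 1)) * radialKernel d s R) := by gcongr
    _ = _ := by
      rw [ENNReal.ofReal_mul zero_le_two, mul_assoc]
      simp

/-- The comparison of the Green function of the ball (through the distance `t` and the reflected
distance `m`) with the kernel of the integrated counting function. -/
theorem radialKernel_le_constA_mul {d : ℕ} (hd : 2 ≤ d) {r R s t m : ℝ} (hr : 0 < r) (hrR : r < R)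
    (hrs : r ≤ s) (hsR : s < R) (hm : m ≤ R + r) (hm' : (R + r) / 2 < s → m ≤ t + 2 * (R - s))
    (ht : s - r ≤ t) :
    radialKernel d t m ≤ ENNReal.ofReal (constA d r R) * radialKernel d s R *
      (1 + radialKernel d t (R + r)) := by
  have hb : 0 < R - r := sub_pos.2 hrR
  have hR : 0 < R := hr.trans hrR
  have hRr : 0 < R + r := by linarith
  -- For `s` in the inner half, `constA` times the kernel over `(s, R)` is already at least `1`, and
  -- the last factor alone dominates; the maximum in `constA` compensates here for the lack of scale
  -- invariance. For `s` in the outer half the interval `(t, m)` is short, of length at most `2 (R -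
  -- s)`.
  rcases le_or_gt s ((R + r) / 2) with hs | hs
  · have h1 : 1 ≤ ENNReal.ofReal (constA d r R) * radialKernel d s R := by
      refine le_trans ?_ (mul_le_mul_right (ofReal_le_radialKernel d (hr.le.trans hrs) hR) _)
      rw [← ENNReal.ofReal_mul (constA_pos hr hrR).le, ENNReal.one_le_ofReal]
      obtain ⟨n, rfl⟩ : ∃ n, d = n + 2 := ⟨d - 2, by omega⟩
      have e1 : n + 2 - 1 = n + 1 := by omega
      have e2 : n + 2 - 2 = n := by omega
      unfold constA
      rw [e1, e2]
      have hmax : (R - r) ^ n ≤ max 1 ((R - r) ^ n) := le_max_right _ _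
      have hsb : (R - r) / 2 ≤ R - s := by linarith
      calc (1 : ℝ) ≤ ((R + r) / R) ^ (n + 1) := by
            apply one_le_pow₀
            rw [le_div_iff₀ hR]
            linarith
        _ = 2 * ((R + r) / (R - r)) ^ (n + 1) * (R - r) ^ n * (((R - r) / 2) / R ^ (n + 1)) := by
            rw [div_pow, div_pow, pow_succ (R - r)]
            field_simp
        _ ≤ _ := by gcongr
    calc radialKernel d t m ≤ radialKernel d t (R + r) := radialKernel_mono d le_rfl hm
      _ ≤ 1 + radialKernel d t (R + r) := le_add_self
      _ ≤ _ := le_mul_of_one_le_left (zero_le) h1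
  · calc radialKernel d t m ≤ radialKernel d t (t + 2 * (R - s)) :=
          radialKernel_mono d le_rfl (hm' hs)
      _ ≤ ENNReal.ofReal (2 * ((R + r) / (R - r)) ^ (d - 1)) * radialKernel d s R :=
          radialKernel_near_le hr hrR hs hsR ht
      _ ≤ ENNReal.ofReal (constA d r R) * radialKernel d s R := by
          gcongr
          exact two_mul_pow_le_constA hr hrR
      _ ≤ _ := le_mul_of_one_le_right (zero_le) (by simp)

end RadialKernel

end DeltaSubharmonic

namespace DeltaSubharmonic

/-! ### The Green function of the ball. -/

section Green

variable {E : Type*} [NormedAddCommGroup E] [InnerProductSpace ℝ E]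

/-- The square of the reflected distance `|y| |x - y*| / R`, where `y* = R² y / |y|²`. -/
noncomputable def mirrorSq (R : ℝ) (x y : E) : ℝ :=
  R ^ 2 - 2 * ⟪x, y⟫ + ‖x‖ ^ 2 * ‖y‖ ^ 2 / R ^ 2

/-- In this form the sign of `(R² - ‖x‖²)(R² - ‖y‖²)` decides which of the direct and the reflected
distance is larger, with equality when either point lies on the sphere. -/
theorem mirrorSq_eq {R : ℝ} (hR : R ≠ 0) (x y : E) :
    mirrorSq R x y = ‖x - y‖ ^ 2 + (R ^ 2 - ‖x‖ ^ 2) * (R ^ 2 - ‖y‖ ^ 2) / R ^ 2 := by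
  rw [mirrorSq, @norm_sub_sq_real]
  field_simp
  ring

theorem sq_le_mirrorSq {R : ℝ} (hR : R ≠ 0) (x y : E) :
    (R - ‖x‖ * ‖y‖ / R) ^ 2 ≤ mirrorSq R x y := by
  have h := real_inner_le_norm x y
  have : (R - ‖x‖ * ‖y‖ / R) ^ 2 = R ^ 2 - 2 * (‖x‖ * ‖y‖) + ‖x‖ ^ 2 * ‖y‖ ^ 2 / R ^ 2 := by
    field_simp
    ring
  rw [this, mirrorSq]
  linarith

theorem mirrorSq_le_sq {R : ℝ} (hR : R ≠ 0) (x y : E) :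
    mirrorSq R x y ≤ (R + ‖x‖ * ‖y‖ / R) ^ 2 := by
  have h := neg_le_of_abs_le (abs_real_inner_le_norm x y)
  have : (R + ‖x‖ * ‖y‖ / R) ^ 2 = R ^ 2 + 2 * (‖x‖ * ‖y‖) + ‖x‖ ^ 2 * ‖y‖ ^ 2 / R ^ 2 := by
    field_simp
    ring
  rw [this, mirrorSq]
  linarith

theorem mirrorSq_nonneg {R : ℝ} (hR : R ≠ 0) (x y : E) : 0 ≤ mirrorSq R x y :=
  (sq_nonneg _).trans (sq_le_mirrorSq hR x y)

theorem mirrorSq_eq_of_norm_eq {R : ℝ} (hR : R ≠ 0) {x y : E} (hy : ‖y‖ = R) :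
    mirrorSq R x y = ‖x - y‖ ^ 2 := by
  simp [mirrorSq_eq hR, hy]

theorem sqrt_mirrorSq_le {R r : ℝ} (hR : 0 < R) {x y : E} (hx : ‖x‖ ≤ r) (hy : ‖y‖ ≤ R) :
    √(mirrorSq R x y) ≤ R + r := by
  have hr : 0 ≤ r := (norm_nonneg x).trans hx
  refine Real.sqrt_le_iff.2 ⟨by linarith, (mirrorSq_le_sq hR.ne' x y).trans ?_⟩
  gcongr
  rw [div_le_iff₀ hR]
  gcongr

/-- With `δ = R - ‖y‖` and `t = ‖x - y‖` one has `R - ‖x‖ ≤ δ + t`, so the product term of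
`mirrorSq_eq` is at most `4 δ (δ + t)`, which completes `t²` to `(t + 2 δ)²`. -/
theorem sqrt_mirrorSq_le_add {R : ℝ} (hR : 0 < R) {x y : E} (hx : ‖x‖ ≤ R) (hy : ‖y‖ ≤ R) :
    √(mirrorSq R x y) ≤ ‖x - y‖ + 2 * (R - ‖y‖) := by
  have ht := norm_nonneg (x - y)
  have h1 : R - ‖x‖ ≤ R - ‖y‖ + ‖x - y‖ := by linarith [norm_sub_norm_le y x, norm_sub_rev x y]
  refine Real.sqrt_le_iff.2 ⟨by linarith, ?_⟩
  rw [mirrorSq_eq hR.ne']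
  have h2 : (R ^ 2 - ‖x‖ ^ 2) * (R ^ 2 - ‖y‖ ^ 2) / R ^ 2 ≤
      4 * ((R - ‖y‖) * (R - ‖y‖ + ‖x - y‖)) := by
    rw [div_le_iff₀ (by positivity)]
    have e : (R ^ 2 - ‖x‖ ^ 2) * (R ^ 2 - ‖y‖ ^ 2) =
      ((R + ‖x‖) * (R + ‖y‖)) * ((R - ‖y‖) * (R - ‖x‖)) := by ring
    have h3 : (R + ‖x‖) * (R + ‖y‖) ≤ 4 * R ^ 2 := by
      nlinarith [norm_nonneg x, norm_nonneg y]
    have h4 : (R - ‖y‖) * (R - ‖x‖) ≤ (R - ‖y‖) * (R - ‖y‖ + ‖x - y‖) :=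
      mul_le_mul_of_nonneg_left h1 (by linarith)
    have h5 : 0 ≤ (R - ‖y‖) * (R - ‖x‖) := mul_nonneg (by linarith) (by linarith)
    rw [e]
    calc _ ≤ (4 * R ^ 2) * ((R - ‖y‖) * (R - ‖y‖ + ‖x - y‖)) :=
          mul_le_mul h3 h4 h5 (by positivity)
      _ = _ := by ring
  nlinarith

theorem sqrt_mirrorSq_le_norm_sub {R : ℝ} (hR : 0 < R) {x y : E} (hx : ‖x‖ ≤ R) (hy : R ≤ ‖y‖) :
    √(mirrorSq R x y) ≤ ‖x - y‖ := by
  refine Real.sqrt_le_iff.2 ⟨norm_nonneg _, ?_⟩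
  rw [mirrorSq_eq hR.ne']
  have h1 : 0 ≤ R ^ 2 - ‖x‖ ^ 2 := by nlinarith [norm_nonneg x]
  have h2 : R ^ 2 - ‖y‖ ^ 2 ≤ 0 := by nlinarith [norm_nonneg x]
  have := div_nonpos_of_nonpos_of_nonneg (mul_nonpos_of_nonneg_of_nonpos h1 h2) (sq_nonneg R)
  linarith

theorem norm_sub_le_sqrt_mirrorSq {R : ℝ} (hR : 0 < R) {x y : E} (hx : ‖x‖ ≤ R) (hy : ‖y‖ ≤ R) :
    ‖x - y‖ ≤ √(mirrorSq R x y) := by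
  refine Real.le_sqrt_of_sq_le ?_
  rw [mirrorSq_eq hR.ne']
  have h1 : 0 ≤ R ^ 2 - ‖x‖ ^ 2 := by nlinarith [norm_nonneg x]
  have h2 : 0 ≤ R ^ 2 - ‖y‖ ^ 2 := by nlinarith [norm_nonneg y]
  have : 0 ≤ (R ^ 2 - ‖x‖ ^ 2) * (R ^ 2 - ‖y‖ ^ 2) / R ^ 2 := by positivity
  linarith

/-- The Green function of the ball of radius `R` divided by `max {1, d - 2}`, extended by zero
outside of the ball. -/
noncomputable def green (d : ℕ) (R : ℝ) (x y : E) : ℝ≥0∞ :=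
  radialKernel d ‖x - y‖ √(mirrorSq R x y)

theorem green_eq_zero {d : ℕ} {R : ℝ} (hR : 0 < R) {x y : E} (hx : ‖x‖ ≤ R) (hy : R ≤ ‖y‖) :
    green d R x y = 0 :=
  radialKernel_eq_zero d (sqrt_mirrorSq_le_norm_sub hR hx hy)

/-- The radial comparison is applied with `s = max ‖y‖ r`: the cut-off at `r` makes the resulting
potential see only radii above `r`, as the counting function does. When `s` exceeds the midpoint of
`r` and `R` it equals `‖y‖`, so the short-interval bound is available. -/
theorem green_le {d : ℕ} (hd : 2 ≤ d) {r R : ℝ} (hr : 0 < r) (hrR : r < R) {x y : E}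
    (hx : ‖x‖ ≤ r) (hy : ‖y‖ < R) :
    green d R x y ≤ ENNReal.ofReal (constA d r R) * radialKernel d (max ‖y‖ r) R *
      (1 + radialKernel d ‖x - y‖ (R + r)) := by
  have hR := hr.trans hrR
  refine radialKernel_le_constA_mul hd hr hrR (le_max_right _ _) (max_lt hy hrR)
    (sqrt_mirrorSq_le hR hx hy.le) (fun h => ?_) ?_
  · rcases max_cases ‖y‖ r with ⟨h1, -⟩ | ⟨h1, -⟩
    · rw [h1]
      exact sqrt_mirrorSq_le_add hR (hx.trans hrR.le) hy.le
    · rw [h1] at h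
      linarith
  · rcases max_cases ‖y‖ r with ⟨h1, -⟩ | ⟨h1, -⟩
    · rw [h1]
      linarith [norm_sub_norm_le y x, norm_sub_rev x y]
    · rw [h1, sub_self]
      exact norm_nonneg _

/-! ### Integrals of the kernels against measures. -/

section Integrals

variable [MeasurableSpace E] [BorelSpace E] [SecondCountableTopology E]

theorem measurable_radialKernel {α : Type*} [MeasurableSpace α] (d : ℕ) {f g : α → ℝ}
    (hf : Measurable f) (hg : Measurable g) :
    Measurable fun x => radialKernel d (f x) (g x) := by
  have h : (fun x => radialKernel d (f x) (g x)) = fun x =>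
      ∫⁻ t, {p : α × ℝ | p.2 ∈ Ioo (f p.1) (g p.1)}.indicator
        (fun p => (ENNReal.ofReal (p.2 ^ (d - 1)))⁻¹) (x, t) := by
    ext x
    rw [radialKernel, ← lintegral_indicator measurableSet_Ioo]
    rfl
  rw [h]
  apply Measurable.lintegral_prod_right'
  refine Measurable.indicator (by fun_prop) ?_
  exact (measurableSet_lt (hf.comp measurable_fst) measurable_snd).inter
    (measurableSet_lt measurable_snd (hg.comp measurable_fst))

theorem continuous_mirrorSq (R : ℝ) : Continuous fun p : E × E => mirrorSq R p.1 p.2 := by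
  unfold mirrorSq
  fun_prop

theorem measurable_green (d : ℕ) (R : ℝ) : Measurable fun p : E × E => green d R p.1 p.2 := by
  refine measurable_radialKernel d ?_ ?_
  · exact (continuous_fst.sub continuous_snd).norm.measurable
  · exact (continuous_mirrorSq R).sqrt.measurable

/-- Layer-cake formula: Tonelli on the region `f x < t < b`. -/
theorem lintegral_radialKernel {α : Type*} [MeasurableSpace α] (d : ℕ) (μ : Measure α) [SFinite μ]
    {f : α → ℝ} (hf : Measurable f) (b : ℝ) :
    ∫⁻ x, radialKernel d (f x) b ∂μ =
      ∫⁻ t in Iio b, μ {x | f x < t} * (ENNReal.ofReal (t ^ (d - 1)))⁻¹ := by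
  have h : ∀ x, radialKernel d (f x) b = ∫⁻ t in Iio b, {p : α × ℝ | f p.1 < p.2}.indicator
      (fun p => (ENNReal.ofReal (p.2 ^ (d - 1)))⁻¹) (x, t) := by
    intro x
    rw [radialKernel, ← lintegral_indicator measurableSet_Ioo,
      ← lintegral_indicator measurableSet_Iio]
    refine lintegral_congr fun t => ?_
    by_cases h1 : t < b <;> by_cases h2 : f x < t <;> simp [indicator, h1, h2]
  simp_rw [h]
  rw [lintegral_lintegral_swap]
  · refine lintegral_congr fun t => ?_
    rw [mul_comm, ← lintegral_indicator_const (measurableSet_lt hf measurable_const)]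
    rfl
  · refine (Measurable.indicator (by fun_prop) ?_).aemeasurable
    exact measurableSet_lt (hf.comp measurable_fst) measurable_snd

/-- After the layer-cake formula the sublevel sets are balls centred at `y`, so the modulus of
continuity bounds their mass uniformly in `y`. -/
theorem lintegral_radialKernel_norm_sub_le (d : ℕ) (μ : Measure E) [SFinite μ] (y : E) (b : ℝ) :
    ∫⁻ x, radialKernel d ‖x - y‖ b ∂μ ≤ diniIntegral d μ b := by
  rw [lintegral_radialKernel d μ (by fun_prop) b, diniIntegral,
    ← lintegral_indicator measurableSet_Iio, ← lintegral_indicator measurableSet_Ioc]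
  refine lintegral_mono fun t => ?_
  by_cases h1 : t ∈ Iio b
  · by_cases h2 : 0 < t
    · rw [indicator_of_mem h1, indicator_of_mem (show t ∈ Ioc 0 b from ⟨h2, le_of_lt h1⟩),
        div_eq_mul_inv]
      gcongr
      refine le_trans (measure_mono fun x hx => ?_) (le_iSup (fun y => μ (closedBall y t)) y)
      rw [mem_closedBall, dist_eq_norm]
      exact le_of_lt hx
    · have : {x : E | ‖x - y‖ < t} = ∅ := by
        ext x
        simpa using (not_lt.1 h2).trans (norm_nonneg _)
      rw [indicator_of_mem h1, this]
      simp
  · rw [indicator_of_notMem h1]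
    exact zero_le

/-- The integral of the Green function with respect to a measure with a finite Dini integral. -/
theorem lintegral_green_le {d : ℕ} (hd : 2 ≤ d) {r R : ℝ} (hr : 0 < r) (hrR : r < R)
    (μ : Measure E) [SFinite μ] (hμ : μ (closedBall 0 r)ᶜ = 0) {y : E} (hy : ‖y‖ < R) :
    ∫⁻ x, green d R x y ∂μ ≤ ENNReal.ofReal (constA d r R) * radialKernel d (max ‖y‖ r) R *
      (μ univ + diniIntegral d μ (R + r)) := by
  have hae : ∀ᵐ x ∂μ, x ∈ closedBall (0 : E) r := hμ
  have hm : Measurable fun x : E => radialKernel d ‖x - y‖ (R + r) :=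
    measurable_radialKernel d (by fun_prop) measurable_const
  calc ∫⁻ x, green d R x y ∂μ
      ≤ ∫⁻ x, ENNReal.ofReal (constA d r R) * radialKernel d (max ‖y‖ r) R *
          (1 + radialKernel d ‖x - y‖ (R + r)) ∂μ := by
        refine lintegral_mono_ae ?_
        filter_upwards [hae] with x hx
        exact green_le hd hr hrR (by simpa using hx) hy
    _ = ENNReal.ofReal (constA d r R) * radialKernel d (max ‖y‖ r) R *
          (μ univ + ∫⁻ x, radialKernel d ‖x - y‖ (R + r) ∂μ) := by
        rw [lintegral_const_mul _ (by fun_prop), lintegral_add_left measurable_const]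
        simp
    _ ≤ _ := by
        gcongr
        exact lintegral_radialKernel_norm_sub_le d μ y _

/-- The set `max ‖y‖ r < t` is empty for `t ≤ r` and lies in the ball of radius `t` otherwise. This
is where the counting function appears. -/
theorem lintegral_radialKernel_max_le (d : ℕ) (ν : Measure E) [SFinite ν] (r R : ℝ) :
    ∫⁻ y, radialKernel d (max ‖y‖ r) R ∂ν ≤
      ∫⁻ t in Ioo r R, ν (closedBall 0 t) / ENNReal.ofReal (t ^ (d - 1)) := by
  rw [lintegral_radialKernel d ν (by fun_prop) R, ← lintegral_indicator measurableSet_Iio,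
    ← lintegral_indicator measurableSet_Ioo]
  refine lintegral_mono fun t => ?_
  by_cases h1 : t < R
  · rw [indicator_of_mem (show t ∈ Iio R from h1)]
    by_cases h2 : r < t
    · rw [indicator_of_mem (show t ∈ Ioo r R from ⟨h2, h1⟩), div_eq_mul_inv]
      gcongr
      intro x hx
      have : ‖x‖ < t := (le_max_left _ _).trans_lt hx
      simpa using this.le
    · have : {x : E | max ‖x‖ r < t} = ∅ := by
        ext x
        simpa using fun _ => not_lt.1 h2
      rw [this]
      simp
  · rw [indicator_of_notMem (show t ∉ Iio R from h1)]
    exact zero_le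

/-- The Dini condition at zero makes the Dini integral finite over every bounded interval. -/
theorem diniIntegral_lt_top {d : ℕ} {μ : Measure E} (hμ : μ univ < ∞) (h : DiniCondition d μ)
    (a : ℝ) : diniIntegral d μ a < ∞ := by
  obtain ⟨ε, hε, hfin⟩ := h
  have hsub : Ioc 0 a ⊆ Ioc 0 ε ∪ Ioc ε a := fun t ht => by
    rcases le_or_gt t ε with h | h
    · exact Or.inl ⟨ht.1, h⟩
    · exact Or.inr ⟨h, ht.2⟩
  have h2 : ∫⁻ t in Ioc ε a, modulus μ t / ENNReal.ofReal (t ^ (d - 1)) < ∞ := by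
    calc _ ≤ ∫⁻ _ in Ioc ε a, μ univ / ENNReal.ofReal (ε ^ (d - 1)) := by
          refine setLIntegral_mono' measurableSet_Ioc fun t ht => ?_
          have := ht.1
          gcongr
          exact iSup_le fun y => measure_mono (subset_univ _)
      _ < ∞ := by
          rw [setLIntegral_const]
          refine ENNReal.mul_lt_top (ENNReal.div_lt_top hμ.ne ?_) (by simp)
          simpa using pow_pos hε _
  refine (lintegral_mono_set hsub).trans_lt ((lintegral_union_le _ _ _).trans_lt ?_)
  exact ENNReal.add_lt_top.2 ⟨hfin, h2⟩

end Integrals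

end Green

end DeltaSubharmonic

namespace DeltaSubharmonic

/-! ### Green's second identity with a cut-off function. -/

section GreenIdentity

variable {E : Type*} [NormedAddCommGroup E] [InnerProductSpace ℝ E] [FiniteDimensional ℝ E]

theorem laplacian_eq_sum_fderiv {f : E → ℝ} (hf : ContDiff ℝ 2 f) (x : E) :
    Laplacian.laplacian f x = ∑ i, fderiv ℝ (fun y => fderiv ℝ f y (stdOrthonormalBasis ℝ E i)) x
      (stdOrthonormalBasis ℝ E i) := by
  rw [InnerProductSpace.laplacian_eq_iteratedFDeriv_stdOrthonormalBasis]
  refine Finset.sum_congr rfl fun i _ => ?_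
  rw [iteratedFDeriv_two_apply]
  have hd : DifferentiableAt ℝ (fderiv ℝ f) x :=
    (hf.fderiv_right (m := 1) (by norm_num)).differentiable (by norm_num) x
  rw [fderiv_clm_apply hd (differentiableAt_const _)]
  simp

theorem contDiff_fderiv_apply_const {n m : WithTop ℕ∞} {f : E → ℝ} (hf : ContDiff ℝ n f)
    (h : m + 1 ≤ n) (v : E) : ContDiff ℝ m fun y => fderiv ℝ f y v :=
  (hf.fderiv_right h).clm_apply contDiff_const

theorem continuous_laplacian {f : E → ℝ} (hf : ContDiff ℝ 2 f) :
    Continuous (Laplacian.laplacian f) := by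
  rw [funext (laplacian_eq_sum_fderiv hf)]
  refine continuous_finsetSum _ fun i _ => ?_
  exact (contDiff_fderiv_apply_const (m := 0)
    (contDiff_fderiv_apply_const (m := 1) hf (by norm_num) _) (by norm_num) _).continuous

theorem two_le_smooth : (2 : WithTop ℕ∞) ≤ ((⊤ : ℕ∞) : WithTop ℕ∞) :=
  WithTop.coe_le_coe.2 (le_top : (2 : ℕ∞) ≤ ⊤)

theorem sum_inner_mul_clm (L : E →L[ℝ] ℝ) (x : E) :
    ∑ i, ⟪x, stdOrthonormalBasis ℝ E i⟫ * L (stdOrthonormalBasis ℝ E i) = L x := by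
  conv_rhs => rw [← (stdOrthonormalBasis ℝ E).sum_repr' x, map_sum]
  refine Finset.sum_congr rfl fun i _ => ?_
  rw [map_smul, smul_eq_mul, real_inner_comm]

theorem tsupport_laplacian_subset {f : E → ℝ} (hf : ContDiff ℝ 2 f) :
    tsupport (Laplacian.laplacian f) ⊆ tsupport f := by
  refine closure_minimal (fun x hx => ?_) (isClosed_tsupport f)
  by_contra h
  apply hx
  rw [laplacian_eq_sum_fderiv hf]
  refine Finset.sum_eq_zero fun i _ => ?_
  have h0 : (fun y => fderiv ℝ f y (stdOrthonormalBasis ℝ E i)) =ᶠ[𝓝 x] fun _ => 0 := by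
    have h1 : ∀ᶠ y in 𝓝 x, y ∉ tsupport f := (isClosed_tsupport f).isOpen_compl.mem_nhds h
    filter_upwards [h1] with y hy
    have : fderiv ℝ f y = 0 := by
      by_contra h2
      exact hy (support_fderiv_subset ℝ h2)
    simp [this]
  rw [h0.fderiv_eq]
  simp

variable [MeasurableSpace E] [BorelSpace E]

theorem integral_mul_fderiv_eq_neg {f g : E → ℝ} (hf : ContDiff ℝ 1 f) (hc : HasCompactSupport f)
    (hg : ContDiff ℝ 1 g) (v : E) :
    ∫ x, f x * fderiv ℝ g x v = -∫ x, fderiv ℝ f x v * g x := by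
  have hf' : Continuous fun x => fderiv ℝ f x v :=
    (contDiff_fderiv_apply_const (m := 0) hf (by norm_num) v).continuous
  have hg' : Continuous fun x => fderiv ℝ g x v :=
    (contDiff_fderiv_apply_const (m := 0) hg (by norm_num) v).continuous
  refine integral_mul_fderiv_eq_neg_fderiv_mul_of_integrable ?_ ?_ ?_ ?_ ?_
  · exact (hf'.mul hg.continuous).integrable_of_hasCompactSupport
      ((hc.fderiv_apply ℝ v).mul_right)
  · exact (hf.continuous.mul hg').integrable_of_hasCompactSupport hc.mul_right
  · exact (hf.continuous.mul hg.continuous).integrable_of_hasCompactSupport hc.mul_right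
  · exact fun x _ => hf.differentiable (by norm_num) x
  · exact fun x _ => hg.differentiable (by norm_num) x

/-- Green's second identity, localized by a cut-off function. -/
theorem integral_cutoff_mul_green {a b χ : E → ℝ} (ha : ContDiff ℝ 2 a) (hb : ContDiff ℝ 2 b)
    (hχ : ContDiff ℝ 1 χ) (hc : HasCompactSupport χ) :
    ∫ x, χ x * (a x * Laplacian.laplacian b x - b x * Laplacian.laplacian a x) =
      -∫ x, ∑ i, fderiv ℝ χ x (stdOrthonormalBasis ℝ E i) *
        (a x * fderiv ℝ b x (stdOrthonormalBasis ℝ E i) -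
          b x * fderiv ℝ a x (stdOrthonormalBasis ℝ E i)) := by
  set v := stdOrthonormalBasis ℝ E
  have ha1 : ContDiff ℝ 1 a := ha.of_le (by norm_num)
  have hb1 : ContDiff ℝ 1 b := hb.of_le (by norm_num)
  have hda : ∀ i, ContDiff ℝ 1 fun y => fderiv ℝ a y (v i) := fun i =>
    contDiff_fderiv_apply_const ha (by norm_num) _
  have hdb : ∀ i, ContDiff ℝ 1 fun y => fderiv ℝ b y (v i) := fun i =>
    contDiff_fderiv_apply_const hb (by norm_num) _
  have hdda : ∀ i, Continuous fun y => fderiv ℝ (fun y => fderiv ℝ a y (v i)) y (v i) := fun i =>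
    (contDiff_fderiv_apply_const (m := 0) (hda i) (by norm_num) _).continuous
  have hddb : ∀ i, Continuous fun y => fderiv ℝ (fun y => fderiv ℝ b y (v i)) y (v i) := fun i =>
    (contDiff_fderiv_apply_const (m := 0) (hdb i) (by norm_num) _).continuous
  have hdχ : ∀ i, Continuous fun y => fderiv ℝ χ y (v i) := fun i =>
    (contDiff_fderiv_apply_const (m := 0) hχ (by norm_num) _).continuous
  -- One integration by parts with `χ a` against `∂b` and one with `χ b` against `∂a`; the terms `χ
  -- ∂a ∂b` cancel and only the derivative of `χ` survives.
  have key : ∀ i, ∫ x, χ x * (a x * fderiv ℝ (fun y => fderiv ℝ b y (v i)) x (v i) -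
      b x * fderiv ℝ (fun y => fderiv ℝ a y (v i)) x (v i)) =
      -∫ x, fderiv ℝ χ x (v i) * (a x * fderiv ℝ b x (v i) - b x * fderiv ℝ a x (v i)) := by
    intro i
    have h1 := integral_mul_fderiv_eq_neg (hχ.mul ha1) (hc.mul_right) (hdb i) (v i)
    have h2 := integral_mul_fderiv_eq_neg (hχ.mul hb1) (hc.mul_right) (hda i) (v i)
    have e1 : ∀ x, fderiv ℝ (fun y => χ y * a y) x (v i) =
        χ x * fderiv ℝ a x (v i) + a x * fderiv ℝ χ x (v i) := fun x => by
      rw [fderiv_fun_mul (hχ.differentiable (by norm_num) x) (ha1.differentiable (by norm_num) x)]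
      simp
    have e2 : ∀ x, fderiv ℝ (fun y => χ y * b y) x (v i) =
        χ x * fderiv ℝ b x (v i) + b x * fderiv ℝ χ x (v i) := fun x => by
      rw [fderiv_fun_mul (hχ.differentiable (by norm_num) x) (hb1.differentiable (by norm_num) x)]
      simp
    simp only [e1, e2] at h1 h2
    have hcs : ∀ {g : E → ℝ}, Continuous g → Integrable fun x => χ x * g x := fun hg =>
      (hχ.continuous.mul hg).integrable_of_hasCompactSupport hc.mul_right
    have hcs' : ∀ {g : E → ℝ}, Continuous g → Integrable fun x => fderiv ℝ χ x (v i) * g x :=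
      fun hg => ((hdχ i).mul hg).integrable_of_hasCompactSupport (hc.fderiv_apply ℝ (v i)).mul_right
    calc _ = (∫ x, χ x * a x * fderiv ℝ (fun y => fderiv ℝ b y (v i)) x (v i)) -
          ∫ x, χ x * b x * fderiv ℝ (fun y => fderiv ℝ a y (v i)) x (v i) := by
          rw [← integral_sub]
          · refine integral_congr_ae (Eventually.of_forall fun x => ?_)
            simp only
            ring
          · simpa only [mul_assoc, Pi.mul_apply] using hcs (ha.continuous.mul (hddb i))
          · simpa only [mul_assoc, Pi.mul_apply] using hcs (hb.continuous.mul (hdda i))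
      _ = _ := by
          rw [h1, h2, ← neg_sub', ← integral_sub]
          · congr 1
            refine integral_congr_ae (Eventually.of_forall fun x => ?_)
            simp only
            ring
          · have := (hcs ((hda i).continuous.mul (hdb i).continuous)).add
              (hcs' (ha.continuous.mul (hdb i).continuous))
            refine this.congr (Eventually.of_forall fun x => ?_)
            simp only [Pi.add_apply, Pi.mul_apply]
            ring
          · have := (hcs ((hdb i).continuous.mul (hda i).continuous)).add
              (hcs' (hb.continuous.mul (hda i).continuous))
            refine this.congr (Eventually.of_forall fun x => ?_)
            simp only [Pi.add_apply, Pi.mul_apply]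
            ring
  have hcs : ∀ {g : E → ℝ}, Continuous g → Integrable fun x => χ x * g x := fun hg =>
    (hχ.continuous.mul hg).integrable_of_hasCompactSupport hc.mul_right
  calc _ = ∫ x, ∑ i, χ x * (a x * fderiv ℝ (fun y => fderiv ℝ b y (v i)) x (v i) -
      b x * fderiv ℝ (fun y => fderiv ℝ a y (v i)) x (v i)) := by
        refine integral_congr_ae (Eventually.of_forall fun x => ?_)
        simp only
        rw [laplacian_eq_sum_fderiv ha, laplacian_eq_sum_fderiv hb, Finset.mul_sum,
          Finset.mul_sum, ← Finset.sum_sub_distrib, Finset.mul_sum]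
    _ = ∑ i, ∫ x, χ x * (a x * fderiv ℝ (fun y => fderiv ℝ b y (v i)) x (v i) -
      b x * fderiv ℝ (fun y => fderiv ℝ a y (v i)) x (v i)) := by
        refine integral_finsetSum _ fun i _ => hcs ?_
        exact (ha.continuous.mul (hddb i)).sub (hb.continuous.mul (hdda i))
    _ = _ := by
        rw [integral_finsetSum, ← Finset.sum_neg_distrib]
        · exact Finset.sum_congr rfl fun i _ => key i
        · intro i _
          refine Continuous.integrable_of_hasCompactSupport ?_ (hc.fderiv_apply ℝ (v i)).mul_right
          exact (hdχ i).mul ((ha.continuous.mul (hdb i).continuous).sub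
            (hb.continuous.mul (hda i).continuous))

/-- Symmetry of the Laplacian on compactly supported test functions. -/
theorem integral_mul_laplacian_comm {a φ : E → ℝ} (ha : ContDiff ℝ 2 a) (hφ : ContDiff ℝ 2 φ)
    (hc : HasCompactSupport φ) :
    ∫ x, φ x * Laplacian.laplacian a x = ∫ x, a x * Laplacian.laplacian φ x := by
  have hda : ∀ v, ContDiff ℝ 1 fun y => fderiv ℝ a y v := fun v =>
    contDiff_fderiv_apply_const ha (by norm_num) _
  have hdφ : ∀ v, ContDiff ℝ 1 fun y => fderiv ℝ φ y v := fun v =>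
    contDiff_fderiv_apply_const hφ (by norm_num) _
  have hdda : ∀ v, Continuous fun y => fderiv ℝ (fun y => fderiv ℝ a y v) y v := fun v =>
    (contDiff_fderiv_apply_const (m := 0) (hda v) (by norm_num) _).continuous
  have hddφ : ∀ v, Continuous fun y => fderiv ℝ (fun y => fderiv ℝ φ y v) y v := fun v =>
    (contDiff_fderiv_apply_const (m := 0) (hdφ v) (by norm_num) _).continuous
  simp only [laplacian_eq_sum_fderiv ha, laplacian_eq_sum_fderiv hφ, Finset.mul_sum]
  rw [integral_finsetSum, integral_finsetSum]
  · refine Finset.sum_congr rfl fun i _ => ?_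
    set v := stdOrthonormalBasis ℝ E i
    rw [integral_mul_fderiv_eq_neg (hφ.of_le (by norm_num)) hc (hda v) v,
      integral_mul_fderiv_eq_neg (hdφ v) (hc.fderiv_apply ℝ v) (ha.of_le (by norm_num)) v, neg_neg]
    simp only [mul_comm (a _)]
  · intro i _
    exact (ha.continuous.mul (hddφ _)).integrable_of_hasCompactSupport
      (((hc.fderiv_apply ℝ _).fderiv_apply ℝ _).mul_left)
  · intro i _
    exact (hφ.continuous.mul (hdda _)).integrable_of_hasCompactSupport hc.mul_right

theorem fderiv_comp_norm_sq {θ : ℝ → ℝ} (hθ : Differentiable ℝ θ) (x v : E) :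
    fderiv ℝ (fun y => θ (‖y‖ ^ 2)) x v = 2 * deriv θ (‖x‖ ^ 2) * ⟪x, v⟫ := by
  have h1 : HasFDerivAt (fun y : E => ‖y‖ ^ 2) (2 • (innerSL ℝ x)) x := by
    simpa using (hasStrictFDerivAt_norm_sq x).hasFDerivAt
  have h2 := (hθ (‖x‖ ^ 2)).hasDerivAt.comp_hasFDerivAt x h1
  have h3 : (fun y => θ (‖y‖ ^ 2)) = θ ∘ fun y : E => ‖y‖ ^ 2 := rfl
  rw [h3, h2.fderiv]
  simp
  ring

/-- Green's second identity with a radial cut-off function. -/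
theorem integral_radial_mul_green [Nontrivial E] {a b : E → ℝ} (ha : ContDiff ℝ 2 a)
    (hb : ContDiff ℝ 2 b) {θ : ℝ → ℝ} (hθ : ContDiff ℝ 1 θ)
    (hc : HasCompactSupport fun x : E => θ (‖x‖ ^ 2)) :
    ∫ x : E, θ (‖x‖ ^ 2) * (a x * Laplacian.laplacian b x - b x * Laplacian.laplacian a x) =
      ∫ t in Ioi (0 : ℝ), -(2 * t * deriv θ (t ^ 2)) * (t ^ (finrank ℝ E - 1) *
        ∫ ω : sphere (0 : E) 1, (a (t • (ω : E)) * fderiv ℝ b (t • (ω : E)) ω -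
          b (t • (ω : E)) * fderiv ℝ a (t • (ω : E)) ω) ∂(surf E)) := by
  have hχ : ContDiff ℝ 1 fun x : E => θ (‖x‖ ^ 2) := hθ.comp (contDiff_norm_sq ℝ)
  rw [integral_cutoff_mul_green ha hb hχ hc]
  have e : ∀ x, ∑ i, fderiv ℝ (fun x : E => θ (‖x‖ ^ 2)) x (stdOrthonormalBasis ℝ E i) *
        (a x * fderiv ℝ b x (stdOrthonormalBasis ℝ E i) -
          b x * fderiv ℝ a x (stdOrthonormalBasis ℝ E i)) =
      2 * deriv θ (‖x‖ ^ 2) * (a x * fderiv ℝ b x x - b x * fderiv ℝ a x x) := by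
    intro x
    have h1 := sum_inner_mul_clm (fderiv ℝ a x) x
    have h2 := sum_inner_mul_clm (fderiv ℝ b x) x
    conv_rhs => rw [← h1, ← h2, Finset.mul_sum, Finset.mul_sum, ← Finset.sum_sub_distrib,
      Finset.mul_sum]
    refine Finset.sum_congr rfl fun i _ => ?_
    rw [fderiv_comp_norm_sq (hθ.differentiable (by norm_num))]
    ring
  have hintg : Integrable fun x : E =>
      2 * deriv θ (‖x‖ ^ 2) * (a x * fderiv ℝ b x x - b x * fderiv ℝ a x x) := by
    have hd : ∀ i, Continuous fun x : E =>
        fderiv ℝ (fun x : E => θ (‖x‖ ^ 2)) x (stdOrthonormalBasis ℝ E i) := fun i =>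
      (contDiff_fderiv_apply_const (m := 0) hχ (by norm_num) _).continuous
    have hda : ∀ i, Continuous fun x : E => fderiv ℝ a x (stdOrthonormalBasis ℝ E i) := fun i =>
      (contDiff_fderiv_apply_const (m := 1) ha (by norm_num) _).continuous
    have hdb : ∀ i, Continuous fun x : E => fderiv ℝ b x (stdOrthonormalBasis ℝ E i) := fun i =>
      (contDiff_fderiv_apply_const (m := 1) hb (by norm_num) _).continuous
    simp_rw [← e]
    refine integrable_finsetSum _ fun i _ => ?_
    refine Continuous.integrable_of_hasCompactSupport ?_ (hc.fderiv_apply ℝ _).mul_right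
    exact (hd i).mul ((ha.continuous.mul (hdb i)).sub (hb.continuous.mul (hda i)))
  simp_rw [e]
  rw [integral_polar hintg, ← integral_neg]
  refine setIntegral_congr_fun measurableSet_Ioi fun t ht => ?_
  have ht0 : (0 : ℝ) < t := ht
  have hn : ∀ ω : sphere (0 : E) 1, ‖t • (ω : E)‖ = t := fun ω => by
    rw [norm_smul, norm_eq_of_mem_sphere, mul_one, Real.norm_of_nonneg ht0.le]
  simp only [hn, map_smul, smul_eq_mul]
  have : ∀ ω : sphere (0 : E) 1, 2 * deriv θ (t ^ 2) *
      (a (t • (ω : E)) * (t * fderiv ℝ b (t • (ω : E)) ω) -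
        b (t • (ω : E)) * (t * fderiv ℝ a (t • (ω : E)) ω)) =
      (2 * t * deriv θ (t ^ 2)) * (a (t • (ω : E)) * fderiv ℝ b (t • (ω : E)) ω -
          b (t • (ω : E)) * fderiv ℝ a (t • (ω : E)) ω) := fun ω => by ring
  simp_rw [this]
  rw [integral_const_mul]
  ring

end GreenIdentity

end DeltaSubharmonic

namespace DeltaSubharmonic

/-! ### Green's second identity on a ball. -/

section GreenIdentityBall

/-- A one-dimensional approximate identity at `R`. It converts the integral of the radial derivative
of the cut-off into the surface integral over the sphere of radius `R`. -/
theorem tendsto_integral_peak {p : ℕ → ℝ → ℝ} {Φ : ℝ → ℝ} {c R : ℝ} (hc : 0 ≤ c)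
    (hp : ∀ n, Continuous (p n))
    (hp0 : ∀ n, ∀ t ∈ Icc 0 c, 0 ≤ p n t) (hp1 : ∀ n, ∫ t in (0 : ℝ)..c, p n t = 1)
    (hpz : ∀ δ > 0, ∀ᶠ n in atTop, ∀ t ∈ Icc 0 c, δ ≤ |t - R| → p n t = 0)
    (hΦ : Continuous Φ) :
    Tendsto (fun n => ∫ t in (0 : ℝ)..c, p n t * Φ t) atTop (𝓝 (Φ R)) := by
  rw [Metric.tendsto_nhds]
  intro ε hε
  obtain ⟨δ, hδ, hδΦ⟩ := Metric.continuousAt_iff.1 (hΦ.continuousAt (x := R)) (ε / 2) (half_pos hε)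
  filter_upwards [hpz δ hδ] with n hn
  have e : (∫ t in (0 : ℝ)..c, p n t * Φ t) - Φ R = ∫ t in (0 : ℝ)..c, p n t * (Φ t - Φ R) := by
    have : ∀ t, p n t * (Φ t - Φ R) = p n t * Φ t - p n t * Φ R := fun t => by ring
    simp_rw [this]
    have h1 : IntervalIntegrable (fun t => p n t * Φ t) volume 0 c :=
      ((hp n).mul hΦ).intervalIntegrable _ _
    have h2 : IntervalIntegrable (fun t => p n t * Φ R) volume 0 c :=
      ((hp n).mul continuous_const).intervalIntegrable _ _
    rw [intervalIntegral.integral_sub h1 h2, intervalIntegral.integral_mul_const, hp1, one_mul]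
  rw [Real.dist_eq, e]
  calc |∫ t in (0 : ℝ)..c, p n t * (Φ t - Φ R)| ≤ ∫ t in (0 : ℝ)..c, p n t * (ε / 2) := by
        rw [← Real.norm_eq_abs]
        refine intervalIntegral.norm_integral_le_of_norm_le hc ?_
          (((hp n).mul continuous_const).intervalIntegrable _ _)
        refine Eventually.of_forall fun t ht => ?_
        have ht' : t ∈ Icc 0 c := Ioc_subset_Icc_self ht
        rw [norm_mul, Real.norm_of_nonneg (hp0 n t ht')]
        by_cases h : δ ≤ |t - R|
        · simp [hn t ht' h]
        · have := hδΦ (x := t) (by rw [Real.dist_eq]; exact not_le.1 h)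
          rw [Real.dist_eq] at this
          exact mul_le_mul_of_nonneg_left this.le (hp0 n t ht')
    _ = ε / 2 := by rw [intervalIntegral.integral_mul_const, hp1, one_mul]
    _ < ε := half_lt_self hε

/-- Smooth decreasing approximation of the indicator function of `(-∞, ρ]`. -/
noncomputable def stepDown (ρ : ℝ) (n : ℕ) (τ : ℝ) : ℝ :=
  Real.smoothTransition ((n + 1) * (ρ - τ) + 1)

theorem stepDown_of_le {ρ τ : ℝ} (n : ℕ) (h : τ ≤ ρ) : stepDown ρ n τ = 1 :=
  Real.smoothTransition.one_of_one_le (by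
    have : 0 ≤ ((n : ℝ) + 1) * (ρ - τ) := mul_nonneg (by positivity) (by linarith)
    linarith)

theorem stepDown_of_ge {ρ τ : ℝ} (n : ℕ) (h : ρ + 1 / (n + 1) ≤ τ) : stepDown ρ n τ = 0 :=
  Real.smoothTransition.zero_of_nonpos (by
    have hn : (0 : ℝ) < n + 1 := by positivity
    have : ((n : ℝ) + 1) * (ρ - τ) ≤ (n + 1) * (-(1 / (n + 1))) :=
      mul_le_mul_of_nonneg_left (by linarith) hn.le
    have h2 : ((n : ℝ) + 1) * (-(1 / (n + 1))) = -1 := by field_simp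
    linarith)

theorem contDiff_stepDown (ρ : ℝ) (n : ℕ) {k : ℕ∞} : ContDiff ℝ k (stepDown ρ n) := by
  unfold stepDown
  exact Real.smoothTransition.contDiff.comp (by fun_prop)

theorem stepDown_nonneg (ρ : ℝ) (n : ℕ) (τ : ℝ) : 0 ≤ stepDown ρ n τ :=
  Real.smoothTransition.nonneg _

theorem stepDown_le_one (ρ : ℝ) (n : ℕ) (τ : ℝ) : stepDown ρ n τ ≤ 1 :=
  Real.smoothTransition.le_one _

theorem antitone_stepDown (ρ : ℝ) (n : ℕ) : Antitone (stepDown ρ n) := by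
  intro a b hab
  unfold stepDown
  apply Real.smoothTransition.monotone
  gcongr

variable {E : Type*} [NormedAddCommGroup E] [InnerProductSpace ℝ E] [FiniteDimensional ℝ E]
  [MeasurableSpace E] [BorelSpace E]

theorem continuous_integral_sphere {F : ℝ → E → ℝ} (hF : Continuous fun p : ℝ × E => F p.1 p.2) :
    Continuous fun t : ℝ => ∫ ω : sphere (0 : E) 1, F t ω ∂(surf E) := by
  have h := continuous_parametric_integral_of_continuous (μ := surf E)
    (f := fun t (ω : sphere (0 : E) 1) => F t ω) (s := univ)
    (hF.comp (continuous_fst.prodMk (continuous_subtype_val.comp continuous_snd))) isCompact_univ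
  simpa using h

/-- Green's second identity on a ball. -/
theorem integral_ball_green [Nontrivial E] {a b : E → ℝ} (ha : ContDiff ℝ 2 a)
    (hb : ContDiff ℝ 2 b) {R : ℝ} (hR : 0 < R) :
    ∫ x in ball (0 : E) R, (a x * Laplacian.laplacian b x - b x * Laplacian.laplacian a x) =
      R ^ (finrank ℝ E - 1) *
        ∫ ω : sphere (0 : E) 1, (a (R • (ω : E)) * fderiv ℝ b (R • (ω : E)) ω -
          b (R • (ω : E)) * fderiv ℝ a (R • (ω : E)) ω) ∂(surf E) := by
  set F : E → ℝ := fun x => a x * Laplacian.laplacian b x - b x * Laplacian.laplacian a x with hF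
  set Φ : ℝ → ℝ := fun t => t ^ (finrank ℝ E - 1) *
    ∫ ω : sphere (0 : E) 1, (a (t • (ω : E)) * fderiv ℝ b (t • (ω : E)) ω -
          b (t • (ω : E)) * fderiv ℝ a (t • (ω : E)) ω) ∂(surf E) with hΦ
  have hFc : Continuous F := (ha.continuous.mul (continuous_laplacian hb)).sub
    (hb.continuous.mul (continuous_laplacian ha))
  have hΦc : Continuous Φ := by
    refine (continuous_pow _).mul (continuous_integral_sphere (F := fun t x =>
      a (t • x) * fderiv ℝ b (t • x) x - b (t • x) * fderiv ℝ a (t • x) x) ?_)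
    have ha' := ha.continuous_fderiv (by norm_num)
    have hb' := hb.continuous_fderiv (by norm_num)
    have hac := ha.continuous
    have hbc := hb.continuous
    have hs : Continuous fun p : ℝ × E => p.1 • p.2 := continuous_fst.smul continuous_snd
    exact ((hac.comp hs).mul ((hb'.comp hs).clm_apply continuous_snd)).sub
      ((hbc.comp hs).mul ((ha'.comp hs).clm_apply continuous_snd))
  have hzero : ∀ n : ℕ, ∀ t : ℝ, R + 1 ≤ t → stepDown (R ^ 2) n (t ^ 2) = 0 := fun n t ht =>
    stepDown_of_ge n (by
      have : 1 / ((n : ℝ) + 1) ≤ 1 := by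
        rw [div_le_one (by positivity)]
        linarith [Nat.cast_nonneg (α := ℝ) n]
      nlinarith)
  have hcs : ∀ n, HasCompactSupport fun x : E => stepDown (R ^ 2) n (‖x‖ ^ 2) := fun n =>
    HasCompactSupport.of_support_subset_isCompact (isCompact_closedBall (0 : E) (R + 1))
      fun x hx => by
        by_contra h
        refine hx (hzero n _ ?_)
        rw [mem_closedBall, dist_zero_right] at h
        linarith
  have hid := fun n => integral_radial_mul_green (E := E) ha hb
    (contDiff_stepDown (R ^ 2) n (k := 1)) (hcs n)
  have hl : Tendsto (fun n => ∫ x : E, stepDown (R ^ 2) n (‖x‖ ^ 2) * F x) atTop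
      (𝓝 (∫ x in ball (0 : E) R, F x)) := by
    -- The cut-offs equal `1` on the closed ball, so their limit is the indicator of the closed
    -- ball; the sphere is a null set.
    have e : ∫ x in ball (0 : E) R, F x = ∫ x, (closedBall (0 : E) R).indicator F x := by
      rw [integral_indicator measurableSet_closedBall]
      refine setIntegral_congr_set (ae_eq_of_subset_of_measure_ge ball_subset_closedBall ?_
        measurableSet_ball.nullMeasurableSet measure_closedBall_lt_top.ne)
      rw [Measure.addHaar_closedBall_eq_addHaar_ball]
    rw [e]
    refine tendsto_integral_of_dominated_convergence
      ((closedBall (0 : E) (R + 1)).indicator fun x => ‖F x‖) ?_ ?_ ?_ ?_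
    · intro n
      exact ((((contDiff_stepDown (R ^ 2) n (k := 1)).continuous.comp
        (by fun_prop)).mul hFc)).aestronglyMeasurable
    · rw [integrable_indicator_iff measurableSet_closedBall]
      exact hFc.norm.continuousOn.integrableOn_compact (isCompact_closedBall _ _)
    · refine fun n => Eventually.of_forall fun x => ?_
      by_cases hx : x ∈ closedBall (0 : E) (R + 1)
      · rw [indicator_of_mem hx, norm_mul, Real.norm_of_nonneg (stepDown_nonneg _ _ _)]
        exact mul_le_of_le_one_left (norm_nonneg _) (stepDown_le_one _ _ _)
      · rw [mem_closedBall, dist_zero_right, not_le] at hx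
        rw [hzero n _ hx.le, zero_mul, norm_zero]
        exact indicator_nonneg (fun _ _ => norm_nonneg _) _
    · refine Eventually.of_forall fun x => ?_
      by_cases hx : x ∈ closedBall (0 : E) R
      · rw [indicator_of_mem hx]
        rw [mem_closedBall, dist_zero_right] at hx
        refine tendsto_const_nhds.congr fun n => ?_
        rw [stepDown_of_le n (by gcongr), one_mul]
      · rw [indicator_of_notMem hx]
        rw [mem_closedBall, dist_zero_right, not_le] at hx
        have hlt : R ^ 2 < ‖x‖ ^ 2 := by gcongr
        refine tendsto_const_nhds.congr' ?_
        have h1 : ∀ᶠ n : ℕ in atTop, 1 / ((n : ℝ) + 1) < ‖x‖ ^ 2 - R ^ 2 :=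
          tendsto_one_div_add_atTop_nhds_zero_nat.eventually_lt_const (sub_pos.2 hlt)
        filter_upwards [h1] with n hn
        rw [stepDown_of_ge n (by linarith), zero_mul]
  have hr : Tendsto (fun n => ∫ x : E, stepDown (R ^ 2) n (‖x‖ ^ 2) * F x) atTop (𝓝 (Φ R)) := by
    -- The weight in the radial identity is an exact derivative, so its mass over `[0, R + 1]`
    -- telescopes to `1`; it is nonnegative because the step decreases, and it concentrates near `t
    -- = R`.
    have hder : ∀ n (t : ℝ), HasDerivAt (fun t => -stepDown (R ^ 2) n (t ^ 2))
        (-(2 * t * deriv (stepDown (R ^ 2) n) (t ^ 2))) t := fun n t => by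
      have h1 := ((contDiff_stepDown (R ^ 2) n (k := 1)).differentiable (by norm_num)
        (t ^ 2)).hasDerivAt
      have h2 : HasDerivAt (fun t : ℝ => t ^ 2) (2 * t) t := by simpa using hasDerivAt_pow 2 t
      have h3 := (HasDerivAt.comp t (h := fun t : ℝ => t ^ 2) h1 h2).neg
      refine h3.congr_deriv ?_
      ring
    have hcont : ∀ n, Continuous fun t : ℝ => -(2 * t * deriv (stepDown (R ^ 2) n) (t ^ 2)) :=
      fun n => by
        have := (contDiff_stepDown (R ^ 2) n (k := 1)).continuous_deriv (by norm_num)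
        fun_prop
    have hz : ∀ n : ℕ, ∀ t : ℝ, R ^ 2 + 1 / (n + 1) < t ^ 2 →
        deriv (stepDown (R ^ 2) n) (t ^ 2) = 0 := fun n t ht => by
      have : stepDown (R ^ 2) n =ᶠ[𝓝 (t ^ 2)] fun _ => 0 := by
        filter_upwards [lt_mem_nhds ht] with τ hτ
        exact stepDown_of_ge n hτ.le
      rw [this.deriv_eq]
      simp
    have hz' : ∀ n : ℕ, ∀ t : ℝ, t ^ 2 < R ^ 2 →
        deriv (stepDown (R ^ 2) n) (t ^ 2) = 0 := fun n t ht => by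
      have : stepDown (R ^ 2) n =ᶠ[𝓝 (t ^ 2)] fun _ => 1 := by
        filter_upwards [gt_mem_nhds ht] with τ hτ
        exact stepDown_of_le n hτ.le
      rw [this.deriv_eq]
      simp
    have hn1 : ∀ n : ℕ, 1 / ((n : ℝ) + 1) ≤ 1 := fun n => by
      rw [div_le_one (by positivity)]
      linarith [Nat.cast_nonneg (α := ℝ) n]
    have hpk := tendsto_integral_peak (c := R + 1) (R := R) (Φ := Φ) (by linarith) hcont
      (fun n t ht => by
        have := (antitone_stepDown (R ^ 2) n).deriv_nonpos (x := t ^ 2)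
        have h0 : 0 ≤ t := ht.1
        nlinarith)
      (fun n => by
        rw [intervalIntegral.integral_eq_sub_of_hasDerivAt (fun t _ => hder n t)
          ((hcont n).intervalIntegrable _ _), hzero n (R + 1) le_rfl, stepDown_of_le n]
        · simp
        · simpa using sq_nonneg R)
      (fun δ hδ => by
        have h1 : ∀ᶠ n : ℕ in atTop, 1 / ((n : ℝ) + 1) < R * δ :=
          tendsto_one_div_add_atTop_nhds_zero_nat.eventually_lt_const (by positivity)
        filter_upwards [h1] with n hn t ht htR
        rcases le_abs.1 htR with h | h
        · rw [hz n t (by nlinarith)]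
          simp
        · rw [hz' n t (by nlinarith [ht.1])]
          simp) hΦc
    refine hpk.congr fun n => ?_
    rw [hid n, intervalIntegral.integral_of_le (by linarith)]
    symm
    refine setIntegral_eq_of_subset_of_forall_sdiff_eq_zero measurableSet_Ioi
      Ioc_subset_Ioi_self fun t ht => ?_
    have h1 : R + 1 < t := by
      by_contra h
      exact ht.2 ⟨ht.1, not_lt.1 h⟩
    rw [hz n t (by nlinarith [hn1 n])]
    simp
  exact tendsto_nhds_unique hl hr

end GreenIdentityBall

end DeltaSubharmonic

namespace DeltaSubharmonic

/-! ### The regularized fundamental solution and its Laplacian. -/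

section Kappa

/-- The antiderivative of `-t ^ (1 - d)` on the half-line vanishing at `1`. -/
noncomputable def kappa (d : ℕ) (t : ℝ) : ℝ := ∫ τ in t..1, (τ ^ (d - 1))⁻¹

theorem continuousOn_inv_pow (n : ℕ) : ContinuousOn (fun τ : ℝ => (τ ^ n)⁻¹) (Ioi 0) :=
  (continuous_pow n).continuousOn.inv₀ fun _ hτ => pow_ne_zero _ (ne_of_gt hτ)

theorem intervalIntegrable_inv_pow (n : ℕ) {a b : ℝ} (ha : 0 < a) (hb : 0 < b) :
    IntervalIntegrable (fun τ : ℝ => (τ ^ n)⁻¹) volume a b := by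
  refine ((continuousOn_inv_pow n).mono fun τ hτ => ?_).intervalIntegrable
  exact (lt_min ha hb).trans_le hτ.1

theorem kappa_sub (d : ℕ) {a b : ℝ} (ha : 0 < a) (hb : 0 < b) :
    kappa d a - kappa d b = ∫ τ in a..b, (τ ^ (d - 1))⁻¹ := by
  rw [kappa, kappa, sub_eq_iff_eq_add, intervalIntegral.integral_add_adjacent_intervals
    (intervalIntegrable_inv_pow _ ha hb) (intervalIntegrable_inv_pow _ hb one_pos)]

theorem hasDerivAt_kappa (d : ℕ) {t : ℝ} (ht : 0 < t) :
    HasDerivAt (kappa d) (-(t ^ (d - 1))⁻¹) t := by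
  refine intervalIntegral.integral_hasDerivAt_left (intervalIntegrable_inv_pow _ ht one_pos) ?_ ?_
  · exact (continuousOn_inv_pow (d - 1)).stronglyMeasurableAtFilter isOpen_Ioi t ht
  · exact (continuousOn_inv_pow (d - 1)).continuousAt (Ioi_mem_nhds ht)

theorem radialKernel_eq_ofReal (d : ℕ) {a b : ℝ} (ha : 0 < a) (hab : a ≤ b) :
    radialKernel d a b = ENNReal.ofReal (kappa d a - kappa d b) := by
  have hb := ha.trans_le hab
  rw [kappa_sub d ha hb, radialKernel, intervalIntegral.integral_of_le hab,
    setLIntegral_congr (Ioo_ae_eq_Ioc (a := a) (b := b)),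
    ofReal_integral_eq_lintegral_ofReal]
  · refine setLIntegral_congr_fun measurableSet_Ioc fun t ht => ?_
    rw [ENNReal.ofReal_inv_of_pos (pow_pos (ha.trans ht.1) _)]
  · exact (intervalIntegrable_inv_pow _ ha hb).1
  · filter_upwards [ae_restrict_mem measurableSet_Ioc] with t ht
    have := ha.trans ht.1
    positivity

theorem kappa_anti (d : ℕ) {a b : ℝ} (ha : 0 < a) (hab : a ≤ b) : kappa d b ≤ kappa d a := by
  have hb := ha.trans_le hab
  rw [← sub_nonneg, kappa_sub d ha hb]
  refine intervalIntegral.integral_nonneg hab fun t ht => ?_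
  have := ha.trans_le ht.1
  positivity

theorem hasDerivAt_kappa_sqrt {d : ℕ} (hd : 1 ≤ d) {q : ℝ} (hq : 0 < q) :
    HasDerivAt (fun q => kappa d √q) (-(1 / 2) * (√q ^ d)⁻¹) q := by
  have hs : 0 < √q := Real.sqrt_pos.2 hq
  have h := (hasDerivAt_kappa d hs).comp q (Real.hasDerivAt_sqrt hq.ne')
  refine h.congr_deriv ?_
  obtain ⟨n, rfl⟩ : ∃ n, d = n + 1 := ⟨d - 1, by omega⟩
  rw [Nat.add_sub_cancel, pow_succ]
  field_simp

theorem hasDerivAt_inv_sqrt_pow (d : ℕ) {q : ℝ} (hq : 0 < q) :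
    HasDerivAt (fun q => (√q ^ d)⁻¹) (-(d / 2) * (√q ^ (d + 2))⁻¹) q := by
  have hs : 0 < √q := Real.sqrt_pos.2 hq
  have h := ((Real.hasDerivAt_sqrt hq.ne').pow d).inv (pow_ne_zero _ hs.ne')
  refine h.congr_deriv ?_
  rcases d with _ | n
  · simp
  · rw [Nat.add_sub_cancel]
    simp only [Pi.pow_apply]
    field_simp
    ring

theorem contDiffOn_kappa_sqrt {d : ℕ} (hd : 1 ≤ d) :
    ContDiffOn ℝ 2 (fun q => kappa d √q) (Ioi 0) := by
  have h2 : (2 : WithTop ℕ∞) = 1 + 1 := by norm_num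
  rw [h2, contDiffOn_succ_iff_deriv_of_isOpen isOpen_Ioi]
  refine ⟨fun q hq => (hasDerivAt_kappa_sqrt hd hq).differentiableAt.differentiableWithinAt,
    by simp, ?_⟩
  have : EqOn (deriv fun q => kappa d √q) (fun q => -(1 / 2) * (√q ^ d)⁻¹) (Ioi 0) :=
    fun q hq => (hasDerivAt_kappa_sqrt hd hq).deriv
  refine ContDiffOn.congr ?_ this
  refine contDiffOn_const.mul (ContDiffOn.inv ?_ fun q hq => ?_)
  · exact (ContDiffOn.sqrt contDiffOn_id fun q hq => ne_of_gt hq).pow d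
  · exact pow_ne_zero _ (Real.sqrt_pos.2 hq).ne'

variable {E : Type*} [NormedAddCommGroup E] [InnerProductSpace ℝ E]

/-- This family of quadratics contains both squared distances plus `η²`: the direct one with `α =
1`, the reflected one with `α = ‖x‖² / R²`. One differentiation serves both halves of the Green
function. -/
theorem hasFDerivAt_quadratic (α γ : ℝ) (x y : E) :
    HasFDerivAt (fun y : E => α * ‖y‖ ^ 2 - 2 * ⟪x, y⟫ + γ) ((2 : ℝ) • innerSL ℝ (α • y - x)) y := by
  have h1 : HasFDerivAt (fun y : E => ‖y‖ ^ 2) (2 • (innerSL ℝ y)) y := by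
    simpa using (hasStrictFDerivAt_norm_sq y).hasFDerivAt
  have h2 : HasFDerivAt (fun y : E => ⟪x, y⟫) (innerSL ℝ x) y := (innerSL ℝ x).hasFDerivAt
  have h3 := ((h1.const_mul α).sub (h2.const_mul 2)).add_const γ
  refine h3.congr_fderiv ?_
  ext v
  simp
  ring

theorem fderiv_kappa_quadratic {d : ℕ} (hd : 1 ≤ d) {α γ : ℝ} {x y : E}
    (hpos : 0 < α * ‖y‖ ^ 2 - 2 * ⟪x, y⟫ + γ) (v : E) :
    fderiv ℝ (fun y : E => kappa d √(α * ‖y‖ ^ 2 - 2 * ⟪x, y⟫ + γ)) y v =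
      -((√(α * ‖y‖ ^ 2 - 2 * ⟪x, y⟫ + γ) ^ d)⁻¹ * ⟪α • y - x, v⟫) := by
  have h := (hasDerivAt_kappa_sqrt hd hpos).comp_hasFDerivAt y (hasFDerivAt_quadratic α γ x y)
  have e : (fun y : E => kappa d √(α * ‖y‖ ^ 2 - 2 * ⟪x, y⟫ + γ)) =
    (fun q => kappa d √q) ∘ fun y : E => α * ‖y‖ ^ 2 - 2 * ⟪x, y⟫ + γ := rfl
  rw [e, h.fderiv]
  simp only [smul_apply, innerSL_apply_apply, smul_eq_mul]
  ring

theorem contDiff_kappa_quadratic {d : ℕ} (hd : 1 ≤ d) {α γ : ℝ} {x : E}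
    (hpos : ∀ y : E, 0 < α * ‖y‖ ^ 2 - 2 * ⟪x, y⟫ + γ) :
    ContDiff ℝ 2 fun y : E => kappa d √(α * ‖y‖ ^ 2 - 2 * ⟪x, y⟫ + γ) := by
  have hq : ContDiff ℝ 2 fun y : E => α * ‖y‖ ^ 2 - 2 * ⟪x, y⟫ + γ :=
    ((contDiff_const.mul (contDiff_norm_sq ℝ)).sub
      (contDiff_const.mul (contDiff_const.inner ℝ contDiff_id))).add contDiff_const
  have := (contDiffOn_kappa_sqrt hd).comp (s := univ) hq.contDiffOn fun y _ => hpos y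
  exact contDiffOn_univ.1 this

variable [FiniteDimensional ℝ E]

theorem sum_inner_sq (z : E) : ∑ i, ⟪z, stdOrthonormalBasis ℝ E i⟫ ^ 2 = ‖z‖ ^ 2 := by
  have := sum_inner_mul_clm (innerSL ℝ z) z
  simp only [innerSL_apply_apply] at this
  rw [← real_inner_self_eq_norm_sq, ← this]
  exact Finset.sum_congr rfl fun i _ => by ring

/-- The Laplacian of the regularized kernel. -/
theorem laplacian_kappa_quadratic (hd : 1 ≤ finrank ℝ E) {α γ ε : ℝ} {x : E}
    (hpos : ∀ y : E, 0 < α * ‖y‖ ^ 2 - 2 * ⟪x, y⟫ + γ) (hε : ‖x‖ ^ 2 - α * γ = -(α * ε)) (y : E) :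
    Laplacian.laplacian
      (fun y : E => kappa (finrank ℝ E) √(α * ‖y‖ ^ 2 - 2 * ⟪x, y⟫ + γ)) y =
      -(finrank ℝ E * α * ε * (√(α * ‖y‖ ^ 2 - 2 * ⟪x, y⟫ + γ) ^ (finrank ℝ E + 2))⁻¹) := by
  set d := finrank ℝ E with hdd
  set Q : E → ℝ := fun y => α * ‖y‖ ^ 2 - 2 * ⟪x, y⟫ + γ with hQ
  rw [laplacian_eq_sum_fderiv (contDiff_kappa_quadratic hd hpos)]
  have h1 : ∀ i, fderiv ℝ (fun y => fderiv ℝ (fun y : E => kappa d √(Q y)) y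
      (stdOrthonormalBasis ℝ E i)) y (stdOrthonormalBasis ℝ E i) =
      d * (√(Q y) ^ (d + 2))⁻¹ * ⟪α • y - x, stdOrthonormalBasis ℝ E i⟫ ^ 2 -
        α * (√(Q y) ^ d)⁻¹ := by
    intro i
    set v := stdOrthonormalBasis ℝ E i
    have hv : ‖v‖ = 1 := (stdOrthonormalBasis ℝ E).orthonormal.1 i
    have e : (fun y => fderiv ℝ (fun y : E => kappa d √(Q y)) y v) =
        fun y => -((√(Q y) ^ d)⁻¹ * ⟪α • y - x, v⟫) :=
      funext fun y => fderiv_kappa_quadratic hd (hpos y) v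
    rw [e]
    have hf0 := (hasDerivAt_inv_sqrt_pow d (hpos y)).comp_hasFDerivAt y
      (hasFDerivAt_quadratic α γ x y)
    have hf1 : HasFDerivAt (fun y => (√(Q y) ^ d)⁻¹) ((-(d / 2) * (√(Q y) ^ (d + 2))⁻¹) •
      (2 : ℝ) • innerSL ℝ (α • y - x)) y := hf0
    have hf2 : HasFDerivAt (fun y : E => ⟪α • y - x, v⟫) (α • innerSL ℝ v) y := by
      have h := ((innerSL ℝ v).hasFDerivAt (x := y)).const_mul α |>.sub_const ⟪v, x⟫
      have e2 : (fun y : E => ⟪α • y - x, v⟫) = fun y => α * innerSL ℝ v y - ⟪v, x⟫ := by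
        ext y
        rw [inner_sub_left, inner_smul_left, real_inner_comm v y, real_inner_comm v x]
        simp
      rw [e2]
      exact h
    rw [(hf1.fun_mul hf2).fun_neg.fderiv]
    simp only [neg_apply, add_apply, smul_apply, innerSL_apply_apply, smul_eq_mul,
      real_inner_self_eq_norm_sq, hv]
    simp only [hQ]
    ring
  rw [Finset.sum_congr rfl fun i _ => h1 i, Finset.sum_sub_distrib, ← Finset.mul_sum, sum_inner_sq]
  -- With this identity the two leading terms cancel, as for the harmonic fundamental solution, and
  -- only the `ε` term remains. The relation `hε` is not solved for `ε` because `α = 0` for the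
  -- reflected term at `x = 0`.
  have h2 : ‖α • y - x‖ ^ 2 = α * (Q y - ε) := by
    rw [@norm_sub_sq_real, norm_smul, inner_smul_left, real_inner_comm]
    simp only [hQ, conj_trivial, mul_pow, Real.norm_eq_abs, sq_abs]
    linear_combination hε
  have hs : √(Q y) ^ (d + 2) = √(Q y) ^ d * Q y := by
    rw [pow_add, Real.sq_sqrt (hpos y).le]
  have hQ0 : Q y ≠ 0 := (hpos y).ne'
  have hs0 : √(Q y) ^ d ≠ 0 := pow_ne_zero _ (Real.sqrt_pos.2 (hpos y)).ne'
  rw [h2, hs]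
  simp only [Finset.sum_const, Finset.card_univ, Fintype.card_fin, nsmul_eq_mul]
  field_simp
  ring

end Kappa

end DeltaSubharmonic

namespace DeltaSubharmonic

/-! ### The regularized Laplacian as an approximate identity. -/

section ApproximateIdentity

/-- An explicit primitive of the radial density. For `d ≥ 1` it rises from `0` at the origin to `1`
at infinity, so the total mass of the profile is the area of the unit sphere. -/
theorem hasDerivAt_pow_mul_inv_sqrt (d : ℕ) (t : ℝ) :
    HasDerivAt (fun t : ℝ => t ^ d * (√(t ^ 2 + 1) ^ d)⁻¹)
      (t ^ (d - 1) * (d * (√(t ^ 2 + 1) ^ (d + 2))⁻¹)) t := by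
  have hq : 0 < t ^ 2 + 1 := by positivity
  have h1 : HasDerivAt (fun t : ℝ => t ^ 2 + 1) (2 * t) t := by
    simpa using (hasDerivAt_pow 2 t).add_const 1
  have h2 : HasDerivAt (fun t : ℝ => (√(t ^ 2 + 1) ^ d)⁻¹)
      ((-(d / 2) * (√(t ^ 2 + 1) ^ (d + 2))⁻¹) * (2 * t)) t :=
    HasDerivAt.comp t (h := fun t : ℝ => t ^ 2 + 1) (hasDerivAt_inv_sqrt_pow d hq) h1
  refine ((hasDerivAt_pow d t).fun_mul h2).congr_deriv ?_
  have hs : √(t ^ 2 + 1) ^ (d + 2) = √(t ^ 2 + 1) ^ d * (t ^ 2 + 1) := by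
    rw [pow_add, Real.sq_sqrt hq.le]
  have hs0 : √(t ^ 2 + 1) ^ d ≠ 0 := pow_ne_zero _ (Real.sqrt_pos.2 hq).ne'
  rw [hs]
  rcases d with _ | n
  · simp
  · rw [Nat.add_sub_cancel, pow_succ t]
    field_simp
    ring

theorem tendsto_pow_mul_inv_sqrt (d : ℕ) :
    Tendsto (fun t : ℝ => t ^ d * (√(t ^ 2 + 1) ^ d)⁻¹) atTop (𝓝 1) := by
  have h1 : Tendsto (fun t : ℝ => (√(1 + (t⁻¹) ^ 2) ^ d)⁻¹) atTop (𝓝 1) := by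
    have : Tendsto (fun t : ℝ => (√(1 + (t⁻¹) ^ 2) ^ d)⁻¹) atTop (𝓝 ((√(1 + 0 ^ 2) ^ d)⁻¹)) := by
      refine Tendsto.inv₀ (Tendsto.pow (Tendsto.sqrt ?_) d) (by simp)
      exact tendsto_const_nhds.add (tendsto_inv_atTop_zero.pow 2)
    simpa using this
  refine h1.congr' ?_
  filter_upwards [eventually_gt_atTop 0] with t ht
  have : √(t ^ 2 + 1) = t * √(1 + (t⁻¹) ^ 2) := by
    rw [← Real.sqrt_sq ht.le, ← Real.sqrt_mul (sq_nonneg t), Real.sqrt_sq ht.le]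
    congr 1
    field_simp
  rw [this, mul_pow]
  field_simp

variable {E : Type*} [NormedAddCommGroup E] [InnerProductSpace ℝ E] [FiniteDimensional ℝ E]
  [MeasurableSpace E] [BorelSpace E] [Nontrivial E]

theorem integrableOn_profile (d : ℕ) :
    IntegrableOn (fun t : ℝ => t ^ (d - 1) * (d * (√(t ^ 2 + 1) ^ (d + 2))⁻¹)) (Ioi 0) :=
  integrableOn_Ioi_deriv_of_nonneg' (fun t _ => hasDerivAt_pow_mul_inv_sqrt d t)
    (fun t ht => by
      have : (0 : ℝ) < t := ht
      positivity) (tendsto_pow_mul_inv_sqrt d)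

theorem integrable_profile :
    Integrable fun z : E => (finrank ℝ E : ℝ) * (√(‖z‖ ^ 2 + 1) ^ (finrank ℝ E + 2))⁻¹ := by
  rw [integrable_fun_norm_addHaar volume
    (f := fun t : ℝ => (finrank ℝ E : ℝ) * (√(t ^ 2 + 1) ^ (finrank ℝ E + 2))⁻¹)]
  simpa only [smul_eq_mul] using integrableOn_profile (finrank ℝ E)

theorem integral_profile :
    ∫ z : E, (finrank ℝ E : ℝ) * (√(‖z‖ ^ 2 + 1) ^ (finrank ℝ E + 2))⁻¹ = (surf E).real univ := by
  have hd : finrank ℝ E ≠ 0 := finrank_pos.ne'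
  rw [integral_fun_norm_addHaar volume
    (fun t : ℝ => (finrank ℝ E : ℝ) * (√(t ^ 2 + 1) ^ (finrank ℝ E + 2))⁻¹)]
  simp only [smul_eq_mul]
  rw [integral_Ioi_of_hasDerivAt_of_nonneg' (fun t _ => hasDerivAt_pow_mul_inv_sqrt _ t)
    (fun t ht => by
      have : (0 : ℝ) < t := ht
      positivity) (tendsto_pow_mul_inv_sqrt _)]
  simp [hd]

/-- The regularized Laplacian of the fundamental solution is an approximate identity. -/
theorem tendsto_integral_profile {f : E → ℝ} (hf : Measurable f) {C : ℝ} (hC : ∀ y, ‖f y‖ ≤ C)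
    {x : E} (hx : ContinuousAt f x) :
    Tendsto (fun η : ℝ => ∫ y, f y * (finrank ℝ E * η ^ 2 *
      (√(‖y - x‖ ^ 2 + η ^ 2) ^ (finrank ℝ E + 2))⁻¹)) (𝓝[>] 0)
      (𝓝 ((surf E).real univ * f x)) := by
  set d := finrank ℝ E with hd
  -- The substitution `y = x + η z` removes `η` from the density, which then serves as the
  -- dominating function.
  have e : ∀ η : ℝ, 0 < η → ∫ y, f y * (d * η ^ 2 * (√(‖y - x‖ ^ 2 + η ^ 2) ^ (d + 2))⁻¹) =
      ∫ z : E, f (x + η • z) * (d * (√(‖z‖ ^ 2 + 1) ^ (d + 2))⁻¹) := by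
    intro η hη
    rw [← integral_add_left_eq_self _ x]
    have h := Measure.integral_comp_smul_of_nonneg (volume : Measure E) (fun y : E =>
      f (x + y) * (d * η ^ 2 * (√(‖x + y - x‖ ^ 2 + η ^ 2) ^ (d + 2))⁻¹)) η (hR := hη.le)
    rw [smul_eq_mul, ← hd] at h
    rw [← mul_right_inj' (inv_ne_zero (pow_ne_zero d hη.ne')), ← h, ← integral_const_mul]
    refine integral_congr_ae (Eventually.of_forall fun z => ?_)
    have h1 : √(‖x + η • z - x‖ ^ 2 + η ^ 2) = η * √(‖z‖ ^ 2 + 1) := by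
      rw [add_sub_cancel_left, norm_smul, Real.norm_of_nonneg hη.le, mul_pow, ← mul_add_one,
        Real.sqrt_mul (sq_nonneg η), Real.sqrt_sq hη.le]
    simp only [h1, mul_pow]
    rw [pow_add η d 2]
    field_simp
  have h0 : (surf E).real univ * f x = ∫ z : E, f x * (d * (√(‖z‖ ^ 2 + 1) ^ (d + 2))⁻¹) := by
    rw [integral_const_mul, integral_profile, mul_comm]
  rw [h0]
  have ht : Tendsto (fun η : ℝ => ∫ z : E, f (x + η • z) * (d * (√(‖z‖ ^ 2 + 1) ^ (d + 2))⁻¹))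
      (𝓝[>] 0) (𝓝 (∫ z : E, f x * (d * (√(‖z‖ ^ 2 + 1) ^ (d + 2))⁻¹))) := by
    refine tendsto_integral_filter_of_dominated_convergence
      (fun z : E => C * (d * (√(‖z‖ ^ 2 + 1) ^ (d + 2))⁻¹)) ?_ ?_ ?_ ?_
    · refine Eventually.of_forall fun η => ?_
      refine (Measurable.mul (hf.comp (by fun_prop)) ?_).aestronglyMeasurable
      fun_prop
    · refine Eventually.of_forall fun η => Eventually.of_forall fun z => ?_
      rw [norm_mul, Real.norm_of_nonneg (show 0 ≤ (d : ℝ) * (√(‖z‖ ^ 2 + 1) ^ (d + 2))⁻¹ by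
        positivity)]
      gcongr
      exact hC _
    · exact integrable_profile.const_mul C
    · refine Eventually.of_forall fun z => Tendsto.mul_const _ ?_
      refine hx.tendsto.comp ?_
      have : Tendsto (fun η : ℝ => x + η • z) (𝓝 0) (𝓝 (x + (0 : ℝ) • z)) :=
        (Continuous.tendsto (by fun_prop) 0)
      rw [zero_smul, add_zero] at this
      exact this.mono_left nhdsWithin_le_nhds
  refine ht.congr' ?_
  filter_upwards [self_mem_nhdsWithin] with η hη
  exact (e η hη).symm

end ApproximateIdentity

/-! ### Local summability of the kernel. -/

section PoissonJensen

variable {E : Type*} [NormedAddCommGroup E] [InnerProductSpace ℝ E] [FiniteDimensional ℝ E]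
  [MeasurableSpace E] [BorelSpace E] [Nontrivial E]

/-- By the layer-cake formula the integrand is the volume of a ball of radius `t` over `t ^ (d -
1)`, a constant multiple of `t`. -/
theorem lintegral_radialKernel_norm_sub_lt_top (x : E) (T : ℝ) :
    ∫⁻ y : E, radialKernel (finrank ℝ E) ‖x - y‖ T < ∞ := by
  have hd : 0 < finrank ℝ E := finrank_pos
  rw [lintegral_radialKernel _ _ (by fun_prop)]
  have hle : ∫⁻ t in Iio T, volume {y : E | ‖x - y‖ < t} *
      (ENNReal.ofReal (t ^ (finrank ℝ E - 1)))⁻¹ ≤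
      ∫⁻ _ in Ioo 0 T, ENNReal.ofReal T * volume (ball (0 : E) 1) := by
    rw [← lintegral_indicator measurableSet_Iio, ← lintegral_indicator measurableSet_Ioo]
    refine lintegral_mono fun t => ?_
    by_cases h1 : t < T
    · rw [indicator_of_mem (show t ∈ Iio T from h1)]
      have hset : {y : E | ‖x - y‖ < t} = ball x t := by
        ext y
        simp [mem_ball, dist_eq_norm, norm_sub_rev]
      rw [hset]
      by_cases h0 : 0 < t
      · rw [indicator_of_mem (show t ∈ Ioo 0 T from ⟨h0, h1⟩), Measure.addHaar_ball_of_pos _ _ h0,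
          mul_right_comm, ← ENNReal.ofReal_inv_of_pos (by positivity),
          ← ENNReal.ofReal_mul (by positivity)]
        gcongr
        obtain ⟨n, hn⟩ : ∃ n, finrank ℝ E = n + 1 := ⟨finrank ℝ E - 1, by omega⟩
        rw [hn, Nat.add_sub_cancel, pow_succ, mul_right_comm,
          mul_inv_cancel₀ (pow_ne_zero _ h0.ne'), one_mul]
        exact h1.le
      · rw [ball_eq_empty.2 (not_lt.1 h0)]
        simp
    · rw [indicator_of_notMem (show t ∉ Iio T from h1)]
      exact zero_le
  refine hle.trans_lt ?_
  rw [setLIntegral_const]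
  exact ENNReal.mul_lt_top (ENNReal.mul_lt_top ENNReal.ofReal_lt_top measure_ball_lt_top) (by simp)

theorem integrable_radialKernel_toReal (x : E) (T : ℝ) :
    Integrable fun y : E => (radialKernel (finrank ℝ E) ‖x - y‖ T).toReal :=
  integrable_toReal_of_lintegral_ne_top
    (measurable_radialKernel _ (by fun_prop) measurable_const).aemeasurable
    (lintegral_radialKernel_norm_sub_lt_top x T).ne

end PoissonJensen

end DeltaSubharmonic

/-! ### The regularized Green function and the Poisson–Jensen formula for `C²` functions. -/

namespace DeltaSubharmonic

variable {E : Type*} [NormedAddCommGroup E] [InnerProductSpace ℝ E] [FiniteDimensional ℝ E]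
  [MeasurableSpace E] [BorelSpace E] [Nontrivial E]

theorem quadratic_eq_norm_sub (x y : E) (η : ℝ) :
    1 * ‖y‖ ^ 2 - 2 * ⟪x, y⟫ + (‖x‖ ^ 2 + η ^ 2) = ‖y - x‖ ^ 2 + η ^ 2 := by
  rw [norm_sub_sq_real, real_inner_comm]; ring

theorem quadratic_eq_mirrorSq (R : ℝ) (x y : E) (η : ℝ) :
    ‖x‖ ^ 2 / R ^ 2 * ‖y‖ ^ 2 - 2 * ⟪x, y⟫ + (R ^ 2 + η ^ 2) = mirrorSq R x y + η ^ 2 := by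
  unfold mirrorSq; ring

/-- The regularized Green function of a ball. -/
noncomputable def greenReg (R : ℝ) (x : E) (η : ℝ) (y : E) : ℝ :=
  kappa (finrank ℝ E) √(1 * ‖y‖ ^ 2 - 2 * ⟪x, y⟫ + (‖x‖ ^ 2 + η ^ 2)) -
    kappa (finrank ℝ E) √(‖x‖ ^ 2 / R ^ 2 * ‖y‖ ^ 2 - 2 * ⟪x, y⟫ + (R ^ 2 + η ^ 2))

theorem greenReg_eq (R : ℝ) (x : E) (η : ℝ) (y : E) :
    greenReg R x η y = kappa (finrank ℝ E) √(‖y - x‖ ^ 2 + η ^ 2) -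
      kappa (finrank ℝ E) √(mirrorSq R x y + η ^ 2) := by
  rw [greenReg, quadratic_eq_norm_sub, quadratic_eq_mirrorSq]

theorem contDiff_greenReg {R : ℝ} (hR : 0 < R) (x : E) {η : ℝ} (hη : 0 < η) :
    ContDiff ℝ 2 (greenReg R x η) := by
  refine ContDiff.sub (contDiff_kappa_quadratic finrank_pos fun y => ?_)
    (contDiff_kappa_quadratic finrank_pos fun y => ?_)
  · rw [quadratic_eq_norm_sub]; positivity
  · rw [quadratic_eq_mirrorSq]
    have := mirrorSq_nonneg hR.ne' x y
    positivity

theorem laplacian_greenReg {R : ℝ} (hR : 0 < R) (x : E) {η : ℝ} (hη : 0 < η) (y : E) :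
    Laplacian.laplacian (greenReg R x η) y =
      -(finrank ℝ E * η ^ 2 * (√(‖y - x‖ ^ 2 + η ^ 2) ^ (finrank ℝ E + 2))⁻¹) +
        finrank ℝ E * (‖x‖ ^ 2 / R ^ 2) * η ^ 2 *
          (√(mirrorSq R x y + η ^ 2) ^ (finrank ℝ E + 2))⁻¹ := by
  have h1 : ∀ y : E, 0 < 1 * ‖y‖ ^ 2 - 2 * ⟪x, y⟫ + (‖x‖ ^ 2 + η ^ 2) := fun y => by
    rw [quadratic_eq_norm_sub]; positivity
  have h2 : ∀ y : E, 0 < ‖x‖ ^ 2 / R ^ 2 * ‖y‖ ^ 2 - 2 * ⟪x, y⟫ + (R ^ 2 + η ^ 2) := fun y => by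
    rw [quadratic_eq_mirrorSq]
    have := mirrorSq_nonneg hR.ne' x y
    positivity
  have := ContDiffAt.laplacian_sub (x := y)
    (contDiff_kappa_quadratic (d := finrank ℝ E) finrank_pos h1).contDiffAt
    (contDiff_kappa_quadratic (d := finrank ℝ E) finrank_pos h2).contDiffAt
  refine Eq.trans ?_ (this.trans ?_)
  · rfl
  · rw [laplacian_kappa_quadratic (ε := η ^ 2) finrank_pos h1 (by ring),
      laplacian_kappa_quadratic (ε := η ^ 2) finrank_pos h2 (by field_simp; ring),
      quadratic_eq_norm_sub, quadratic_eq_mirrorSq]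
    ring

/-- The same `η²` is added to both squared distances, so they still coincide on the sphere: the
boundary value is zero before the limit, and Green's identity has no normal derivative of the other
function. -/
theorem greenReg_sphere {R : ℝ} (hR : 0 < R) (x : E) (η : ℝ) {y : E} (hy : ‖y‖ = R) :
    greenReg R x η y = 0 := by
  rw [greenReg_eq, mirrorSq_eq_of_norm_eq hR.ne' hy, norm_sub_rev, sub_self]

/-- The two radicands agree on the sphere, so the difference of the derivatives is one power times
the difference of the linear factors. This is the regularized Poisson kernel. -/
theorem fderiv_greenReg_sphere {R : ℝ} (hR : 0 < R) (x : E) {η : ℝ} (hη : 0 < η)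
    (ω : sphere (0 : E) 1) :
    fderiv ℝ (greenReg R x η) (R • (ω : E)) ω =
      -((R ^ 2 - ‖x‖ ^ 2) / R * (√(‖x - R • (ω : E)‖ ^ 2 + η ^ 2) ^ finrank ℝ E)⁻¹) := by
  have hω : ‖(ω : E)‖ = 1 := norm_eq_of_mem_sphere ω
  have hRω : ‖R • (ω : E)‖ = R := by rw [norm_smul, hω, mul_one, Real.norm_of_nonneg hR.le]
  have h1 : ∀ y : E, 0 < 1 * ‖y‖ ^ 2 - 2 * ⟪x, y⟫ + (‖x‖ ^ 2 + η ^ 2) := fun y => by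
    rw [quadratic_eq_norm_sub]; positivity
  have h2 : ∀ y : E, 0 < ‖x‖ ^ 2 / R ^ 2 * ‖y‖ ^ 2 - 2 * ⟪x, y⟫ + (R ^ 2 + η ^ 2) := fun y => by
    rw [quadratic_eq_mirrorSq]
    have := mirrorSq_nonneg hR.ne' x y
    positivity
  have d1 := ((contDiff_kappa_quadratic (d := finrank ℝ E) finrank_pos h1).differentiable
    (by norm_num)) (R • (ω : E))
  have d2 := ((contDiff_kappa_quadratic (d := finrank ℝ E) finrank_pos h2).differentiable
    (by norm_num)) (R • (ω : E))
  have h3 := fderiv_sub d1 d2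
  have h4 : fderiv ℝ (greenReg R x η) (R • (ω : E)) = _ := h3
  rw [h4, sub_apply, fderiv_kappa_quadratic finrank_pos (h1 _),
    fderiv_kappa_quadratic finrank_pos (h2 _), quadratic_eq_norm_sub, quadratic_eq_mirrorSq,
    mirrorSq_eq_of_norm_eq hR.ne' hRω, norm_sub_rev]
  have hi : ⟪(ω : E), (ω : E)⟫ = 1 := by rw [real_inner_self_eq_norm_sq, hω]; norm_num
  simp only [inner_sub_left, inner_smul_left, hi, RCLike.conj_to_real]
  field_simp
  ring

/-- A summable majorant independent of `η`: both regularized distances lie between `‖x - y‖` and `2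
R + 1`, the `1` coming from `η < 1`. -/
theorem greenReg_bounds {R : ℝ} (hR : 0 < R) {x y : E} (hx : ‖x‖ < R) (hy : ‖y‖ < R) (hxy : y ≠ x)
    {η : ℝ} (hη : 0 < η) (hη1 : η < 1) :
    ‖greenReg R x η y‖ ≤ (radialKernel (finrank ℝ E) ‖x - y‖ (2 * R + 1)).toReal := by
  have h0 : 0 < ‖x - y‖ := norm_sub_pos_iff.2 (Ne.symm hxy)
  have hm := norm_sub_le_sqrt_mirrorSq hR hx.le hy.le
  have hm2 := sqrt_mirrorSq_le hR hx.le hy.le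
  have hm0 := mirrorSq_nonneg hR.ne' x y
  have e1 : √(mirrorSq R x y) ^ 2 = mirrorSq R x y := Real.sq_sqrt hm0
  have h1 : √(‖y - x‖ ^ 2 + η ^ 2) ≤ √(mirrorSq R x y + η ^ 2) := by
    apply Real.sqrt_le_sqrt
    rw [norm_sub_rev]
    nlinarith
  have h2 : ‖x - y‖ ≤ √(‖y - x‖ ^ 2 + η ^ 2) := by
    apply Real.le_sqrt_of_sq_le
    rw [norm_sub_rev]
    nlinarith
  have h3 : √(mirrorSq R x y + η ^ 2) ≤ 2 * R + 1 := by
    rw [Real.sqrt_le_left (by linarith)]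
    nlinarith [Real.sqrt_nonneg (mirrorSq R x y)]
  rw [radialKernel_eq_ofReal _ h0 (h2.trans (h1.trans h3)), greenReg_eq,
    ENNReal.toReal_ofReal (sub_nonneg.2 (kappa_anti _ h0 (h2.trans (h1.trans h3)))),
    Real.norm_of_nonneg (sub_nonneg.2 (kappa_anti _ (h0.trans_le h2) h1))]
  exact sub_le_sub (kappa_anti _ h0 h2) (kappa_anti _ ((h0.trans_le h2).trans_le h1) h3)

theorem green_toReal_eq {R : ℝ} (hR : 0 < R) {x y : E} (hx : ‖x‖ ≤ R) (hy : ‖y‖ ≤ R) (hxy : y ≠ x)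
    (d : ℕ) : (green d R x y).toReal = kappa d ‖y - x‖ - kappa d √(mirrorSq R x y) := by
  have h0 : 0 < ‖x - y‖ := norm_sub_pos_iff.2 (Ne.symm hxy)
  have hm := norm_sub_le_sqrt_mirrorSq hR hx hy
  rw [green, radialKernel_eq_ofReal _ h0 hm,
    ENNReal.toReal_ofReal (sub_nonneg.2 (kappa_anti _ h0 hm)), norm_sub_rev]

theorem tendsto_sqrt_add_sq (A : ℝ) (hA : 0 ≤ A) :
    Tendsto (fun η : ℝ => √(A ^ 2 + η ^ 2)) (𝓝[>] 0) (𝓝 A) := by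
  have : Continuous fun η : ℝ => √(A ^ 2 + η ^ 2) := by fun_prop
  simpa [Real.sqrt_sq hA] using (this.tendsto 0).mono_left nhdsWithin_le_nhds

theorem tendsto_greenReg {R : ℝ} (hR : 0 < R) {x y : E} (hx : ‖x‖ < R) (hy : ‖y‖ < R)
    (hxy : y ≠ x) : Tendsto (fun η => greenReg R x η y) (𝓝[>] 0)
      (𝓝 (green (finrank ℝ E) R x y).toReal) := by
  have h0 : 0 < ‖y - x‖ := norm_sub_pos_iff.2 hxy
  have hm := norm_sub_le_sqrt_mirrorSq hR hx.le hy.le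
  rw [norm_sub_rev] at hm
  have hk : ∀ A : ℝ, 0 < A → Tendsto (fun η : ℝ => kappa (finrank ℝ E) √(A ^ 2 + η ^ 2))
      (𝓝[>] 0) (𝓝 (kappa (finrank ℝ E) A)) := fun A hA =>
    ((hasDerivAt_kappa _ hA).continuousAt.tendsto).comp (tendsto_sqrt_add_sq A hA.le)
  rw [green_toReal_eq hR hx.le hy.le hxy]
  have h2 := (hk _ h0).sub (hk _ (h0.trans_le hm))
  rw [Real.sq_sqrt (mirrorSq_nonneg hR.ne' x y)] at h2
  simpa only [greenReg_eq] using h2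

theorem tendsto_integral_greenReg_mul {R : ℝ} (hR : 0 < R) {x : E} (hx : ‖x‖ < R) {f : E → ℝ}
    (hf : Continuous f) :
    Tendsto (fun η => ∫ y in ball (0 : E) R, greenReg R x η y * f y) (𝓝[>] 0)
      (𝓝 (∫ y in ball (0 : E) R, (green (finrank ℝ E) R x y).toReal * f y)) := by
  obtain ⟨C, hC⟩ := (isCompact_closedBall (0 : E) R).exists_bound_of_continuousOn hf.continuousOn
  have hne : ∀ᵐ y ∂(volume.restrict (ball (0 : E) R)), y ≠ x ∧ ‖y‖ < R := by
    filter_upwards [ae_restrict_mem measurableSet_ball,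
      compl_mem_ae_iff.2 (measure_singleton (μ := volume.restrict (ball (0 : E) R)) x)] with y h1 h2
    exact ⟨h2, by simpa using h1⟩
  refine tendsto_integral_filter_of_dominated_convergence
    (fun y => (radialKernel (finrank ℝ E) ‖x - y‖ (2 * R + 1)).toReal * C) ?_ ?_ ?_ ?_
  · filter_upwards [self_mem_nhdsWithin] with η hη
    exact ((contDiff_greenReg hR x hη).continuous.mul hf).aestronglyMeasurable
  · filter_upwards [Ioo_mem_nhdsGT (zero_lt_one' ℝ)] with η hη
    filter_upwards [hne] with y hy
    rw [norm_mul]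
    exact mul_le_mul (greenReg_bounds hR hx hy.2 hy.1 hη.1 hη.2)
      (hC y (by simpa using hy.2.le)) (norm_nonneg _) ENNReal.toReal_nonneg
  · exact ((integrable_radialKernel_toReal x _).mul_const C).integrableOn
  · filter_upwards [hne] with y hy
    exact (tendsto_greenReg hR hx hy.2 hy.1).mul_const _

/-- On the ball the reflected distance stays above `R - ‖x‖ > 0`, so the factor `η²` sends the
integral to zero. The reflected pole lies outside the ball and leaves no point mass. -/
theorem tendsto_integral_mirror {R : ℝ} (hR : 0 < R) {x : E} (hx : ‖x‖ < R) {a : E → ℝ}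
    (ha : Continuous a) (c : ℝ) (n : ℕ) :
    Tendsto (fun η : ℝ => ∫ y in ball (0 : E) R,
      a y * (c * η ^ 2 * (√(mirrorSq R x y + η ^ 2) ^ n)⁻¹)) (𝓝[>] 0) (𝓝 0) := by
  have hpos : ∀ y : E, ‖y‖ ≤ R → (R - ‖x‖) ^ 2 ≤ mirrorSq R x y := fun y hy => by
    refine le_trans ?_ (sq_le_mirrorSq hR.ne' x y)
    have : ‖x‖ * ‖y‖ / R ≤ ‖x‖ := by
      rw [div_le_iff₀ hR]; gcongr
    apply pow_le_pow_left₀ (by linarith); linarith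
  have hx' : 0 < R - ‖x‖ := by linarith
  have key : Tendsto (fun η : ℝ => ∫ y in ball (0 : E) R,
      a y * (c * η ^ 2 * (√(mirrorSq R x y + η ^ 2) ^ n)⁻¹)) (𝓝[>] 0)
      (𝓝 (∫ _ in ball (0 : E) R, (0 : ℝ))) := by
    obtain ⟨C, hC⟩ := (isCompact_closedBall (0 : E) R).exists_bound_of_continuousOn ha.continuousOn
    refine tendsto_integral_filter_of_dominated_convergence
      (fun y => C * (|c| * ((R - ‖x‖) ^ n)⁻¹)) ?_ ?_ ?_ ?_
    · filter_upwards [self_mem_nhdsWithin] with η hη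
      refine (Measurable.mul ha.measurable ?_).aestronglyMeasurable
      have : Measurable fun y => mirrorSq R x y :=
        ((continuous_mirrorSq R).comp (Continuous.prodMk_right x)).measurable
      fun_prop
    · filter_upwards [Ioo_mem_nhdsGT (zero_lt_one' ℝ)] with η hη
      filter_upwards [ae_restrict_mem measurableSet_ball] with y hy₀
      have hy := ball_subset_closedBall hy₀
      have hy' : ‖y‖ ≤ R := by simpa using hy
      have h1 : R - ‖x‖ ≤ √(mirrorSq R x y + η ^ 2) :=
        Real.le_sqrt_of_sq_le ((hpos y hy').trans (by nlinarith))
      rw [norm_mul]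
      refine mul_le_mul (hC y hy) ?_ (norm_nonneg _) ((norm_nonneg _).trans (hC y hy))
      rw [norm_mul, norm_mul, Real.norm_eq_abs, norm_inv, norm_pow, norm_pow,
        Real.norm_of_nonneg (Real.sqrt_nonneg _), Real.norm_of_nonneg hη.1.le]
      have h2 : η ^ 2 ≤ 1 := by nlinarith [hη.1, hη.2]
      refine mul_le_mul ?_ ?_ (by positivity) (abs_nonneg _)
      · nlinarith [abs_nonneg c]
      · gcongr
    · exact integrableOn_const (by exact measure_ball_lt_top.ne)
    · filter_upwards [ae_restrict_mem measurableSet_ball] with y hy₀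
      have hy := ball_subset_closedBall hy₀
      have hy' : ‖y‖ ≤ R := by simpa using hy
      have h1 : 0 < mirrorSq R x y := (by positivity : 0 < (R - ‖x‖) ^ 2).trans_le (hpos y hy')
      have h2 : ContinuousAt (fun η : ℝ => a y * (c * η ^ 2 * (√(mirrorSq R x y + η ^ 2) ^ n)⁻¹)) 0 := by
        refine ContinuousAt.mul (by fun_prop) (ContinuousAt.mul (by fun_prop) ?_)
        exact ContinuousAt.inv₀ (by fun_prop)
          (pow_ne_zero _ (by simpa using (Real.sqrt_pos.2 h1).ne'))
      simpa using h2.tendsto.mono_left nhdsWithin_le_nhds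
  simpa only [integral_zero] using key

theorem tendsto_integral_sphere_poisson {R : ℝ} {x : E} (hx : ‖x‖ < R) {a : E → ℝ}
    (ha : Continuous a) (n : ℕ) :
    Tendsto (fun η : ℝ => ∫ ω : sphere (0 : E) 1,
      a (R • (ω : E)) * (√(‖x - R • (ω : E)‖ ^ 2 + η ^ 2) ^ n)⁻¹ ∂(surf E)) (𝓝[>] 0)
      (𝓝 (∫ ω : sphere (0 : E) 1, a (R • (ω : E)) * (‖x - R • (ω : E)‖ ^ n)⁻¹ ∂(surf E))) := by
  have hR : 0 < R := (norm_nonneg x).trans_lt hx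
  have hx' : 0 < R - ‖x‖ := by linarith
  have hd : ∀ ω : sphere (0 : E) 1, R - ‖x‖ ≤ ‖x - R • (ω : E)‖ := fun ω => by
    have h1 : ‖R • (ω : E)‖ = R := by
      rw [norm_smul, norm_eq_of_mem_sphere ω, mul_one, Real.norm_of_nonneg hR.le]
    have := norm_sub_norm_le (R • (ω : E)) x
    rw [norm_sub_rev, h1] at this
    exact this
  obtain ⟨C, hC⟩ := (isCompact_closedBall (0 : E) R).exists_bound_of_continuousOn ha.continuousOn
  refine tendsto_integral_filter_of_dominated_convergence
    (fun y => C * ((R - ‖x‖) ^ n)⁻¹) ?_ ?_ ?_ ?_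
  · filter_upwards [self_mem_nhdsWithin] with η hη
    refine (Measurable.mul (ha.measurable.comp (by fun_prop)) ?_).aestronglyMeasurable
    fun_prop
  · filter_upwards [self_mem_nhdsWithin] with η hη
    refine Eventually.of_forall fun ω => ?_
    have h1 : R - ‖x‖ ≤ √(‖x - R • (ω : E)‖ ^ 2 + η ^ 2) :=
      Real.le_sqrt_of_sq_le (by nlinarith [hd ω])
    rw [norm_mul, norm_inv, norm_pow, Real.norm_of_nonneg (Real.sqrt_nonneg _)]
    have hm : R • (ω : E) ∈ closedBall (0 : E) R := by
      rw [mem_closedBall_zero_iff, norm_smul, norm_eq_of_mem_sphere ω, mul_one,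
        Real.norm_of_nonneg hR.le]
    refine mul_le_mul (hC _ hm) ?_ (by positivity) ((norm_nonneg _).trans (hC _ hm))
    gcongr
  · exact integrable_const _
  · refine Eventually.of_forall fun ω => Tendsto.const_mul _ ?_
    have := hx'.trans_le (hd ω)
    exact ((tendsto_sqrt_add_sq _ (norm_nonneg _)).pow n).inv₀ (by positivity)

/-- The Poisson–Jensen formula for twice continuously differentiable functions. -/
theorem poissonJensen_of_contDiff {a : E → ℝ} (ha : ContDiff ℝ 2 a) {R : ℝ} {x : E}
    (hx : ‖x‖ < R) :
    (surf E).real univ * a x = R ^ (finrank ℝ E - 1) * ((R ^ 2 - ‖x‖ ^ 2) / R *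
      ∫ ω : sphere (0 : E) 1, a (R • (ω : E)) * (‖x - R • (ω : E)‖ ^ finrank ℝ E)⁻¹ ∂(surf E)) -
      ∫ y in ball (0 : E) R, (green (finrank ℝ E) R x y).toReal * Laplacian.laplacian a y := by
  have hR : 0 < R := (norm_nonneg x).trans_lt hx
  set d := finrank ℝ E with hd
  have hΔ := continuous_laplacian ha
  obtain ⟨C, hC⟩ := (isCompact_closedBall (0 : E) R).exists_bound_of_continuousOn
    ha.continuous.continuousOn
  have L1 : Tendsto (fun η : ℝ => ∫ y in ball (0 : E) R,
      a y * (d * η ^ 2 * (√(‖y - x‖ ^ 2 + η ^ 2) ^ (d + 2))⁻¹)) (𝓝[>] 0)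
      (𝓝 ((surf E).real univ * a x)) := by
    have := tendsto_integral_profile (f := (ball (0 : E) R).indicator a)
      (ha.continuous.measurable.indicator measurableSet_ball) (C := C) (x := x) (fun y => by
        by_cases h : y ∈ ball (0 : E) R
        · rw [indicator_of_mem h]; exact hC y (ball_subset_closedBall h)
        · rw [indicator_of_notMem h, norm_zero]
          exact (norm_nonneg _).trans (hC 0 (by simp [hR.le])))
      (ha.continuous.continuousAt.congr (by
        filter_upwards [isOpen_ball.mem_nhds (show x ∈ ball (0 : E) R by simpa using hx)] with y hy
        rw [indicator_of_mem hy]))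
    rw [indicator_of_mem (show x ∈ ball (0 : E) R by simpa using hx)] at this
    refine this.congr fun η => ?_
    rw [← integral_indicator measurableSet_ball]
    congr 1; ext y
    by_cases h : y ∈ ball (0 : E) R <;> simp [h, hd]
  have L2 := tendsto_integral_mirror hR hx ha.continuous (d * (‖x‖ ^ 2 / R ^ 2)) (d + 2)
  have L3 := tendsto_integral_greenReg_mul hR hx hΔ
  have L4 := tendsto_integral_sphere_poisson hx ha.continuous d
  -- Green's identity for `a` and the regularized Green function, solved for the term that
  -- concentrates at `x`.
  have hid : ∀ η : ℝ, 0 < η → ∫ y in ball (0 : E) R,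
      a y * (d * η ^ 2 * (√(‖y - x‖ ^ 2 + η ^ 2) ^ (d + 2))⁻¹) =
      R ^ (d - 1) * ((R ^ 2 - ‖x‖ ^ 2) / R * ∫ ω : sphere (0 : E) 1,
        a (R • (ω : E)) * (√(‖x - R • (ω : E)‖ ^ 2 + η ^ 2) ^ d)⁻¹ ∂(surf E)) +
      (∫ y in ball (0 : E) R, a y * (d * (‖x‖ ^ 2 / R ^ 2) * η ^ 2 *
        (√(mirrorSq R x y + η ^ 2) ^ (d + 2))⁻¹)) -
      ∫ y in ball (0 : E) R, greenReg R x η y * Laplacian.laplacian a y := by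
    intro η hη
    have hg := integral_ball_green ha (contDiff_greenReg hR x hη) hR
    have hcI : ∀ f : E → ℝ, Continuous f → Integrable f (volume.restrict (ball (0 : E) R)) :=
      fun f hf => (hf.continuousOn.integrableOn_compact (isCompact_closedBall (0 : E) R)).mono_set
        ball_subset_closedBall
    have hm : Continuous fun y => mirrorSq R x y :=
      (continuous_mirrorSq R).comp (Continuous.prodMk_right x)
    have c1 : Continuous fun y => a y * (d * η ^ 2 * (√(‖y - x‖ ^ 2 + η ^ 2) ^ (d + 2))⁻¹) := by
      refine ha.continuous.mul (continuous_const.mul (Continuous.inv₀ (by fun_prop) fun y => ?_))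
      positivity
    have c2 : Continuous fun y => a y * (d * (‖x‖ ^ 2 / R ^ 2) * η ^ 2 *
        (√(mirrorSq R x y + η ^ 2) ^ (d + 2))⁻¹) := by
      refine ha.continuous.mul (continuous_const.mul (Continuous.inv₀ (by fun_prop) fun y => ?_))
      have := mirrorSq_nonneg hR.ne' x y
      positivity
    have c3 : Continuous fun y => greenReg R x η y * Laplacian.laplacian a y :=
      (contDiff_greenReg hR x hη).continuous.mul hΔ
    have e1 : ∀ y, a y * Laplacian.laplacian (greenReg R x η) y -
        greenReg R x η y * Laplacian.laplacian a y =
        (a y * (d * (‖x‖ ^ 2 / R ^ 2) * η ^ 2 * (√(mirrorSq R x y + η ^ 2) ^ (d + 2))⁻¹) -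
        a y * (d * η ^ 2 * (√(‖y - x‖ ^ 2 + η ^ 2) ^ (d + 2))⁻¹)) -
        greenReg R x η y * Laplacian.laplacian a y := fun y => by
      rw [laplacian_greenReg hR x hη]; ring
    simp only [e1] at hg
    have i1 := integral_sub (hcI _ (c2.sub c1)) (hcI _ c3)
    have i2 := integral_sub (hcI _ c2) (hcI _ c1)
    simp only [Pi.sub_apply] at i1
    rw [i1, i2] at hg
    have e2 : ∀ ω : sphere (0 : E) 1, a (R • (ω : E)) * fderiv ℝ (greenReg R x η) (R • (ω : E)) ω -
          greenReg R x η (R • (ω : E)) * fderiv ℝ a (R • (ω : E)) ω =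
        -((R ^ 2 - ‖x‖ ^ 2) / R) *
          (a (R • (ω : E)) * (√(‖x - R • (ω : E)‖ ^ 2 + η ^ 2) ^ d)⁻¹) := fun ω => by
      rw [fderiv_greenReg_sphere hR x hη, greenReg_sphere hR x η]
      · ring
      · rw [norm_smul, norm_eq_of_mem_sphere ω, mul_one, Real.norm_of_nonneg hR.le]
    simp only [e2] at hg
    rw [integral_const_mul] at hg
    linarith
  have L5 := (((L4.const_mul ((R ^ 2 - ‖x‖ ^ 2) / R)).const_mul (R ^ (d - 1))).add L2).sub L3
  rw [add_zero] at L5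
  refine tendsto_nhds_unique L1 (L5.congr' ?_)
  filter_upwards [self_mem_nhdsWithin] with η hη
  exact (hid η hη).symm

end DeltaSubharmonic

/-! ### Spherical means, the sign of the Laplacian, and superharmonicity of the kernel. -/

namespace DeltaSubharmonic

variable {E : Type*} [NormedAddCommGroup E] [InnerProductSpace ℝ E] [FiniteDimensional ℝ E]
  [MeasurableSpace E] [BorelSpace E] [Nontrivial E]

theorem laplacian_comp_add_left {a : E → ℝ} (ha : ContDiff ℝ 2 a) (x y : E) :
    Laplacian.laplacian (fun z => a (x + z)) y = Laplacian.laplacian a (x + y) := by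
  have hx : ContDiff ℝ 2 fun z => a (x + z) := ha.comp (contDiff_const.add contDiff_id)
  rw [laplacian_eq_sum_fderiv ha, laplacian_eq_sum_fderiv hx]
  refine Finset.sum_congr rfl fun i _ => ?_
  have h1 : (fun z => fderiv ℝ (fun z => a (x + z)) z (stdOrthonormalBasis ℝ E i)) =
      fun z => (fun w => fderiv ℝ a w (stdOrthonormalBasis ℝ E i)) (x + z) := by
    ext z
    rw [fderiv_comp_add_left (f := a) x]
  exact (congrArg (fun F => fderiv ℝ F y (stdOrthonormalBasis ℝ E i)) h1).trans
    (by rw [fderiv_comp_add_left (f := fun w => fderiv ℝ a w (stdOrthonormalBasis ℝ E i)) x])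

theorem green_zero_left (d : ℕ) {R : ℝ} (hR : 0 < R) (y : E) :
    green d R 0 y = radialKernel d ‖y‖ R := by
  rw [green, zero_sub, norm_neg, mirrorSq]
  simp [Real.sqrt_sq hR.le]

/-- The spherical mean of a twice continuously differentiable function. -/
theorem integral_sphere_eq {a : E → ℝ} (ha : ContDiff ℝ 2 a) (x : E) {t : ℝ} (ht : 0 < t) :
    ∫ ω : sphere (0 : E) 1, a (x + t • (ω : E)) ∂(surf E) = (surf E).real univ * a x +
      ∫ y in ball (0 : E) t, (radialKernel (finrank ℝ E) ‖y‖ t).toReal *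
        Laplacian.laplacian a (x + y) := by
  have hx : ContDiff ℝ 2 fun z => a (x + z) := ha.comp (contDiff_const.add contDiff_id)
  have h := poissonJensen_of_contDiff hx (R := t) (x := 0) (by simpa using ht)
  have e1 : ∀ ω : sphere (0 : E) 1, ‖(0 : E) - t • (ω : E)‖ = t := fun ω => by
    rw [zero_sub, norm_neg, norm_smul, norm_eq_of_mem_sphere ω, mul_one, Real.norm_of_nonneg ht.le]
  simp only [e1, green_zero_left _ ht, laplacian_comp_add_left ha, add_zero, norm_zero] at h
  rw [integral_mul_const] at h
  have e2 : t ^ (finrank ℝ E - 1) * ((t ^ 2 - 0 ^ 2) / t *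
      ((∫ ω : sphere (0 : E) 1, a (x + t • (ω : E)) ∂(surf E)) * (t ^ finrank ℝ E)⁻¹)) =
      ∫ ω : sphere (0 : E) 1, a (x + t • (ω : E)) ∂(surf E) := by
    obtain ⟨n, hn⟩ := Nat.exists_eq_succ_of_ne_zero (finrank_pos (R := ℝ) (M := E)).ne'
    rw [hn, Nat.succ_sub_one, Nat.succ_eq_add_one, pow_succ]
    field_simp
    ring
  rw [e2] at h
  linarith

theorem integral_sphere_le {a : E → ℝ} (ha : ContDiff ℝ 2 a) (x : E) {t : ℝ} (ht : 0 < t)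
    (hΔ : ∀ y ∈ ball x t, Laplacian.laplacian a y ≤ 0) :
    ∫ ω : sphere (0 : E) 1, a (x + t • (ω : E)) ∂(surf E) ≤ (surf E).real univ * a x := by
  rw [integral_sphere_eq ha x ht]
  have : ∫ y in ball (0 : E) t, (radialKernel (finrank ℝ E) ‖y‖ t).toReal *
        Laplacian.laplacian a (x + y) ≤ 0 :=
    setIntegral_nonpos measurableSet_ball fun y hy =>
      mul_nonpos_of_nonneg_of_nonpos ENNReal.toReal_nonneg (hΔ _ (by simpa using hy))
  linarith

theorem radialKernel_toReal_pos (d : ℕ) {a b : ℝ} (ha : 0 < a) (hab : a < b) :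
    0 < (radialKernel d a b).toReal := by
  rw [radialKernel_eq_ofReal d ha hab.le, kappa_sub d ha (ha.trans hab)]
  have : 0 < ∫ τ in a..b, (τ ^ (d - 1))⁻¹ := by
    refine intervalIntegral.intervalIntegral_pos_of_pos_on
      (intervalIntegrable_inv_pow _ ha (ha.trans hab)) (fun τ hτ => ?_) hab
    have := ha.trans hτ.1
    positivity
  rwa [ENNReal.toReal_ofReal this.le]

/-- A positive Laplacian at `x` would be positive on a small ball, and the formula for spherical
means would make the mean strictly larger than the value at `x`. -/
theorem laplacian_nonpos_of_integral_sphere_le {a : E → ℝ} (ha : ContDiff ℝ 2 a) (x : E) {δ : ℝ}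
    (hδ : 0 < δ) (h : ∀ t, 0 < t → t < δ →
      ∫ ω : sphere (0 : E) 1, a (x + t • (ω : E)) ∂(surf E) ≤ (surf E).real univ * a x) :
    Laplacian.laplacian a x ≤ 0 := by
  by_contra! hc
  obtain ⟨ε, hε, hball⟩ := Metric.isOpen_iff.1
    ((continuous_laplacian ha).isOpen_preimage _ (isOpen_Ioi (a := (0 : ℝ)))) x hc
  set t := min ε (δ / 2) with ht
  have ht0 : 0 < t := by positivity
  have h1 := h t ht0 ((min_le_right _ _).trans_lt (by linarith))
  rw [integral_sphere_eq ha x ht0] at h1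
  have hcont : Continuous fun y => Laplacian.laplacian a (x + y) :=
    (continuous_laplacian ha).comp (by fun_prop)
  have hpos : ∀ y ∈ ball (0 : E) t, 0 < Laplacian.laplacian a (x + y) := fun y hy =>
    hball (by simpa using (mem_ball_zero_iff.1 hy).trans_le (min_le_left _ _))
  have hintg : IntegrableOn (fun y => (radialKernel (finrank ℝ E) ‖y‖ t).toReal *
      Laplacian.laplacian a (x + y)) (ball 0 t) := by
    obtain ⟨C, hC⟩ := (isCompact_closedBall (0 : E) t).exists_bound_of_continuousOn
      hcont.continuousOn
    have h3 := (integrable_radialKernel_toReal (0 : E) t).integrableOn (s := ball 0 t)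
    simp only [zero_sub, norm_neg] at h3
    refine Integrable.mul_bdd (c := C) h3 hcont.aestronglyMeasurable ?_
    filter_upwards [ae_restrict_mem measurableSet_ball] with y hy
    exact hC y (ball_subset_closedBall hy)
  have h2 : 0 < ∫ y in ball (0 : E) t, (radialKernel (finrank ℝ E) ‖y‖ t).toReal *
        Laplacian.laplacian a (x + y) := by
    rw [setIntegral_pos_iff_support_of_nonneg_ae _ hintg]
    · refine lt_of_lt_of_le ?_ (measure_mono (s := ball (0 : E) t \ {0}) ?_)
      · rw [measure_sdiff_null (measure_singleton _)]
        exact measure_ball_pos _ _ ht0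
      · rintro y ⟨hy, hy0⟩
        refine ⟨?_, hy⟩
        exact (mul_pos (radialKernel_toReal_pos _ (norm_pos_iff.2 hy0) (by simpa using hy))
          (hpos y hy)).ne'
    · filter_upwards [ae_restrict_mem measurableSet_ball] with y hy
      exact mul_nonneg ENNReal.toReal_nonneg (hpos y hy).le
  linarith

/-- Lower semicontinuity of the kernel in both endpoints. -/
theorem radialKernel_le_liminf (d : ℕ) {a b : ℝ} {u v : ℕ → ℝ} (hu : Tendsto u atTop (𝓝 a))
    (hv : Tendsto v atTop (𝓝 b)) :
    radialKernel d a b ≤ liminf (fun n => radialKernel d (u n) (v n)) atTop := by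
  have hm : Measurable fun t : ℝ => (ENNReal.ofReal (t ^ (d - 1)))⁻¹ := by fun_prop
  simp only [radialKernel, ← lintegral_indicator measurableSet_Ioo]
  refine le_trans (lintegral_mono fun t => ?_)
    (lintegral_liminf_le fun n => hm.indicator measurableSet_Ioo)
  -- The interval is open, so a point inside it is eventually inside the approximating intervals;
  -- Fatou's lemma does the rest.
  by_cases ht : t ∈ Ioo a b
  · rw [indicator_of_mem ht]
    refine le_liminf_of_le (by isBoundedDefault) ?_
    filter_upwards [hu.eventually_lt_const ht.1, hv.eventually_const_lt ht.2] with n h1 h2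
    rw [indicator_of_mem (show t ∈ Ioo (u n) (v n) from ⟨h1, h2⟩)]
  · rw [indicator_of_notMem ht]
    exact zero_le

/-- The kernel is superharmonic in the variable point. -/
theorem lintegral_sphere_radialKernel_le (x y : E) {t T : ℝ} (ht : 0 < t) (hT : ‖x - y‖ + t < T) :
    ∫⁻ ω : sphere (0 : E) 1, radialKernel (finrank ℝ E) ‖x - (y + t • (ω : E))‖ T ∂(surf E) ≤
      surf E univ * radialKernel (finrank ℝ E) ‖x - y‖ T := by
  set d := finrank ℝ E
  have hT0 : 0 < T := by linarith [norm_nonneg (x - y)]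
  -- For such `η` the truncation at `T` is not felt on the ball bounded by the sphere: there the
  -- kernel is `kappa` minus a constant, which is smooth with nonpositive Laplacian after
  -- regularization.
  have hlt : ∀ z : E, ‖x - z‖ ≤ ‖x - y‖ + t → ∀ η : ℝ, η ^ 2 ≤ T ^ 2 - (‖x - y‖ + t) ^ 2 →
      √(‖x - z‖ ^ 2 + η ^ 2) ≤ T := fun z hz η hη => by
    rw [Real.sqrt_le_left hT0.le]
    have := pow_le_pow_left₀ (norm_nonneg (x - z)) hz 2
    linarith
  have key : ∀ η : ℝ, 0 < η → η ^ 2 ≤ T ^ 2 - (‖x - y‖ + t) ^ 2 →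
      ∫⁻ ω : sphere (0 : E) 1, radialKernel d √(‖x - (y + t • (ω : E))‖ ^ 2 + η ^ 2) T ∂(surf E) ≤
      surf E univ * radialKernel d ‖x - y‖ T := by
    intro η hη hη2
    have hpos : ∀ z : E, 0 < 1 * ‖z‖ ^ 2 - 2 * ⟪x, z⟫ + (‖x‖ ^ 2 + η ^ 2) := fun z => by
      rw [quadratic_eq_norm_sub]; positivity
    have hb : ContDiff ℝ 2 fun z : E => kappa d √(‖x - z‖ ^ 2 + η ^ 2) := by
      have := contDiff_kappa_quadratic (d := d) finrank_pos hpos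
      simpa only [quadratic_eq_norm_sub, norm_sub_rev] using this
    have hl : ∀ z : E, Laplacian.laplacian (fun z : E => kappa d √(‖x - z‖ ^ 2 + η ^ 2)) z ≤ 0 := by
      intro z
      have := laplacian_kappa_quadratic (ε := η ^ 2) finrank_pos hpos (by ring) z
      simp only [quadratic_eq_norm_sub, norm_sub_rev _ x] at this
      rw [this, neg_nonpos]
      positivity
    have h1 := integral_sphere_le hb y ht fun z _ => hl z
    have hsp : ∀ ω : sphere (0 : E) 1, ‖x - (y + t • (ω : E))‖ ≤ ‖x - y‖ + t := fun ω => by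
      have h2 : ‖t • (ω : E)‖ = t := by
        rw [norm_smul, norm_eq_of_mem_sphere ω, mul_one, Real.norm_of_nonneg ht.le]
      calc ‖x - (y + t • (ω : E))‖ = ‖(x - y) - t • (ω : E)‖ := by rw [sub_add_eq_sub_sub]
        _ ≤ _ := (norm_sub_le _ _).trans (by rw [h2])
    have hs : ∀ z : E, 0 < √(‖x - z‖ ^ 2 + η ^ 2) := fun z => by positivity
    have hc : Continuous fun ω : sphere (0 : E) 1 =>
        kappa d √(‖x - (y + t • (ω : E))‖ ^ 2 + η ^ 2) := by
      exact hb.continuous.comp (by fun_prop : Continuous fun ω : sphere (0 : E) 1 => y + t • (ω : E))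
    have hi : Integrable (fun ω : sphere (0 : E) 1 =>
        kappa d √(‖x - (y + t • (ω : E))‖ ^ 2 + η ^ 2)) (surf E) :=
      (hc.continuousOn.integrableOn_compact isCompact_univ).integrable_of_forall_notMem_eq_zero
        (by simp)
    calc ∫⁻ ω : sphere (0 : E) 1, radialKernel d √(‖x - (y + t • (ω : E))‖ ^ 2 + η ^ 2) T ∂(surf E)
        = ∫⁻ ω : sphere (0 : E) 1, ENNReal.ofReal
          (kappa d √(‖x - (y + t • (ω : E))‖ ^ 2 + η ^ 2) - kappa d T) ∂(surf E) :=
          lintegral_congr fun ω => radialKernel_eq_ofReal d (hs _) (hlt _ (hsp ω) η hη2)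
      _ = ENNReal.ofReal (∫ ω : sphere (0 : E) 1,
          (kappa d √(‖x - (y + t • (ω : E))‖ ^ 2 + η ^ 2) - kappa d T) ∂(surf E)) := by
        rw [ofReal_integral_eq_lintegral_ofReal (f := fun ω : sphere (0 : E) 1 =>
          kappa d √(‖x - (y + t • (ω : E))‖ ^ 2 + η ^ 2) - kappa d T) (hi.sub (integrable_const _))]
        exact Eventually.of_forall fun ω =>
          sub_nonneg.2 (kappa_anti d (hs _) (hlt _ (hsp ω) η hη2))
      _ ≤ ENNReal.ofReal ((surf E).real univ * (kappa d √(‖x - y‖ ^ 2 + η ^ 2) - kappa d T)) := by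
        apply ENNReal.ofReal_le_ofReal
        rw [integral_sub hi (integrable_const _), integral_const, smul_eq_mul, mul_sub]
        linarith
      _ = surf E univ * radialKernel d √(‖x - y‖ ^ 2 + η ^ 2) T := by
        rw [ENNReal.ofReal_mul measureReal_nonneg, ofReal_measureReal,
          radialKernel_eq_ofReal d (hs _) (hlt _ (by linarith) η hη2)]
      _ ≤ _ := by
        gcongr
        refine radialKernel_mono d (Real.le_sqrt_of_sq_le (by nlinarith)) le_rfl
  have hgap : 0 < T ^ 2 - (‖x - y‖ + t) ^ 2 := by nlinarith [norm_nonneg (x - y)]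
  have h0 : Tendsto (fun n : ℕ => (1 / ((n : ℝ) + 1))) atTop (𝓝 0) :=
    tendsto_one_div_add_atTop_nhds_zero_nat
  have hev : ∀ᶠ n : ℕ in atTop, (1 / ((n : ℝ) + 1)) ^ 2 ≤ T ^ 2 - (‖x - y‖ + t) ^ 2 := by
    have h3 := h0.pow 2
    rw [zero_pow two_ne_zero] at h3
    exact h3.eventually_le_const hgap
  calc ∫⁻ ω : sphere (0 : E) 1, radialKernel d ‖x - (y + t • (ω : E))‖ T ∂(surf E)
      ≤ ∫⁻ ω : sphere (0 : E) 1, liminf (fun n : ℕ => radialKernel d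
        √(‖x - (y + t • (ω : E))‖ ^ 2 + (1 / ((n : ℝ) + 1)) ^ 2) T) atTop ∂(surf E) := by
        refine lintegral_mono fun ω => radialKernel_le_liminf d ?_ tendsto_const_nhds
        have hcont : Continuous fun η : ℝ => √(‖x - (y + t • (ω : E))‖ ^ 2 + η ^ 2) := by fun_prop
        simpa [Function.comp_def, Real.sqrt_sq (norm_nonneg _)] using (hcont.tendsto 0).comp h0
    _ ≤ liminf (fun n : ℕ => ∫⁻ ω : sphere (0 : E) 1, radialKernel d
        √(‖x - (y + t • (ω : E))‖ ^ 2 + (1 / ((n : ℝ) + 1)) ^ 2) T ∂(surf E)) atTop := by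
        refine lintegral_liminf_le fun n => measurable_radialKernel d ?_ measurable_const
        fun_prop
    _ ≤ liminf (fun _ : ℕ => surf E univ * radialKernel d ‖x - y‖ T) atTop := by
        refine liminf_le_liminf ?_
        filter_upwards [hev] with n hn
        exact key _ (by positivity) hn
    _ = _ := liminf_const _

end DeltaSubharmonic

/-! ### Convolution and radial mollifiers. -/

namespace DeltaSubharmonic

variable {E : Type*} [NormedAddCommGroup E] [InnerProductSpace ℝ E] [FiniteDimensional ℝ E]
  [MeasurableSpace E] [BorelSpace E] [Nontrivial E]

/-- The convolution of two real functions. -/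
noncomputable def conv (f k : E → ℝ) (x : E) : ℝ := ∫ y, f y * k (x - y)

theorem conv_eq_convolution (f k : E → ℝ) :
    conv f k = convolution f k (ContinuousLinearMap.mul ℝ ℝ) volume := rfl

theorem contDiff_conv {n : ℕ∞} {f k : E → ℝ} (hf : Integrable f) (hk : ContDiff ℝ n k)
    (hc : HasCompactSupport k) : ContDiff ℝ n (conv f k) :=
  hc.contDiff_convolution_right (ContinuousLinearMap.mul ℝ ℝ) hf.locallyIntegrable hk

theorem fderiv_conv_apply {f k : E → ℝ} (hf : Integrable f) (hk : ContDiff ℝ 1 k)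
    (hc : HasCompactSupport k) (x v : E) :
    fderiv ℝ (conv f k) x v = conv f (fun y => fderiv ℝ k y v) x := by
  have h := (hc.hasFDerivAt_convolution_right (ContinuousLinearMap.mul ℝ ℝ)
    (μ := volume) hf.locallyIntegrable hk x).fderiv
  rw [conv_eq_convolution, h, convolution_precompR_apply _ hf.locallyIntegrable (hc.fderiv ℝ)
    (hk.continuous_fderiv one_ne_zero)]
  rfl

theorem integrable_conv_integrand {f k : E → ℝ} (hf : Integrable f) (hk : Continuous k)
    (hc : HasCompactSupport k) (x : E) : Integrable fun y => f y * k (x - y) := by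
  obtain ⟨C, hC⟩ := hk.bounded_above_of_compact_support hc
  exact hf.mul_bdd (c := C) (by fun_prop) (Eventually.of_forall fun y => hC _)

theorem laplacian_conv {f k : E → ℝ} (hf : Integrable f) (hk : ContDiff ℝ 2 k)
    (hc : HasCompactSupport k) (x : E) :
    Laplacian.laplacian (conv f k) x = conv f (Laplacian.laplacian k) x := by
  have hk1 : ContDiff ℝ 1 k := hk.of_le (by norm_num)
  have h2 : ContDiff ℝ 2 (conv f k) := contDiff_conv (n := 2) hf hk hc
  rw [laplacian_eq_sum_fderiv h2]
  have e : ∀ i, fderiv ℝ (fun y => fderiv ℝ (conv f k) y (stdOrthonormalBasis ℝ E i)) x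
      (stdOrthonormalBasis ℝ E i) = ∫ y, f y * (fun w => fderiv ℝ (fun z => fderiv ℝ k z
        (stdOrthonormalBasis ℝ E i)) w (stdOrthonormalBasis ℝ E i)) (x - y) := fun i => by
    have h3 : (fun y => fderiv ℝ (conv f k) y (stdOrthonormalBasis ℝ E i)) =
        conv f (fun y => fderiv ℝ k y (stdOrthonormalBasis ℝ E i)) :=
      funext fun y => fderiv_conv_apply hf hk1 hc y _
    rw [h3, fderiv_conv_apply hf (contDiff_fderiv_apply_const hk (by norm_num) _)
      (hc.fderiv_apply ℝ _)]
    rfl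
  simp only [e]
  rw [← integral_finsetSum]
  · unfold conv
    congr 1; ext y
    rw [laplacian_eq_sum_fderiv hk, Finset.mul_sum]
  · intro i _
    refine integrable_conv_integrand (k := fun w => fderiv ℝ (fun z => fderiv ℝ k z
        (stdOrthonormalBasis ℝ E i)) w (stdOrthonormalBasis ℝ E i)) hf ?_ ?_ x
    · exact (contDiff_fderiv_apply_const (m := 0)
        (contDiff_fderiv_apply_const (m := 1) hk (by norm_num) _) (by norm_num) _).continuous
    · exact (hc.fderiv_apply ℝ _).fderiv_apply ℝ _

theorem fderiv_comp_neg_apply {F : E → ℝ} (hF : Differentiable ℝ F) (y v : E) :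
    fderiv ℝ (fun z => F (-z)) y v = -fderiv ℝ F (-y) v := by
  have h := (hF (-y)).hasFDerivAt.comp y (hasFDerivAt_id y).neg
  have h2 : fderiv ℝ (fun z => F (-z)) y = _ := h.fderiv
  rw [h2]
  simp

/-- Convolution with an even kernel is self-adjoint; this evenness permits that use with the
Laplacian of the mollifier as the kernel. -/
theorem laplacian_neg_arg {k : E → ℝ} (hk : ContDiff ℝ 2 k) (he : ∀ x, k (-x) = k x) (x : E) :
    Laplacian.laplacian k (-x) = Laplacian.laplacian k x := by
  rw [laplacian_eq_sum_fderiv hk, laplacian_eq_sum_fderiv hk]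
  refine Finset.sum_congr rfl fun i _ => ?_
  have h1 : ∀ y v, fderiv ℝ k (-y) v = -fderiv ℝ k y v := fun y v => by
    have := fderiv_comp_neg_apply (hk.differentiable (by norm_num)) y v
    simp only [he] at this
    rw [this, neg_neg]
  have h2 := fderiv_comp_neg_apply (F := fun y => fderiv ℝ k y (stdOrthonormalBasis ℝ E i))
    ((contDiff_fderiv_apply_const (m := 1) hk (by norm_num) _).differentiable (by norm_num)) x
    (stdOrthonormalBasis ℝ E i)
  simp only [h1, fderiv_fun_neg, neg_apply, neg_inj] at h2
  exact h2.symm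

theorem integral_conv_mul_comm {f g k : E → ℝ} (hf : Integrable f) (hg : Integrable g)
    (hk : Continuous k) (hc : HasCompactSupport k) (he : ∀ x, k (-x) = k x) :
    ∫ x, conv f k x * g x = ∫ x, f x * conv g k x := by
  obtain ⟨C, hC⟩ := hk.bounded_above_of_compact_support hc
  have hintg : Integrable (fun p : E × E => g p.1 * f p.2 * k (p.1 - p.2))
      ((volume : Measure E).prod volume) :=
    (hg.mul_prod hf).mul_bdd (c := C) (by fun_prop) (Eventually.of_forall fun y => hC _)
  calc ∫ x, conv f k x * g x = ∫ x, ∫ y, g x * f y * k (x - y) := by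
        congr 1; ext x
        rw [conv, mul_comm, ← integral_const_mul]
        congr 1; ext y; ring
    _ = ∫ y, ∫ x, g x * f y * k (x - y) := integral_integral_swap hintg
    _ = _ := by
        congr 1; ext y
        rw [conv, ← integral_const_mul]
        congr 1; ext x
        rw [← he (x - y), neg_sub]; ring

/-- A smooth radial bump function supported in the ball of radius `δ`, before normalization. -/
noncomputable def preMollifier (δ : ℝ) (z : E) : ℝ := expNegInvGlue (1 - ‖z‖ ^ 2 / δ ^ 2)

theorem contDiff_preMollifier (δ : ℝ) {n : ℕ∞} : ContDiff ℝ n (preMollifier δ : E → ℝ) :=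
  expNegInvGlue.contDiff.comp (contDiff_const.sub ((contDiff_norm_sq ℝ).div_const _))

theorem preMollifier_nonneg (δ : ℝ) (z : E) : 0 ≤ preMollifier δ z := expNegInvGlue.nonneg _

theorem preMollifier_eq_zero {δ : ℝ} (hδ : 0 < δ) {z : E} (hz : δ ≤ ‖z‖) :
    preMollifier δ z = 0 := by
  refine expNegInvGlue.zero_of_nonpos ?_
  rw [sub_nonpos, one_le_div (by positivity)]
  exact pow_le_pow_left₀ hδ.le hz 2

theorem hasCompactSupport_preMollifier {δ : ℝ} (hδ : 0 < δ) :
    HasCompactSupport (preMollifier δ : E → ℝ) :=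
  HasCompactSupport.intro (isCompact_closedBall (0 : E) δ) fun z hz =>
    preMollifier_eq_zero hδ (by simpa using (not_le.1 (fun h => hz (by simpa using h))).le)

theorem integral_preMollifier_pos {δ : ℝ} (hδ : 0 < δ) : 0 < ∫ z : E, preMollifier δ z := by
  refine Continuous.integral_pos_of_hasCompactSupport_nonneg_nonzero
    (contDiff_preMollifier δ (n := 0)).continuous (hasCompactSupport_preMollifier hδ)
    (preMollifier_nonneg δ) (x := 0) ?_
  exact (expNegInvGlue.pos_of_pos (by simp)).ne'

/-- A smooth radial probability density supported in the ball of radius `δ`. -/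
noncomputable def mollifier (δ : ℝ) (z : E) : ℝ := (∫ w : E, preMollifier δ w)⁻¹ * preMollifier δ z

theorem contDiff_mollifier (δ : ℝ) {n : ℕ∞} : ContDiff ℝ n (mollifier δ : E → ℝ) :=
  contDiff_const.mul (contDiff_preMollifier δ)

theorem continuous_mollifier (δ : ℝ) : Continuous (mollifier δ : E → ℝ) :=
  (contDiff_mollifier δ (n := 0)).continuous

theorem mollifier_nonneg (δ : ℝ) (z : E) : 0 ≤ mollifier δ z :=
  mul_nonneg (inv_nonneg.2 (integral_nonneg (preMollifier_nonneg δ))) (preMollifier_nonneg δ z)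

theorem mollifier_eq_zero {δ : ℝ} (hδ : 0 < δ) {z : E} (hz : δ ≤ ‖z‖) : mollifier δ z = 0 := by
  rw [mollifier, preMollifier_eq_zero hδ hz, mul_zero]

theorem hasCompactSupport_mollifier {δ : ℝ} (hδ : 0 < δ) :
    HasCompactSupport (mollifier δ : E → ℝ) :=
  (hasCompactSupport_preMollifier hδ).mul_left

theorem mollifier_neg (δ : ℝ) (z : E) : mollifier δ (-z) = mollifier δ z := by
  simp [mollifier, preMollifier]

theorem mollifier_eq_of_norm_eq (δ : ℝ) {z w : E} (h : ‖z‖ = ‖w‖) :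
    mollifier δ z = mollifier δ w := by
  simp [mollifier, preMollifier, h]

theorem integral_mollifier {δ : ℝ} (hδ : 0 < δ) : ∫ z : E, mollifier δ z = 1 := by
  simp only [mollifier]
  rw [integral_const_mul, inv_mul_cancel₀ (integral_preMollifier_pos hδ).ne']

theorem integrable_mollifier {δ : ℝ} (hδ : 0 < δ) : Integrable (mollifier δ : E → ℝ) :=
  (continuous_mollifier δ).integrable_of_hasCompactSupport (hasCompactSupport_mollifier hδ)

theorem lintegral_mollifier {δ : ℝ} (hδ : 0 < δ) :
    ∫⁻ z : E, ENNReal.ofReal (mollifier δ z) = 1 := by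
  rw [← ofReal_integral_eq_lintegral_ofReal (integrable_mollifier hδ)
    (Eventually.of_forall (mollifier_nonneg δ)), integral_mollifier hδ, ENNReal.ofReal_one]

/-- The average of a nonnegative extended real function against the mollifier. -/
noncomputable def lconv (s : E → ℝ≥0∞) (δ : ℝ) (x : E) : ℝ≥0∞ :=
  ∫⁻ y, s y * ENNReal.ofReal (mollifier δ (x - y))

theorem lconv_eq (s : E → ℝ≥0∞) (δ : ℝ) (x : E) :
    lconv s δ x = ∫⁻ z, s (x + z) * ENNReal.ofReal (mollifier δ z) := by
  rw [lconv, ← lintegral_add_left_eq_self _ x]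
  simp [mollifier_neg]

theorem lconv_const {δ : ℝ} (hδ : 0 < δ) (c : ℝ≥0∞) (x : E) : lconv (fun _ => c) δ x = c := by
  rw [lconv_eq, lintegral_const_mul _ (continuous_mollifier δ).measurable.ennreal_ofReal,
    lintegral_mollifier hδ, mul_one]

theorem lconv_mono_on {s s' : E → ℝ≥0∞} {δ : ℝ} (hδ : 0 < δ) {x : E}
    (h : ∀ y ∈ ball x δ, s y ≤ s' y) : lconv s δ x ≤ lconv s' δ x := by
  refine lintegral_mono fun y => ?_
  by_cases hy : y ∈ ball x δ
  · dsimp only; gcongr; exact h y hy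
  · have : mollifier δ (x - y) = 0 := mollifier_eq_zero hδ (by
      rw [← dist_eq_norm, dist_comm]; exact not_lt.1 hy)
    simp [this]

theorem measurable_lconv {s : E → ℝ≥0∞} (hs : Measurable s) (δ : ℝ) : Measurable (lconv s δ) := by
  refine Measurable.lintegral_prod_right' (f := fun p : E × E =>
    s p.2 * ENNReal.ofReal (mollifier δ (p.1 - p.2))) ?_
  have := (continuous_mollifier (E := E) δ).measurable
  fun_prop

/-- Links the smooth real convolution, which can be differentiated, with the `[0, ∞]`-valued
average, which is defined and monotone without any summability. -/
theorem ofReal_conv_mollifier {s : E → ℝ≥0∞} (hs : Measurable s) (hfin : ∫⁻ y, s y ≠ ∞)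
    (δ : ℝ) (hδ : 0 < δ) (x : E) :
    ENNReal.ofReal (conv (fun y => (s y).toReal) (mollifier δ) x) = lconv s δ x := by
  have hi : Integrable fun y => (s y).toReal :=
    integrable_toReal_of_lintegral_ne_top hs.aemeasurable hfin
  rw [conv, ofReal_integral_eq_lintegral_ofReal (integrable_conv_integrand hi
    (continuous_mollifier δ) (hasCompactSupport_mollifier hδ) x)
    (Eventually.of_forall fun y => mul_nonneg ENNReal.toReal_nonneg (mollifier_nonneg δ _))]
  refine lintegral_congr_ae ?_
  filter_upwards [ae_lt_top hs hfin] with y hy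
  rw [ENNReal.ofReal_mul ENNReal.toReal_nonneg, ENNReal.ofReal_toReal hy.ne]

theorem tendsto_lconv {s : E → ℝ≥0∞} {x : E} (hs : ContinuousAt s x) {δ : ℕ → ℝ}
    (hδ : ∀ n, 0 < δ n) (hδ0 : Tendsto δ atTop (𝓝 0)) :
    Tendsto (fun n => lconv s (δ n) x) atTop (𝓝 (s x)) := by
  refine tendsto_order.2 ⟨fun c hc => ?_, fun c hc => ?_⟩
  · obtain ⟨c', h1, h2⟩ := exists_between hc
    obtain ⟨ε, hε, hb⟩ := Metric.eventually_nhds_iff_ball.1 (hs.eventually_const_lt h2)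
    filter_upwards [hδ0.eventually_lt_const hε] with n hn
    refine h1.trans_le ((lconv_const (hδ n) c' x).symm.le.trans (lconv_mono_on (hδ n) ?_))
    exact fun y hy => (hb y (ball_subset_ball hn.le hy)).le
  · obtain ⟨c', h1, h2⟩ := exists_between hc
    obtain ⟨ε, hε, hb⟩ := Metric.eventually_nhds_iff_ball.1 (hs.eventually_lt_const h1)
    filter_upwards [hδ0.eventually_lt_const hε] with n hn
    refine lt_of_le_of_lt ((lconv_mono_on (s' := fun _ => c') (hδ n) ?_).trans
      (lconv_const (hδ n) c' x).le) h2
    exact fun y hy => (hb y (ball_subset_ball hn.le hy)).le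

/-- Lower semicontinuity bounds the averages from below in the limit, the hypothesis from above. The
value `s x = ∞` is allowed. -/
theorem tendsto_lconv_of_le {s : E → ℝ≥0∞} {x : E} (hs : LowerSemicontinuousAt s x) {δ : ℕ → ℝ}
    (hδ : ∀ n, 0 < δ n) (hδ0 : Tendsto δ atTop (𝓝 0)) (h : ∀ᶠ n in atTop, lconv s (δ n) x ≤ s x) :
    Tendsto (fun n => lconv s (δ n) x) atTop (𝓝 (s x)) := by
  refine tendsto_order.2 ⟨fun c hc => ?_, fun c hc => ?_⟩
  · obtain ⟨c', h1, h2⟩ := exists_between hc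
    obtain ⟨ε, hε, hb⟩ := Metric.eventually_nhds_iff_ball.1 (hs c' h2)
    filter_upwards [hδ0.eventually_lt_const hε] with n hn
    refine h1.trans_le ((lconv_const (hδ n) c' x).symm.le.trans (lconv_mono_on (hδ n) ?_))
    exact fun y hy => (hb y (ball_subset_ball hn.le hy)).le
  · filter_upwards [h] with n hn using hn.trans_lt hc

/-- The mollifier is constant on spheres, so in polar coordinates the average is a weighted average
of spherical means, each at most the value at the centre. -/
theorem lconv_le_self {s : E → ℝ≥0∞} (hs : Measurable s) {δ : ℝ} (hδ : 0 < δ) {x : E}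
    (h : ∀ t, 0 < t → t < δ →
      ∫⁻ ω : sphere (0 : E) 1, s (x + t • (ω : E)) ∂(surf E) ≤ surf E univ * s x) :
    lconv s δ x ≤ s x := by
  have hm := (continuous_mollifier (E := E) δ).measurable
  obtain ⟨e, he⟩ := exists_ne (0 : E)
  obtain ⟨θ, hθ⟩ : ∃ θ : ℝ → ℝ, ∀ t, 0 < t → ∀ ω : sphere (0 : E) 1,
      mollifier δ (t • (ω : E)) = θ t := by
    refine ⟨fun t => mollifier δ ((t / ‖e‖) • e), fun t ht ω => mollifier_eq_of_norm_eq δ ?_⟩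
    rw [norm_smul, norm_smul, norm_eq_of_mem_sphere ω, norm_div, norm_norm]
    field_simp [norm_ne_zero_iff.2 he]
  calc lconv s δ x = ∫⁻ t in Ioi (0 : ℝ), ENNReal.ofReal (t ^ (finrank ℝ E - 1)) *
        ∫⁻ ω : sphere (0 : E) 1, s (x + t • (ω : E)) *
          ENNReal.ofReal (mollifier δ (t • (ω : E))) ∂(surf E) := by
        rw [lconv_eq]
        exact lintegral_polar (f := fun z => s (x + z) * ENNReal.ofReal (mollifier δ z))
          (by fun_prop)
    _ ≤ ∫⁻ t in Ioi (0 : ℝ), ENNReal.ofReal (t ^ (finrank ℝ E - 1)) *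
        ∫⁻ ω : sphere (0 : E) 1, s x * ENNReal.ofReal (mollifier δ (t • (ω : E))) ∂(surf E) := by
        refine setLIntegral_mono' measurableSet_Ioi fun t ht => ?_
        refine mul_le_mul' le_rfl ?_
        have ht' : (0 : ℝ) < t := ht
        simp only [hθ t ht]
        rw [lintegral_mul_const _ (by fun_prop), lintegral_const, mul_right_comm]
        by_cases htδ : t < δ
        · gcongr
          rw [mul_comm]
          exact h t ht htδ
        · have : θ t = 0 := by
            obtain ⟨ω⟩ : Nonempty (sphere (0 : E) 1) :=
              (NormedSpace.sphere_nonempty.2 zero_le_one).to_subtype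
            rw [← hθ t ht ω]
            refine mollifier_eq_zero hδ ?_
            rw [norm_smul, norm_eq_of_mem_sphere ω, mul_one, Real.norm_of_nonneg ht'.le]
            exact not_lt.1 htδ
          simp [this]
    _ = lconv (fun _ => s x) δ x := by
        rw [lconv_eq]
        exact (lintegral_polar (f := fun z => s x * ENNReal.ofReal (mollifier δ z))
          (by fun_prop)).symm
    _ = s x := lconv_const hδ _ _

/-- Averaging over spheres commutes with mollification by Tonelli, so the mean value inequality
passes to the average. -/
theorem lintegral_sphere_lconv_le {s : E → ℝ≥0∞} (hs : Measurable s) {δ : ℝ} (hδ : 0 < δ) {x : E}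
    {t : ℝ} (h : ∀ y ∈ ball x δ,
      ∫⁻ ω : sphere (0 : E) 1, s (y + t • (ω : E)) ∂(surf E) ≤ surf E univ * s y) :
    ∫⁻ ω : sphere (0 : E) 1, lconv s δ (x + t • (ω : E)) ∂(surf E) ≤
      surf E univ * lconv s δ x := by
  have hm := (continuous_mollifier (E := E) δ).measurable
  simp only [lconv_eq]
  rw [lintegral_lintegral_swap (by fun_prop), ← lintegral_const_mul _ (by fun_prop)]
  refine lintegral_mono fun z => ?_
  dsimp only
  rw [lintegral_mul_const _ (by fun_prop), ← mul_assoc]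
  by_cases hz : ‖z‖ < δ
  · gcongr
    have := h (x + z) (by simpa using hz)
    simpa only [add_right_comm] using this
  · simp [mollifier_eq_zero hδ (not_lt.1 hz)]

end DeltaSubharmonic

/-! ### Superharmonic functions: regularization, existence and uniqueness of the Riesz measure. -/

namespace DeltaSubharmonic

variable {E : Type*} [NormedAddCommGroup E] [InnerProductSpace ℝ E] [FiniteDimensional ℝ E]
  [MeasurableSpace E] [BorelSpace E] [Nontrivial E]

/-- Nonnegative summable functions which are superharmonic on the ball of radius `ρ`. -/
structure IsSuperharmonic (s : E → ℝ≥0∞) (ρ : ℝ) : Prop where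
  lsc : LowerSemicontinuous s
  mean_le : ∀ (x : E) (t : ℝ), 0 < t → ‖x‖ + t < ρ →
    ∫⁻ ω : sphere (0 : E) 1, s (x + t • (ω : E)) ∂(surf E) ≤ surf E univ * s x
  lintegral_ne_top : ∫⁻ x, s x ≠ ∞

namespace IsSuperharmonic

variable {s : E → ℝ≥0∞} {ρ : ℝ}

theorem measurable (hs : IsSuperharmonic s ρ) : Measurable s := hs.lsc.measurable

theorem integrable (hs : IsSuperharmonic s ρ) : Integrable fun x => (s x).toReal :=
  integrable_toReal_of_lintegral_ne_top hs.measurable.aemeasurable hs.lintegral_ne_top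

/-- The smooth regularization. -/
noncomputable def _root_.DeltaSubharmonic.smoothing (s : E → ℝ≥0∞) (δ : ℝ) : E → ℝ :=
  conv (fun x => (s x).toReal) (mollifier δ)

theorem contDiff_smoothing (hs : IsSuperharmonic s ρ) {δ : ℝ} (hδ : 0 < δ) {n : ℕ∞} :
    ContDiff ℝ n (smoothing s δ) :=
  contDiff_conv hs.integrable (contDiff_mollifier δ) (hasCompactSupport_mollifier hδ)

theorem _root_.DeltaSubharmonic.smoothing_nonneg (s : E → ℝ≥0∞) (δ : ℝ) (x : E) :
    0 ≤ smoothing s δ x :=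
  integral_nonneg fun _ => mul_nonneg ENNReal.toReal_nonneg (mollifier_nonneg δ _)

theorem ofReal_smoothing (hs : IsSuperharmonic s ρ) {δ : ℝ} (hδ : 0 < δ) (x : E) :
    ENNReal.ofReal (smoothing s δ x) = lconv s δ x :=
  ofReal_conv_mollifier hs.measurable hs.lintegral_ne_top δ hδ x

theorem lconv_le (hs : IsSuperharmonic s ρ) {δ : ℝ} (hδ : 0 < δ) {x : E} (hx : ‖x‖ + δ ≤ ρ) :
    lconv s δ x ≤ s x :=
  lconv_le_self hs.measurable hδ fun t ht htδ => hs.mean_le x t ht (by linarith)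

theorem tendsto_lconv (hs : IsSuperharmonic s ρ) {x : E} (hx : ‖x‖ < ρ) {δ : ℕ → ℝ}
    (hδ : ∀ n, 0 < δ n) (hδ0 : Tendsto δ atTop (𝓝 0)) :
    Tendsto (fun n => lconv s (δ n) x) atTop (𝓝 (s x)) := by
  refine tendsto_lconv_of_le (hs.lsc x) hδ hδ0 ?_
  filter_upwards [hδ0.eventually_lt_const (show 0 < ρ - ‖x‖ by linarith)] with n hn
  exact hs.lconv_le (hδ n) (by linarith)

/-- The smoothing inherits the mean value inequality for spheres of radius below `ρ - ‖x‖ - δ`, and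
for a `C²` function this fixes the sign of the Laplacian. -/
theorem laplacian_smoothing_nonpos (hs : IsSuperharmonic s ρ) {δ : ℝ} (hδ : 0 < δ) {x : E}
    (hx : ‖x‖ + δ < ρ) : Laplacian.laplacian (smoothing s δ) x ≤ 0 := by
  have hc := (hs.contDiff_smoothing hδ (n := 2)).continuous
  refine laplacian_nonpos_of_integral_sphere_le (hs.contDiff_smoothing hδ (n := 2)) x
    (show 0 < ρ - ‖x‖ - δ by linarith) fun t ht htδ => ?_
  have h := lintegral_sphere_lconv_le hs.measurable hδ (x := x) (t := t) fun y hy =>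
    hs.mean_le y t ht (by
      have := norm_le_norm_add_norm_sub' y x
      rw [mem_ball, dist_eq_norm] at hy
      linarith)
  simp only [← hs.ofReal_smoothing hδ] at h
  have hi : Integrable (fun ω : sphere (0 : E) 1 => smoothing s δ (x + t • (ω : E))) (surf E) := by
    have hcc : Continuous fun ω : sphere (0 : E) 1 => smoothing s δ (x + t • (ω : E)) :=
      hc.comp (by fun_prop)
    exact (hcc.continuousOn.integrableOn_compact isCompact_univ).integrable_of_forall_notMem_eq_zero
        (by simp)
  rw [← ofReal_integral_eq_lintegral_ofReal hi
    (Eventually.of_forall fun _ => smoothing_nonneg s δ _), ← ofReal_measureReal (μ := surf E),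
    ← ENNReal.ofReal_mul measureReal_nonneg] at h
  exact (ENNReal.ofReal_le_ofReal_iff
    (mul_nonneg measureReal_nonneg (smoothing_nonneg s δ x))).1 h

theorem laplacian_smoothing (hs : IsSuperharmonic s ρ) {δ : ℝ} (hδ : 0 < δ) (x : E) :
    Laplacian.laplacian (smoothing s δ) x =
      conv (fun x => (s x).toReal) (Laplacian.laplacian (mollifier δ : E → ℝ)) x :=
  laplacian_conv hs.integrable (contDiff_mollifier δ (n := 2)) (hasCompactSupport_mollifier hδ) x

/-- Transfer of the Laplacian of the regularization to the test function. -/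
theorem integral_mul_laplacian_smoothing (hs : IsSuperharmonic s ρ) {δ : ℝ} (hδ : 0 < δ)
    {g : E → ℝ} (hg : Integrable g) :
    ∫ x, g x * Laplacian.laplacian (smoothing s δ) x =
      ∫ x, (s x).toReal * Laplacian.laplacian (conv g (mollifier δ)) x := by
  have hk : ContDiff ℝ 2 (mollifier δ : E → ℝ) := contDiff_mollifier δ (n := 2)
  have hc := hasCompactSupport_mollifier (E := E) hδ
  simp only [hs.laplacian_smoothing hδ, laplacian_conv hg hk hc]
  rw [← integral_conv_mul_comm hs.integrable hg (continuous_laplacian hk)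
    (hc.mono' ((subset_tsupport _).trans (tsupport_laplacian_subset hk)))
    (laplacian_neg_arg hk (mollifier_neg δ))]
  simp only [mul_comm]

end IsSuperharmonic

theorem abs_conv_mollifier_le {g : E → ℝ} {C : ℝ} (hC : ∀ x, ‖g x‖ ≤ C)
    {δ : ℝ} (hδ : 0 < δ) (x : E) : ‖conv g (mollifier δ) x‖ ≤ C := by
  calc ‖conv g (mollifier δ) x‖ ≤ ∫ y, C * mollifier δ (x - y) := by
        refine norm_integral_le_of_norm_le
          (((integrable_mollifier hδ).comp_sub_left x).const_mul C) ?_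
        refine Eventually.of_forall fun y => ?_
        rw [norm_mul, Real.norm_of_nonneg (mollifier_nonneg δ _)]
        exact mul_le_mul_of_nonneg_right (hC y) (mollifier_nonneg δ _)
    _ = C := by
        rw [integral_const_mul, integral_sub_left_eq_self (mollifier δ : E → ℝ) volume x,
          integral_mollifier hδ, mul_one]

theorem tendsto_conv_mollifier {g : E → ℝ} (hg : Continuous g) (hc : HasCompactSupport g)
    {δ : ℕ → ℝ} (hδ : ∀ n, 0 < δ n) (hδ0 : Tendsto δ atTop (𝓝 0)) (x : E) :
    Tendsto (fun n => conv g (mollifier (δ n)) x) atTop (𝓝 (g x)) := by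
  have hgi : Integrable g := hg.integrable_of_hasCompactSupport hc
  rw [Metric.tendsto_atTop]
  intro ε hε
  obtain ⟨η, hη, hb⟩ := Metric.continuousAt_iff.1 (hg.continuousAt (x := x)) (ε / 2) (by positivity)
  obtain ⟨N, hN⟩ := eventually_atTop.1 (hδ0.eventually_lt_const hη)
  refine ⟨N, fun n hn => ?_⟩
  have hm : Integrable fun y => mollifier (δ n) (x - y) :=
    (integrable_mollifier (hδ n)).comp_sub_left x
  have h1 : ∫ y, mollifier (δ n) (x - y) = 1 := by
    rw [integral_sub_left_eq_self (mollifier (δ n) : E → ℝ) volume x, integral_mollifier (hδ n)]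
  have h2 : conv g (mollifier (δ n)) x - g x = ∫ y, (g y - g x) * mollifier (δ n) (x - y) := by
    simp only [sub_mul]
    rw [integral_sub (integrable_conv_integrand hgi (continuous_mollifier _)
      (hasCompactSupport_mollifier (hδ n)) x) (hm.const_mul _), integral_const_mul, h1, mul_one, conv]
  rw [dist_eq_norm, h2]
  calc _ ≤ ∫ y, ε / 2 * mollifier (δ n) (x - y) := by
        refine norm_integral_le_of_norm_le (hm.const_mul _) (Eventually.of_forall fun y => ?_)
        rw [norm_mul, Real.norm_of_nonneg (mollifier_nonneg _ _)]
        by_cases hy : ‖x - y‖ < δ n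
        · refine mul_le_mul_of_nonneg_right ?_ (mollifier_nonneg _ _)
          rw [← dist_eq_norm]
          exact (hb (by rw [dist_comm, dist_eq_norm]; exact hy.trans (hN n hn))).le
        · rw [mollifier_eq_zero (hδ n) (not_lt.1 hy)]; simp
    _ = ε / 2 := by rw [integral_const_mul, h1, mul_one]
    _ < ε := by linarith

namespace IsSuperharmonic

variable {s : E → ℝ≥0∞} {ρ : ℝ}

/-- The distributional Laplacians of the regularizations converge. -/
theorem tendsto_integral_mul_laplacian_smoothing (hs : IsSuperharmonic s ρ) {φ : E → ℝ}
    (hφ : ContDiff ℝ 2 φ) (hc : HasCompactSupport φ) {δ : ℕ → ℝ} (hδ : ∀ n, 0 < δ n)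
    (hδ0 : Tendsto δ atTop (𝓝 0)) :
    Tendsto (fun n => ∫ x, φ x * Laplacian.laplacian (smoothing s (δ n)) x) atTop
      (𝓝 (∫ x, (s x).toReal * Laplacian.laplacian φ x)) := by
  have hΔ := continuous_laplacian hφ
  have hcΔ : HasCompactSupport (Laplacian.laplacian φ) :=
    hc.mono' ((subset_tsupport _).trans (tsupport_laplacian_subset hφ))
  obtain ⟨C, hC⟩ := hΔ.bounded_above_of_compact_support hcΔ
  have e : ∀ n, ∫ x, φ x * Laplacian.laplacian (smoothing s (δ n)) x =
      ∫ x, (s x).toReal * conv (Laplacian.laplacian φ) (mollifier (δ n)) x := fun n => by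
    rw [integral_mul_laplacian_comm (hs.contDiff_smoothing (hδ n) (n := 2)) hφ hc, smoothing,
      integral_conv_mul_comm hs.integrable (hΔ.integrable_of_hasCompactSupport hcΔ)
        (continuous_mollifier _) (hasCompactSupport_mollifier (hδ n)) (mollifier_neg _)]
  simp only [e]
  refine tendsto_integral_of_dominated_convergence (fun x => (s x).toReal * C) (fun n => ?_)
    (hs.integrable.mul_const C) (fun n => Eventually.of_forall fun x => ?_)
    (Eventually.of_forall fun x => ?_)
  · refine hs.integrable.aestronglyMeasurable.mul ?_
    exact (contDiff_conv (n := 0) (hΔ.integrable_of_hasCompactSupport hcΔ) (contDiff_mollifier _)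
      (hasCompactSupport_mollifier (hδ n))).continuous.aestronglyMeasurable
  · rw [norm_mul, Real.norm_of_nonneg ENNReal.toReal_nonneg]
    exact mul_le_mul_of_nonneg_left (abs_conv_mollifier_le hC (hδ n) x) ENNReal.toReal_nonneg
  · exact (tendsto_conv_mollifier hΔ hcΔ hδ hδ0 x).const_mul _

/-- Existence of the (unnormalized) Riesz measure on a smaller ball. -/
theorem exists_measure (hs : IsSuperharmonic s ρ) {ρ' : ℝ} (hρ' : 0 < ρ') (h : ρ' < ρ) :
    ∃ ν : Measure E, IsFiniteMeasure ν ∧ ∀ φ : E → ℝ, ContDiff ℝ 2 φ → HasCompactSupport φ →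
      tsupport φ ⊆ ball 0 ρ' → ∫ x, φ x ∂ν = -∫ x, (s x).toReal * Laplacian.laplacian φ x := by
  obtain ⟨ρ₂, hρ₂, h₂⟩ := exists_between h
  let χ : ContDiffBump (0 : E) := ⟨ρ', ρ₂, hρ', hρ₂⟩
  have hχ2 : ContDiff ℝ 2 χ := χ.contDiff
  -- The denominator `n + 2` keeps every `δ n` strictly below `ρ - ρ₂`, so the Laplacian of the
  -- smoothing is nonpositive where `χ` is nonzero.
  set δ : ℕ → ℝ := fun n => (ρ - ρ₂) / (n + 2) with hδdef
  have hδ : ∀ n, 0 < δ n := fun n => div_pos (by linarith) (by positivity)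
  have hδlt : ∀ n, δ n < ρ - ρ₂ := fun n => by
    rw [hδdef]
    exact div_lt_self (by linarith) (by linarith [Nat.cast_nonneg (α := ℝ) n])
  have hδ0 : Tendsto δ atTop (𝓝 0) :=
    (tendsto_const_nhds (x := ρ - ρ₂)).div_atTop
      (tendsto_natCast_atTop_atTop.atTop_add tendsto_const_nhds)
  have hnn : ∀ n x, 0 ≤ χ x * -Laplacian.laplacian (smoothing s (δ n)) x := fun n x => by
    by_cases hx : ‖x‖ < ρ₂
    · exact mul_nonneg χ.nonneg (neg_nonneg.2 (hs.laplacian_smoothing_nonpos (hδ n)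
        (by linarith [hδlt n])))
    · rw [χ.zero_of_le_dist (by rw [dist_zero_right]; exact not_lt.1 hx), zero_mul]
  have hcont : ∀ n, Continuous fun x => χ x * -Laplacian.laplacian (smoothing s (δ n)) x := fun n =>
    χ.continuous.mul (continuous_laplacian (hs.contDiff_smoothing (hδ n) (n := 2))).neg
  have hintg : ∀ n, Integrable fun x => χ x * -Laplacian.laplacian (smoothing s (δ n)) x := fun n =>
    (hcont n).integrable_of_hasCompactSupport χ.hasCompactSupport.mul_right
  let m : ℕ → Measure E := fun n =>
    volume.withDensity fun x => ENNReal.ofReal (χ x * -Laplacian.laplacian (smoothing s (δ n)) x)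
  have hmass : ∀ n, m n univ = ENNReal.ofReal
      (∫ x, χ x * -Laplacian.laplacian (smoothing s (δ n)) x) := fun n => by
    rw [withDensity_apply _ MeasurableSet.univ, Measure.restrict_univ,
      ofReal_integral_eq_lintegral_ofReal (hintg n) (Eventually.of_forall (hnn n))]
  have hfin : ∀ n, IsFiniteMeasure (m n) := fun n => ⟨by rw [hmass]; exact ENNReal.ofReal_lt_top⟩
  -- The total masses converge, since the Laplacian can be moved onto the bump function; hence they
  -- are bounded.
  obtain ⟨C, hC⟩ : BddAbove (range fun n =>
      ∫ x, χ x * -Laplacian.laplacian (smoothing s (δ n)) x) := by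
    have := (hs.tendsto_integral_mul_laplacian_smoothing hχ2 χ.hasCompactSupport hδ hδ0).neg
    simp only [← integral_neg, ← mul_neg] at this
    exact this.bddAbove_range
  let μ : ℕ → FiniteMeasure E := fun n => ⟨m n, hfin n⟩
  have hK := isCompact_setOfPred_finiteMeasure_le_of_isCompact (E := E) C.toNNReal
    (isCompact_closedBall (0 : E) ρ₂)
  have hμK : ∀ n, μ n ∈ {μ : FiniteMeasure E | μ.mass ≤ C.toNNReal ∧ μ (closedBall 0 ρ₂)ᶜ = 0} := by
    refine fun n => ⟨?_, ?_⟩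
    · rw [← ENNReal.coe_le_coe, FiniteMeasure.ennreal_mass]
      change m n univ ≤ _
      rw [hmass]
      exact ENNReal.ofReal_le_ofReal (hC ⟨n, rfl⟩)
    · rw [← ENNReal.coe_eq_zero, FiniteMeasure.ennreal_coeFn_eq_coeFn_toMeasure]
      change m n _ = 0
      rw [withDensity_apply _ measurableSet_closedBall.compl]
      refine (setLIntegral_congr_fun measurableSet_closedBall.compl fun x hx => ?_).trans
        lintegral_zero
      have : ρ₂ ≤ ‖x‖ := by
        by_contra! hlt
        exact hx (by simpa using hlt.le)
      rw [χ.zero_of_le_dist (by rwa [dist_zero_right]), zero_mul, ENNReal.ofReal_zero]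
  -- Measures of bounded mass carried by a compact set form a weakly compact set. A limit along a
  -- free ultrafilter suffices, because the integrals of test functions converge along the whole
  -- sequence.
  obtain ⟨ν, -, hν⟩ := hK.ultrafilter_le_nhds ((hyperfilter ℕ).map μ)
    (le_principal_iff.2 (Ultrafilter.mem_map.2 (univ_mem' hμK)))
  have hν' : Tendsto μ (hyperfilter ℕ : Filter ℕ) (𝓝 ν) := hν
  refine ⟨ν, inferInstance, fun φ hφ hc hsupp => ?_⟩
  have hφc := hφ.continuous
  obtain ⟨B, hB⟩ := hφc.bounded_above_of_compact_support hc
  let φb : BoundedContinuousFunction E ℝ := BoundedContinuousFunction.ofNormedAddCommGroup φ hφc B hB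
  have h1 : Tendsto (fun n => ∫ x, φ x ∂(m n)) (hyperfilter ℕ : Filter ℕ) (𝓝 (∫ x, φ x ∂(ν : Measure E))) :=
    (FiniteMeasure.tendsto_iff_forall_integral_tendsto.1 hν') φb
  have h2 : Tendsto (fun n => ∫ x, φ x ∂(m n)) (hyperfilter ℕ : Filter ℕ)
      (𝓝 (-∫ x, (s x).toReal * Laplacian.laplacian φ x)) := by
    refine Tendsto.mono_left ?_ (Nat.hyperfilter_le_atTop)
    refine (hs.tendsto_integral_mul_laplacian_smoothing hφ hc hδ hδ0).neg.congr fun n => ?_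
    rw [integral_withDensity_eq_integral_toReal_smul (hcont n).measurable.ennreal_ofReal
      (Eventually.of_forall fun _ => ENNReal.ofReal_lt_top), ← integral_neg]
    congr 1; ext x
    rw [ENNReal.toReal_ofReal (hnn n x), smul_eq_mul]
    by_cases hx : x ∈ tsupport φ
    · rw [χ.one_of_mem_closedBall (ball_subset_closedBall (hsupp hx))]; ring
    · rw [image_eq_zero_of_notMem_tsupport hx]; ring
  exact tendsto_nhds_unique h1 h2

end IsSuperharmonic

/-- A measure on an open ball is determined by the integrals of test functions. -/
theorem restrict_ball_eq_of_integral_eq {ν₁ ν₂ : Measure E} {R : ℝ}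
    (h₁ : ∀ K : Set E, IsCompact K → K ⊆ ball 0 R → ν₁ K < ∞)
    (h₂ : ∀ K : Set E, IsCompact K → K ⊆ ball 0 R → ν₂ K < ∞)
    (h : ∀ φ : E → ℝ, ContDiff ℝ (⊤ : ℕ∞) φ → HasCompactSupport φ → tsupport φ ⊆ ball 0 R →
      ∫ x, φ x ∂ν₁ = ∫ x, φ x ∂ν₂) :
    ν₁.restrict (ball 0 R) = ν₂.restrict (ball 0 R) := by
  have hopen : ∀ (U : Set E) (t : ℝ), IsOpen U → t < R → U ⊆ ball 0 t → ν₁ U = ν₂ U := by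
    intro U t hU ht hUt
    have hK : closedBall (0 : E) t ⊆ ball 0 R := closedBall_subset_ball ht
    have hUK : U ⊆ closedBall 0 t := hUt.trans ball_subset_closedBall
    have f1 : ν₁ U < ∞ := (measure_mono hUK).trans_lt (h₁ _ (isCompact_closedBall _ _) hK)
    have f2 : ν₂ U < ∞ := (measure_mono hUK).trans_lt (h₂ _ (isCompact_closedBall _ _) hK)
    -- Since `g` is positive exactly on `U`, the functions `smoothTransition (n * g)` are smooth and
    -- tend pointwise to the indicator of `U`.
    obtain ⟨g, hgs, hg, hg0⟩ := hU.exists_contDiff_support_eq (n := ⊤)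
    let φ : ℕ → E → ℝ := fun n x => Real.smoothTransition (n * g x)
    have hzero : ∀ x, x ∉ U → g x = 0 := fun x hx => by
      rw [← hgs] at hx; simpa using hx
    have hφ : ∀ n, ContDiff ℝ (⊤ : ℕ∞) (φ n) := fun n =>
      Real.smoothTransition.contDiff.comp (contDiff_const.mul hg)
    have hφs : ∀ n, tsupport (φ n) ⊆ closedBall 0 t := fun n => by
      refine closure_minimal (fun x hx => ?_) isClosed_closedBall
      by_contra hx'
      refine hx ?_
      change Real.smoothTransition (n * g x) = 0
      rw [hzero x fun h => hx' (hUK h), mul_zero, Real.smoothTransition.zero]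
    have hφc : ∀ n, HasCompactSupport (φ n) := fun n =>
      (isCompact_closedBall (0 : E) t).of_isClosed_subset (isClosed_tsupport _) (hφs n)
    have hlim : ∀ x, Tendsto (fun n => φ n x) atTop (𝓝 (U.indicator (fun _ => (1 : ℝ)) x)) := by
      intro x
      by_cases hx : x ∈ U
      · rw [indicator_of_mem hx]
        have hgx : 0 < g x := lt_of_le_of_ne (hg0 (mem_range_self x)).1 (by
          have : x ∈ Function.support g := by rw [hgs]; exact hx
          exact (Ne.symm this))
        refine tendsto_const_nhds.congr' ?_
        filter_upwards [eventually_ge_atTop ⌈(g x)⁻¹⌉₊] with n hn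
        have : (g x)⁻¹ ≤ n := (Nat.le_ceil _).trans (by exact_mod_cast hn)
        refine (Real.smoothTransition.one_of_one_le ?_).symm
        rwa [inv_le_iff_one_le_mul₀ hgx] at this
      · rw [indicator_of_notMem hx]
        refine tendsto_const_nhds.congr fun n => ?_
        change 0 = Real.smoothTransition (n * g x)
        rw [hzero x hx, mul_zero, Real.smoothTransition.zero]
    have key : ∀ ν : Measure E, ν U < ∞ →
        Tendsto (fun n => ∫ x, φ n x ∂ν) atTop (𝓝 (ν.real U)) := by
      intro ν hν
      rw [← integral_indicator_one hU.measurableSet]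
      refine tendsto_integral_of_dominated_convergence (U.indicator fun _ => (1 : ℝ))
        (fun n => (hφ n).continuous.aestronglyMeasurable)
        ((integrable_indicator_iff hU.measurableSet).2 (integrableOn_const hν.ne)) (fun n => ?_)
        (Eventually.of_forall hlim)
      refine Eventually.of_forall fun x => ?_
      by_cases hx : x ∈ U
      · rw [indicator_of_mem hx, Real.norm_of_nonneg (Real.smoothTransition.nonneg _)]
        exact Real.smoothTransition.le_one _
      · rw [indicator_of_notMem hx]
        change ‖Real.smoothTransition (n * g x)‖ ≤ 0
        rw [hzero x hx, mul_zero, Real.smoothTransition.zero, norm_zero]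
    have heq : ν₁.real U = ν₂.real U := by
      refine tendsto_nhds_unique (key ν₁ f1) ((key ν₂ f2).congr fun n => ?_)
      exact (h _ (hφ n) (hφc n) ((hφs n).trans hK)).symm
    exact (measureReal_eq_measureReal_iff f1.ne f2.ne).1 heq
  -- The measures may have infinite mass on the whole ball, so they are compared on an exhaustion by
  -- smaller balls, where the open sets form a generating π-system for finite measures.
  have hU : ball (0 : E) R = ⋃ n : ℕ, ball (0 : E) (R - 1 / (n + 1)) := by
    refine subset_antisymm (fun x hx => ?_)
      (iUnion_subset fun n => ball_subset_ball (sub_le_self _ (by positivity)))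
    rw [mem_ball_zero_iff] at hx
    obtain ⟨n, hn⟩ := exists_nat_one_div_lt (show 0 < R - ‖x‖ by linarith)
    exact mem_iUnion.2 ⟨n, by rw [mem_ball_zero_iff]; linarith⟩
  rw [hU, Measure.restrict_iUnion_congr]
  intro n
  have hlt : R - 1 / ((n : ℝ) + 1) < R := sub_lt_self _ (by positivity)
  have : IsFiniteMeasure (ν₁.restrict (ball 0 (R - 1 / ((n : ℝ) + 1)))) := ⟨by
    rw [Measure.restrict_apply_univ]
    exact (measure_mono ball_subset_closedBall).trans_lt
      (h₁ _ (isCompact_closedBall _ _) (closedBall_subset_ball hlt))⟩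
  refine ext_of_generate_finite _ (BorelSpace.measurable_eq (α := E)) isPiSystem_isOpen
    (fun V hV => ?_) ?_
  · have hV' : IsOpen V := hV
    rw [Measure.restrict_apply hV'.measurableSet, Measure.restrict_apply hV'.measurableSet]
    exact hopen _ _ (hV'.inter isOpen_ball) hlt inter_subset_right
  · rw [Measure.restrict_apply_univ, Measure.restrict_apply_univ]
    exact hopen _ _ isOpen_ball hlt subset_rfl

end DeltaSubharmonic

/-! ### The Poisson–Jensen formula for superharmonic functions. -/

namespace DeltaSubharmonic

theorem radialKernel_lt_top (d : ℕ) {a b : ℝ} (ha : 0 < a) : radialKernel d a b < ∞ := by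
  rcases le_or_gt a b with h | h
  · rw [radialKernel_eq_ofReal d ha h]; exact ENNReal.ofReal_lt_top
  · rw [radialKernel_eq_zero d h.le]; exact ENNReal.zero_lt_top

theorem radialKernel_eq_ofReal' (d : ℕ) {a b : ℝ} (ha : 0 < a) (hb : 0 < b) :
    radialKernel d a b = ENNReal.ofReal (kappa d a - kappa d b) := by
  rcases le_or_gt a b with h | h
  · exact radialKernel_eq_ofReal d ha h
  · rw [radialKernel_eq_zero d h.le,
      ENNReal.ofReal_of_nonpos (sub_nonpos.2 (kappa_anti d hb h.le))]

/-- Near zero the integrand dominates `1 / t` because `d - 1 ≥ 1`. -/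
theorem radialKernel_zero {d : ℕ} (hd : 2 ≤ d) {b : ℝ} (hb : 0 < b) : radialKernel d 0 b = ∞ := by
  set c := min b 1 with hc
  have hc0 : 0 < c := by positivity
  by_contra hne
  have h1 : ∫⁻ t in Ioo 0 c, ENNReal.ofReal t⁻¹ ≤ radialKernel d 0 b := by
    rw [radialKernel]
    refine le_trans (setLIntegral_mono' measurableSet_Ioo fun t ht => ?_)
      (lintegral_mono_set (Ioo_subset_Ioo le_rfl (min_le_left _ _)))
    rw [← ENNReal.ofReal_inv_of_pos (pow_pos ht.1 _)]
    apply ENNReal.ofReal_le_ofReal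
    have h2 : t ≤ 1 := ht.2.le.trans (min_le_right _ _)
    have h3 : t ^ (d - 1) ≤ t ^ 1 := pow_le_pow_of_le_one ht.1.le h2 (by omega)
    rw [pow_one] at h3
    exact inv_anti₀ (pow_pos ht.1 _) h3
  have h2 : IntegrableOn (fun t : ℝ => t⁻¹) (Ioo 0 c) := by
    refine ⟨by fun_prop, ?_⟩
    rw [hasFiniteIntegral_iff_norm]
    refine lt_of_le_of_lt ?_ (h1.trans_lt (lt_top_iff_ne_top.2 hne))
    refine setLIntegral_mono' measurableSet_Ioo fun t ht => ?_
    rw [Real.norm_of_nonneg (inv_nonneg.2 ht.1.le)]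
  have h3 : IntervalIntegrable (fun t : ℝ => t⁻¹) volume 0 c := by
    rw [intervalIntegrable_iff, uIoc_of_le hc0.le]
    exact h2.congr_set_ae Ioo_ae_eq_Ioc.symm
  rw [intervalIntegrable_inv_iff] at h3
  rcases h3 with h3 | h3
  · exact hc0.ne h3
  · exact h3 left_mem_uIcc

/-- Fatou's lemma gives the lower bound and domination by the limit itself the upper one, so the
limit integral may be infinite. -/
theorem tendsto_lintegral_of_le {α : Type*} [MeasurableSpace α] {μ : Measure α}
    {F : ℕ → α → ℝ≥0∞} {G : α → ℝ≥0∞} (hF : ∀ n, Measurable (F n))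
    (hle : ∀ᶠ n in atTop, ∀ x, F n x ≤ G x) (h : ∀ x, Tendsto (fun n => F n x) atTop (𝓝 (G x))) :
    Tendsto (fun n => ∫⁻ x, F n x ∂μ) atTop (𝓝 (∫⁻ x, G x ∂μ)) := by
  refine tendsto_of_le_liminf_of_limsup_le ?_ ?_
  · refine le_trans (lintegral_mono fun x => ?_) (lintegral_liminf_le hF)
    exact (h x).liminf_eq.ge
  · refine limsup_le_of_le (by isBoundedDefault) ?_
    filter_upwards [hle] with n hn using lintegral_mono hn

variable {E : Type*} [NormedAddCommGroup E] [InnerProductSpace ℝ E] [FiniteDimensional ℝ E]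
  [MeasurableSpace E] [BorelSpace E] [Nontrivial E]

theorem lowerSemicontinuous_radialKernel (d : ℕ) {f g : E → ℝ} (hf : Continuous f)
    (hg : Continuous g) : LowerSemicontinuous fun y => radialKernel d (f y) (g y) := by
  intro y c hc
  by_contra hne
  obtain ⟨u, hu, hu2⟩ := exists_seq_forall_of_frequently (not_eventually.1 hne)
  have := radialKernel_le_liminf d ((hf.tendsto y).comp hu) ((hg.tendsto y).comp hu)
  refine absurd (hc.trans_le this) (not_lt.2 ?_)
  refine (liminf_le_liminf (v := fun _ : ℕ => c) ?_).trans (liminf_const c).le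
  exact Eventually.of_forall fun n => not_lt.1 (hu2 n)

theorem lowerSemicontinuous_green (d : ℕ) (R : ℝ) (x : E) :
    LowerSemicontinuous fun y => green d R x y :=
  lowerSemicontinuous_radialKernel d (by fun_prop)
    ((continuous_mirrorSq R).comp (Continuous.prodMk_right x)).sqrt

theorem green_self {d : ℕ} (hd : 2 ≤ d) {R : ℝ} {x : E} (hx : ‖x‖ < R) : green d R x x = ∞ := by
  have hR := (norm_nonneg x).trans_lt hx
  rw [green, sub_self, norm_zero]
  refine radialKernel_zero hd (Real.sqrt_pos.2 (lt_of_lt_of_le ?_ (sq_le_mirrorSq hR.ne' x x)))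
  have : ‖x‖ * ‖x‖ / R < R := by
    rw [div_lt_iff₀ hR]
    exact mul_self_lt_mul_self (norm_nonneg _) hx
  have h : 0 < R - ‖x‖ * ‖x‖ / R := by linarith
  positivity

theorem sub_le_sqrt_mirrorSq {R : ℝ} (hR : 0 < R) (x y : E) :
    R - ‖x‖ * ‖y‖ / R ≤ √(mirrorSq R x y) :=
  (le_abs_self _).trans (Real.abs_le_sqrt (sq_le_mirrorSq hR.ne' x y))

/-- The closed formula through `kappa` remains valid across the sphere, because `ENNReal.ofReal`
truncates the negative difference; strictly outside the closed ball the function vanishes locally.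
-/
theorem continuousAt_green (d : ℕ) {R : ℝ} {x y : E} (hx : ‖x‖ < R) (hxy : y ≠ x) :
    ContinuousAt (fun y => green d R x y) y := by
  have hR := (norm_nonneg x).trans_lt hx
  have hm : Continuous fun y => √(mirrorSq R x y) :=
    ((continuous_mirrorSq R).comp (Continuous.prodMk_right x)).sqrt
  rcases le_or_gt ‖y‖ R with hy | hy
  · have hm0 : 0 < √(mirrorSq R x y) := by
      refine lt_of_lt_of_le ?_ (sub_le_sqrt_mirrorSq hR x y)
      have : ‖x‖ * ‖y‖ / R ≤ ‖x‖ := by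
        rw [div_le_iff₀ hR]; gcongr
      linarith
    have h0 : 0 < ‖x - y‖ := norm_sub_pos_iff.2 (Ne.symm hxy)
    have hn : Continuous fun y => ‖x - y‖ := by fun_prop
    have hc : ContinuousAt (fun y => ENNReal.ofReal
        (kappa d ‖x - y‖ - kappa d √(mirrorSq R x y))) y := by
      refine ENNReal.continuous_ofReal.continuousAt.comp (ContinuousAt.sub ?_ ?_)
      · exact (hasDerivAt_kappa d h0).continuousAt.comp (f := fun y => ‖x - y‖) hn.continuousAt
      · exact (hasDerivAt_kappa d hm0).continuousAt.comp (f := fun y => √(mirrorSq R x y))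
          hm.continuousAt
    refine hc.congr ?_
    filter_upwards [hn.continuousAt.eventually_const_lt h0,
      hm.continuousAt.eventually_const_lt hm0] with z h1 h2
    rw [green, radialKernel_eq_ofReal' d h1 h2]
  · refine (continuousAt_const (y := (0 : ℝ≥0∞))).congr ?_
    filter_upwards [continuous_norm.continuousAt.eventually_const_lt hy] with z hz
    rw [green_eq_zero hR hx.le hz.le]

theorem green_le_radialKernel (d : ℕ) {R T : ℝ} {x : E} (hx : ‖x‖ < R) (hT : 2 * R ≤ T) (y : E) :
    green d R x y ≤ radialKernel d ‖x - y‖ T := by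
  have hR := (norm_nonneg x).trans_lt hx
  rcases le_or_gt R ‖y‖ with hy | hy
  · rw [green_eq_zero hR hx.le hy]; exact zero_le
  · exact radialKernel_mono d le_rfl (by linarith [sqrt_mirrorSq_le hR le_rfl hy.le (x := x)])

theorem lintegral_green_lt_top {R : ℝ} {x : E} (hx : ‖x‖ < R) :
    ∫⁻ y, green (finrank ℝ E) R x y < ∞ :=
  (lintegral_mono (green_le_radialKernel _ hx le_rfl)).trans_lt
    (lintegral_radialKernel_norm_sub_lt_top x _)

theorem measurable_green_right (d : ℕ) (R : ℝ) (x : E) : Measurable fun y => green d R x y :=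
  (lowerSemicontinuous_green d R x).measurable

theorem lconv_green_eq_zero (d : ℕ) {R δ : ℝ} (hδ : 0 < δ) {x y : E} (hx : ‖x‖ < R)
    (hy : R + δ ≤ ‖y‖) : lconv (fun y => green d R x y) δ y = 0 := by
  have hR := (norm_nonneg x).trans_lt hx
  refine le_antisymm (le_trans (lconv_mono_on (s' := fun _ => 0) hδ fun z hz => ?_)
    (lconv_const hδ 0 y).le) zero_le
  rw [green_eq_zero hR hx.le]
  rw [mem_ball, dist_eq_norm] at hz
  have := norm_le_norm_add_norm_sub z y
  linarith [norm_sub_rev z y]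

/-- The regularized Green function exceeds the Green function by at most a constant. -/
theorem lconv_green_le {R : ℝ} {x : E} (hx : ‖x‖ < R) {δ : ℝ} (hδ : 0 < δ) (hδ1 : δ ≤ 1)
    (hδ2 : δ < (R - ‖x‖) / 2) (y : E) :
    lconv (fun y => green (finrank ℝ E) R x y) δ y ≤ green (finrank ℝ E) R x y +
      radialKernel (finrank ℝ E) ((R - ‖x‖) / 2) (2 * R + 2) := by
  have hR := (norm_nonneg x).trans_lt hx
  rcases le_or_gt (R + δ) ‖y‖ with hy | hy
  · rw [lconv_green_eq_zero _ hδ hx hy]; exact zero_le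
  · have hxy : ‖x - y‖ ≤ ‖x‖ + ‖y‖ := norm_sub_le x y
    calc lconv (fun y => green (finrank ℝ E) R x y) δ y
        ≤ lconv (fun y => radialKernel (finrank ℝ E) ‖x - y‖ (2 * R + 2)) δ y :=
          lconv_mono_on hδ fun z _ => green_le_radialKernel _ hx (by linarith) z
      -- Here `‖x‖ < R`, `‖y‖ < R + δ`, the sphere radii are below `δ`, and `δ ≤ 1`; the endpoint `2
      -- R + 2` is thus beyond all distances involved, as superharmonicity of the truncated kernel
      -- requires.
      _ ≤ radialKernel (finrank ℝ E) ‖x - y‖ (2 * R + 2) := by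
          refine lconv_le_self (measurable_radialKernel _ (by fun_prop) measurable_const) hδ
            fun t ht htδ => lintegral_sphere_radialKernel_le x y ht (by linarith)
      _ ≤ green (finrank ℝ E) R x y + radialKernel (finrank ℝ E) √(mirrorSq R x y) (2 * R + 2) :=
          radialKernel_le_add _ _ _ _
      _ ≤ _ := by
          gcongr
          refine radialKernel_mono _ (le_trans ?_ (sub_le_sqrt_mirrorSq hR x y)) le_rfl
          have : ‖x‖ * ‖y‖ / R ≤ ‖x‖ + δ := by
            rw [div_le_iff₀ hR]
            nlinarith [norm_nonneg x, norm_nonneg y]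
          linarith

/-- If the potential is infinite at `x`, Fatou's lemma suffices. If it is finite, `x` is not an atom
of `ν`, since the Green function is infinite there; convergence then holds almost everywhere and is
dominated by the Green function plus a constant. -/
theorem tendsto_lintegral_lconv_green (hd : 2 ≤ finrank ℝ E) {R : ℝ} {x : E} (hx : ‖x‖ < R)
    (ν : Measure E) [IsFiniteMeasure ν] {δ : ℕ → ℝ} (hδ : ∀ n, 0 < δ n)
    (hδ0 : Tendsto δ atTop (𝓝 0)) :
    Tendsto (fun n => ∫⁻ y, lconv (fun y => green (finrank ℝ E) R x y) (δ n) y ∂ν) atTop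
      (𝓝 (∫⁻ y, green (finrank ℝ E) R x y ∂ν)) := by
  have hm := measurable_green_right (finrank ℝ E) R x
  have hmn : ∀ n, Measurable (lconv (fun y => green (finrank ℝ E) R x y) (δ n)) := fun n =>
    measurable_lconv hm _
  have hp : ∀ y, y ≠ x → Tendsto (fun n => lconv (fun y => green (finrank ℝ E) R x y) (δ n) y) atTop
      (𝓝 (green (finrank ℝ E) R x y)) := fun y hy =>
    tendsto_lconv (continuousAt_green _ hx hy) hδ hδ0
  by_cases hfin : ∫⁻ y, green (finrank ℝ E) R x y ∂ν = ∞
  · have hx' : Tendsto (fun n => lconv (fun y => green (finrank ℝ E) R x y) (δ n) x) atTop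
        (𝓝 (green (finrank ℝ E) R x x)) := by
      refine tendsto_lconv_of_le (lowerSemicontinuous_green _ R x x) hδ hδ0 ?_
      simp [green_self hd hx]
    refine tendsto_of_le_liminf_of_limsup_le ?_ (hfin ▸ le_top)
    refine le_trans (lintegral_mono fun y => ?_) (lintegral_liminf_le hmn)
    by_cases hy : y = x
    · subst hy; exact hx'.liminf_eq.ge
    · exact (hp y hy).liminf_eq.ge
  · obtain ⟨N, hN⟩ := eventually_atTop.1 ((hδ0.eventually_lt_const zero_lt_one).and
      (hδ0.eventually_lt_const (show 0 < (R - ‖x‖) / 2 by linarith)))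
    rw [← tendsto_add_atTop_iff_nat N]
    refine tendsto_lintegral_of_dominated_convergence (fun y => green (finrank ℝ E) R x y +
      radialKernel (finrank ℝ E) ((R - ‖x‖) / 2) (2 * R + 2)) (fun n => hmn _) (fun n => ?_) ?_ ?_
    · have := hN (n + N) (by omega)
      exact Eventually.of_forall fun y => lconv_green_le hx (hδ _) this.1.le this.2 y
    · rw [lintegral_add_right _ measurable_const, lintegral_const]
      exact ENNReal.add_ne_top.2 ⟨hfin, ENNReal.mul_ne_top
        (radialKernel_lt_top _ (by linarith)).ne (measure_ne_top _ _)⟩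
    · filter_upwards [ae_lt_top hm hfin] with y hy
      have hyx : y ≠ x := by
        rintro rfl
        rw [green_self hd hx] at hy
        exact lt_irrefl _ hy
      exact (hp y hyx).comp (tendsto_add_atTop_nat N)

/-- The Poisson kernel of a ball, without the normalization of the surface measure. -/
noncomputable def poissonKernel (R : ℝ) (x : E) (ω : sphere (0 : E) 1) : ℝ :=
  R ^ (finrank ℝ E - 1) * ((R ^ 2 - ‖x‖ ^ 2) / R * (‖x - R • (ω : E)‖ ^ finrank ℝ E)⁻¹)

theorem poissonKernel_nonneg {R : ℝ} {x : E} (hx : ‖x‖ < R) (ω : sphere (0 : E) 1) :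
    0 ≤ poissonKernel R x ω := by
  have hR := (norm_nonneg x).trans_lt hx
  have : 0 ≤ R ^ 2 - ‖x‖ ^ 2 := by nlinarith [norm_nonneg x]
  unfold poissonKernel
  positivity

theorem norm_sub_smul_pos {R : ℝ} {x : E} (hx : ‖x‖ < R) (ω : sphere (0 : E) 1) :
    R - ‖x‖ ≤ ‖x - R • (ω : E)‖ := by
  have hR := (norm_nonneg x).trans_lt hx
  have h1 : ‖R • (ω : E)‖ = R := by
    rw [norm_smul, norm_eq_of_mem_sphere ω, mul_one, Real.norm_of_nonneg hR.le]
  have := norm_sub_norm_le (R • (ω : E)) x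
  rwa [norm_sub_rev, h1] at this

theorem continuous_poissonKernel {R : ℝ} {x : E} (hx : ‖x‖ < R) :
    Continuous (poissonKernel R x) := by
  unfold poissonKernel
  refine continuous_const.mul (continuous_const.mul (Continuous.inv₀ (by fun_prop) fun ω => ?_))
  have := norm_sub_smul_pos hx ω
  exact pow_ne_zero _ (by linarith)

theorem support_conv_mollifier_subset {g : E → ℝ} {R δ : ℝ} (hδ : 0 < δ)
    (hg : ∀ y, R ≤ ‖y‖ → g y = 0) : Function.support (conv g (mollifier δ)) ⊆ closedBall 0 (R + δ) := by
  intro y hy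
  by_contra h
  refine hy ?_
  have h' : R + δ < ‖y‖ := by simpa using h
  refine (integral_congr_ae (Eventually.of_forall fun z => ?_)).trans (integral_zero _ _)
  rcases le_or_gt R ‖z‖ with hz | hz
  · rw [hg z hz, zero_mul]
  · rw [mollifier_eq_zero hδ, mul_zero]
    have := norm_sub_norm_le y z
    linarith

/-- The Poisson–Jensen formula. -/
theorem IsSuperharmonic.poissonJensen (hd : 2 ≤ finrank ℝ E) {s : E → ℝ≥0∞} {ρ ρ' R : ℝ}
    (hs : IsSuperharmonic s ρ) (hR' : R < ρ') (hρ' : ρ' < ρ) {ν : Measure E} [IsFiniteMeasure ν]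
    (hν : ∀ φ : E → ℝ, ContDiff ℝ 2 φ → HasCompactSupport φ → tsupport φ ⊆ ball 0 ρ' →
      ∫ x, φ x ∂ν = -∫ x, (s x).toReal * Laplacian.laplacian φ x) {x : E} (hx : ‖x‖ < R) :
    surf E univ * s x = ∫⁻ ω : sphere (0 : E) 1,
      ENNReal.ofReal (poissonKernel R x ω) * s (R • (ω : E)) ∂(surf E) +
        ∫⁻ y, green (finrank ℝ E) R x y ∂ν := by
  have hR := (norm_nonneg x).trans_lt hx
  have hgm := measurable_green_right (finrank ℝ E) R x
  have hgfin := (lintegral_green_lt_top hx (E := E)).ne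
  have hgi : Integrable fun y => (green (finrank ℝ E) R x y).toReal :=
    integrable_toReal_of_lintegral_ne_top hgm.aemeasurable hgfin
  have hsph : ∀ ω : sphere (0 : E) 1, ‖R • (ω : E)‖ = R := fun ω => by
    rw [norm_smul, norm_eq_of_mem_sphere ω, mul_one, Real.norm_of_nonneg hR.le]
  -- The `C²` formula for the smoothing, with the mollification transferred to the Green function.
  -- The mollified Green function is an admissible test function because it is supported in the ball
  -- of radius `R + δ < ρ'`.
  have key : ∀ δ, 0 < δ → δ < ρ' - R → surf E univ * lconv s δ x =
      ∫⁻ ω : sphere (0 : E) 1,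
        ENNReal.ofReal (poissonKernel R x ω) * lconv s δ (R • (ω : E)) ∂(surf E) +
        ∫⁻ y, lconv (fun y => green (finrank ℝ E) R x y) δ y ∂ν := by
    intro δ hδ hδ2
    have ha : ContDiff ℝ 2 (smoothing s δ) := hs.contDiff_smoothing hδ (n := 2)
    have h1 := poissonJensen_of_contDiff ha hx
    have hφ : ContDiff ℝ 2 (conv (fun y => (green (finrank ℝ E) R x y).toReal) (mollifier δ)) :=
      contDiff_conv (n := 2) hgi (contDiff_mollifier δ) (hasCompactSupport_mollifier hδ)
    have hsup : tsupport (conv (fun y => (green (finrank ℝ E) R x y).toReal) (mollifier δ)) ⊆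
        closedBall 0 (R + δ) :=
      closure_minimal (support_conv_mollifier_subset hδ fun y hy => by
        rw [green_eq_zero hR hx.le hy, ENNReal.toReal_zero]) isClosed_closedBall
    have hcs : HasCompactSupport (conv (fun y => (green (finrank ℝ E) R x y).toReal)
        (mollifier δ)) :=
      (isCompact_closedBall (0 : E) (R + δ)).of_isClosed_subset (isClosed_tsupport _) hsup
    have h2 : ∫ y in ball (0 : E) R, (green (finrank ℝ E) R x y).toReal *
        Laplacian.laplacian (smoothing s δ) y =
        -∫ y, conv (fun y => (green (finrank ℝ E) R x y).toReal) (mollifier δ) y ∂ν := by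
      rw [setIntegral_eq_integral_of_forall_compl_eq_zero, hs.integral_mul_laplacian_smoothing hδ hgi,
        hν _ hφ hcs (hsup.trans (closedBall_subset_ball (by linarith))), neg_neg]
      intro y hy
      rw [green_eq_zero hR hx.le (by simpa using hy), ENNReal.toReal_zero, zero_mul]
    have h3 : R ^ (finrank ℝ E - 1) * ((R ^ 2 - ‖x‖ ^ 2) / R * ∫ ω : sphere (0 : E) 1,
        smoothing s δ (R • (ω : E)) * (‖x - R • (ω : E)‖ ^ finrank ℝ E)⁻¹ ∂(surf E)) =
        ∫ ω : sphere (0 : E) 1, poissonKernel R x ω * smoothing s δ (R • (ω : E)) ∂(surf E) := by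
      rw [← integral_const_mul, ← integral_const_mul]
      congr 1; ext ω
      rw [poissonKernel]; ring
    rw [h2, h3, sub_neg_eq_add] at h1
    have hPc : Continuous fun ω : sphere (0 : E) 1 =>
        poissonKernel R x ω * smoothing s δ (R • (ω : E)) :=
      (continuous_poissonKernel hx).mul (ha.continuous.comp (by fun_prop))
    have hPi : Integrable (fun ω : sphere (0 : E) 1 =>
        poissonKernel R x ω * smoothing s δ (R • (ω : E))) (surf E) :=
      (hPc.continuousOn.integrableOn_compact isCompact_univ).integrable_of_forall_notMem_eq_zero
        (by simp)
    have hP0 : ∀ ω : sphere (0 : E) 1, 0 ≤ poissonKernel R x ω * smoothing s δ (R • (ω : E)) :=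
      fun ω => mul_nonneg (poissonKernel_nonneg hx ω) (smoothing_nonneg s δ _)
    have hg0 : ∀ y, 0 ≤ conv (fun y => (green (finrank ℝ E) R x y).toReal) (mollifier δ) y :=
      smoothing_nonneg _ δ
    have h4 := congrArg ENNReal.ofReal h1
    rw [ENNReal.ofReal_mul measureReal_nonneg, ofReal_measureReal, hs.ofReal_smoothing hδ,
      ENNReal.ofReal_add (integral_nonneg hP0) (integral_nonneg hg0),
      ofReal_integral_eq_lintegral_ofReal hPi (Eventually.of_forall hP0),
      ofReal_integral_eq_lintegral_ofReal (hφ.continuous.integrable_of_hasCompactSupport hcs)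
        (Eventually.of_forall hg0)] at h4
    simpa only [ofReal_conv_mollifier hgm hgfin δ hδ, ENNReal.ofReal_mul (poissonKernel_nonneg hx _),
      hs.ofReal_smoothing hδ] using h4
  set δ : ℕ → ℝ := fun n => (ρ' - R) / (n + 2) with hδdef
  have hδ : ∀ n, 0 < δ n := fun n => div_pos (by linarith) (by positivity)
  have hδlt : ∀ n, δ n < ρ' - R := fun n => by
    rw [hδdef]
    exact div_lt_self (by linarith) (by linarith [Nat.cast_nonneg (α := ℝ) n])
  have hδ0 : Tendsto δ atTop (𝓝 0) :=
    (tendsto_const_nhds (x := ρ' - R)).div_atTop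
      (tendsto_natCast_atTop_atTop.atTop_add tendsto_const_nhds)
  have L1 : Tendsto (fun n => surf E univ * lconv s (δ n) x) atTop (𝓝 (surf E univ * s x)) :=
    ENNReal.Tendsto.const_mul (hs.tendsto_lconv (by linarith) hδ hδ0)
      (Or.inr (measure_ne_top _ _))
  have L2 : Tendsto (fun n => ∫⁻ ω : sphere (0 : E) 1,
      ENNReal.ofReal (poissonKernel R x ω) * lconv s (δ n) (R • (ω : E)) ∂(surf E)) atTop
      (𝓝 (∫⁻ ω : sphere (0 : E) 1,
        ENNReal.ofReal (poissonKernel R x ω) * s (R • (ω : E)) ∂(surf E))) := by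
    refine tendsto_lintegral_of_le (fun n => ?_) (Eventually.of_forall fun n ω => ?_) fun ω => ?_
    · have h1 := (continuous_poissonKernel hx (E := E)).measurable
      have h2 := measurable_lconv hs.measurable (δ n)
      fun_prop
    · gcongr
      exact hs.lconv_le (hδ n) (by rw [hsph]; linarith [hδlt n])
    · exact ENNReal.Tendsto.const_mul (hs.tendsto_lconv (by rw [hsph]; linarith) hδ hδ0)
        (Or.inr ENNReal.ofReal_ne_top)
  have L3 := tendsto_lintegral_lconv_green hd hx ν hδ hδ0
  exact tendsto_nhds_unique L1 ((L2.add L3).congr fun n => (key _ (hδ n) (hδlt n)).symm)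

end DeltaSubharmonic

/-! ### From subharmonic functions to nonnegative superharmonic ones. -/

namespace DeltaSubharmonic

variable {E : Type*} [NormedAddCommGroup E] [InnerProductSpace ℝ E] [FiniteDimensional ℝ E]
  [MeasurableSpace E] [BorelSpace E] [Nontrivial E]

theorem surf_univ_ne_zero : surf E univ ≠ 0 := by
  rw [Ne, Measure.measure_univ_eq_zero, Measure.toSphere_eq_zero_iff_finrank]
  exact finrank_pos.ne'

theorem lintegral_ball_le {s : E → ℝ≥0∞} (hs : Measurable s) {y : E} {δ : ℝ}
    (h : ∀ t, 0 < t → t < δ →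
      ∫⁻ ω : sphere (0 : E) 1, s (y + t • (ω : E)) ∂(surf E) ≤ surf E univ * s y) :
    ∫⁻ x in ball y δ, s x ≤ s y * volume (ball y δ) := by
  have hi : ∀ g : E → ℝ≥0∞, Measurable g → ∫⁻ x in ball y δ, g x =
      ∫⁻ t in Ioi (0 : ℝ), ENNReal.ofReal (t ^ (finrank ℝ E - 1)) *
        ∫⁻ ω : sphere (0 : E) 1, (ball y δ).indicator g (y + t • (ω : E)) ∂(surf E) := by
    intro g hg
    rw [← lintegral_indicator measurableSet_ball, ← lintegral_add_left_eq_self _ y]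
    exact lintegral_polar (f := fun z => (ball y δ).indicator g (y + z))
      ((hg.indicator measurableSet_ball).comp (by fun_prop))
  rw [← setLIntegral_const, hi s hs, hi (fun _ => s y) measurable_const]
  refine setLIntegral_mono' measurableSet_Ioi fun t ht => mul_le_mul' le_rfl ?_
  have ht' : (0 : ℝ) < t := ht
  have hmem : ∀ ω : sphere (0 : E) 1, y + t • (ω : E) ∈ ball y δ ↔ t < δ := fun ω => by
    rw [mem_ball, dist_eq_norm, add_sub_cancel_left, norm_smul, norm_eq_of_mem_sphere ω, mul_one,
      Real.norm_of_nonneg ht'.le]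
  by_cases htδ : t < δ
  · simp only [indicator_of_mem ((hmem _).2 htδ)]
    rw [lintegral_const, mul_comm]
    exact h t ht htδ
  · simp only [indicator_of_notMem (fun hh => htδ ((hmem _).1 hh))]
    exact le_rfl

/-- A superharmonic function which is finite at one point of a ball is locally summable. -/
theorem lintegral_closedBall_lt_top_of_mean_le {s : E → ℝ≥0∞} (hs : Measurable s) {ρ : ℝ}
    (hmean : ∀ (x : E) (t : ℝ), 0 < t → ‖x‖ + t < ρ →
      ∫⁻ ω : sphere (0 : E) 1, s (x + t • (ω : E)) ∂(surf E) ≤ surf E univ * s x)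
    {x₀ : E} (hx₀ : ‖x₀‖ < ρ) (hfin : s x₀ ≠ ∞) {t : ℝ} (ht : t < ρ) :
    ∫⁻ x in closedBall 0 t, s x < ∞ := by
  set A : Set E := {x | ∃ ε > 0, ∫⁻ y in ball x ε, s y < ∞} with hA
  have hbd : ∀ y δ, ‖y‖ + δ ≤ ρ → s y ≠ ∞ → ∫⁻ x in ball y δ, s x < ∞ := fun y δ h hy =>
    (lintegral_ball_le hs fun t ht htδ => hmean y t ht (by linarith)).trans_lt
      (ENNReal.mul_lt_top (lt_top_iff_ne_top.2 hy) measure_ball_lt_top)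
  have hball : ∀ y δ, ‖y‖ + δ ≤ ρ → s y ≠ ∞ → ball y δ ⊆ A := fun y δ h hy x hx => by
    obtain ⟨ε, hε, hsub⟩ := Metric.isOpen_iff.1 isOpen_ball x hx
    exact ⟨ε, hε, (lintegral_mono_set hsub).trans_lt (hbd y δ h hy)⟩
  have hAo : IsOpen A := by
    rw [Metric.isOpen_iff]
    rintro x ⟨ε, hε, hx⟩
    refine ⟨ε / 2, by positivity, fun y hy => ⟨ε / 2, by positivity, lt_of_le_of_lt
      (lintegral_mono_set (ball_subset_ball' ?_)) hx⟩⟩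
    rw [mem_ball] at hy
    linarith
  -- Connectedness of the ball: `A`, the set of points near which `s` is summable, is open and meets
  -- the ball, and it is relatively closed because near a limit point there are points of finiteness
  -- whose large balls reach that limit point.
  have hsub : ball (0 : E) ρ ⊆ A := by
    refine (convex_ball (0 : E) ρ).isPreconnected.subset_of_closure_inter_subset hAo
      ⟨x₀, by simpa using hx₀, hball x₀ (ρ - ‖x₀‖) (by linarith) hfin
        (mem_ball_self (by linarith))⟩ ?_
    rintro x ⟨hxc, hxρ⟩
    rw [mem_ball_zero_iff] at hxρ
    -- A point `z` with `dist x z < 2 δ` then satisfies `‖z‖ + 2 δ ≤ ρ`, so the ball of radius `2 δ`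
    -- about `z` is admissible and contains `x`.
    set δ := (ρ - ‖x‖) / 4 with hδ
    have hδ0 : 0 < δ := by rw [hδ]; linarith
    obtain ⟨y, ⟨ε, hε, hy⟩, hxy⟩ := Metric.mem_closure_iff.1 hxc δ hδ0
    have hae : ∀ᵐ z ∂(volume.restrict (ball y (min ε δ))), s z < ∞ :=
      ae_lt_top hs ((lintegral_mono_set (ball_subset_ball (min_le_left _ _))).trans_lt hy).ne
    have hne : (ae (volume.restrict (ball y (min ε δ)))).NeBot := by
      rw [ae_neBot, Ne, Measure.restrict_eq_zero]
      exact (measure_ball_pos _ _ (lt_min hε hδ0)).ne'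
    obtain ⟨z, hz, hzb⟩ := (hae.and (ae_restrict_mem measurableSet_ball)).exists
    have h1 : dist z y < δ := (mem_ball.1 hzb).trans_le (min_le_right _ _)
    have h2 : dist x z < 2 * δ := by
      have := dist_triangle x y z
      rw [dist_comm y z] at this
      linarith
    refine hball z (2 * δ) ?_ hz.ne (mem_ball.2 h2)
    have := norm_le_norm_add_norm_sub x z
    rw [dist_eq_norm] at h2
    linarith
  have hK := (isCompact_closedBall (0 : E) t).measure_lt_top_of_nhdsWithin
    (μ := volume.withDensity s) fun x hx => by
      obtain ⟨ε, hε, h⟩ := hsub (closedBall_subset_ball ht hx)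
      refine ⟨ball x ε, mem_nhdsWithin_of_mem_nhds (ball_mem_nhds x hε), ?_⟩
      rwa [withDensity_apply _ measurableSet_ball]
  rwa [withDensity_apply _ measurableSet_closedBall] at hK

/-- The identity `(C - a) + a⁺ = C + a⁻`, arranged without subtraction on the outside so that it
also holds at `a = ⊥`; it needs `C ≥ 0`. -/
theorem toENNReal_sub_add {C : ℝ} {a : EReal} (ha : a ≤ C) :
    ((C : EReal) - a).toENNReal + a.toENNReal = ENNReal.ofReal C + (-a).toENNReal ∨ C < 0 := by
  rcases lt_or_ge C 0 with hC | hC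
  · exact Or.inr hC
  left
  induction a with
  | bot => simp
  | top => exact absurd ha (by simp)
  | coe a =>
    have ha' : a ≤ C := by exact_mod_cast ha
    rw [← EReal.coe_sub, ← EReal.coe_neg, EReal.toENNReal_of_ne_top (EReal.coe_ne_top _),
      EReal.toENNReal_of_ne_top (EReal.coe_ne_top _), EReal.toENNReal_of_ne_top (EReal.coe_ne_top _),
      EReal.toReal_coe, EReal.toReal_coe, EReal.toReal_coe]
    rcases le_total 0 a with h | h
    · rw [← ENNReal.ofReal_add (by linarith) h, ENNReal.ofReal_of_nonpos (show -a ≤ 0 by linarith),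
        add_zero, sub_add_cancel]
    · rw [← ENNReal.ofReal_add hC (by linarith), ENNReal.ofReal_of_nonpos h, add_zero, sub_eq_add_neg]

/-- The difference of a constant and a function, cut off outside a ball. -/
noncomputable def constSub (C : ℝ) (w : E → EReal) (ρ : ℝ) : E → ℝ≥0∞ :=
  (ball (0 : E) ρ).indicator fun x => ((C : EReal) - w x).toENNReal

theorem continuous_const_sub_toENNReal (C : ℝ) :
    Continuous fun a : EReal => ((C : EReal) - a).toENNReal := by
  simp only [sub_eq_add_neg]
  refine EReal.continuous_toENNReal.comp (continuous_iff_continuousAt.2 fun a => ?_)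
  exact (EReal.continuousAt_add (p := ((C : EReal), -a)) (Or.inl (EReal.coe_ne_top C))
    (Or.inl (EReal.coe_ne_bot C))).comp (f := fun a : EReal => ((C : EReal), -a))
    (continuous_const.prodMk continuous_neg).continuousAt

theorem antitone_const_sub_toENNReal (C : ℝ) :
    Antitone fun a : EReal => ((C : EReal) - a).toENNReal := fun _ _ h =>
  EReal.toENNReal_le_toENNReal (EReal.sub_le_sub le_rfl h)

theorem lowerSemicontinuous_constSub (C : ℝ) {w : E → EReal} {ρ ρ' : ℝ} (h : ρ ≤ ρ')
    (hw : UpperSemicontinuousOn w (ball 0 ρ')) : LowerSemicontinuous (constSub C w ρ) := by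
  have h1 := (continuous_const_sub_toENNReal C).comp_upperSemicontinuousOn_antitone hw
    (antitone_const_sub_toENNReal C)
  intro x c hc
  by_cases hx : x ∈ ball (0 : E) ρ
  · rw [constSub, indicator_of_mem hx] at hc
    have h2 := h1 x (ball_subset_ball h hx) c hc
    rw [nhdsWithin_eq_nhds.2 (isOpen_ball.mem_nhds (ball_subset_ball h hx))] at h2
    filter_upwards [h2, isOpen_ball.mem_nhds hx] with y hy hyb
    rwa [constSub, indicator_of_mem hyb]
  · rw [constSub, indicator_of_notMem hx] at hc
    exact absurd hc not_lt_zero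

theorem norm_add_smul_le (x : E) {t : ℝ} (ht : 0 < t) (ω : sphere (0 : E) 1) :
    ‖x + t • (ω : E)‖ ≤ ‖x‖ + t := by
  refine (norm_add_le _ _).trans ?_
  rw [norm_smul, norm_eq_of_mem_sphere ω, mul_one, Real.norm_of_nonneg ht.le]

/-- Integrating `(C - w) + w⁺ = C + w⁻` over the sphere turns the submean inequality for `w` into
the supermean inequality for `C - w`. If `w⁻` has infinite integral, then `w x = ⊥` and the right
side is infinite. -/
theorem lintegral_sphere_constSub_le {C : ℝ} (hC : 0 ≤ C) {w : E → EReal} {ρ ρ' : ℝ} (h : ρ ≤ ρ')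
    (hw : SubharmonicOn w (ball 0 ρ')) (hb : ∀ x ∈ ball (0 : E) ρ, w x ≤ C) (x : E) {t : ℝ}
    (ht : 0 < t) (hxt : ‖x‖ + t < ρ) :
    ∫⁻ ω : sphere (0 : E) 1, constSub C w ρ (x + t • (ω : E)) ∂(surf E) ≤
      surf E univ * constSub C w ρ x := by
  have hmem : ∀ ω : sphere (0 : E) 1, x + t • (ω : E) ∈ ball (0 : E) ρ := fun ω =>
    mem_ball_zero_iff.2 ((norm_add_smul_le x ht ω).trans_lt hxt)
  have hxm : x ∈ ball (0 : E) ρ := mem_ball_zero_iff.2 (by linarith)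
  have hmeas := (lowerSemicontinuous_constSub C h hw.upperSemicontinuousOn).measurable
  have hsub := hw.le_sphereMean x t ht (fun y hy => by
    rw [mem_closedBall, dist_eq_norm] at hy
    rw [mem_ball_zero_iff]
    linarith [norm_le_norm_add_norm_sub' y x])
  set S := surf E univ with hS
  have hS0 : S ≠ 0 := surf_univ_ne_zero
  have hSt : S ≠ ∞ := measure_ne_top _ _
  set I := ∫⁻ ω : sphere (0 : E) 1, constSub C w ρ (x + t • (ω : E)) ∂(surf E)
  set P := ∫⁻ ω : sphere (0 : E) 1, (w (x + t • (ω : E))).toENNReal ∂(surf E) with hP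
  set N := ∫⁻ ω : sphere (0 : E) 1, (-w (x + t • (ω : E))).toENNReal ∂(surf E) with hN
  have hsum : I + P = ENNReal.ofReal C * S + N := by
    have hm : Measurable fun ω : sphere (0 : E) 1 => constSub C w ρ (x + t • (ω : E)) :=
      hmeas.comp (by fun_prop)
    rw [← lintegral_add_left hm, hS, ← lintegral_const,
      ← lintegral_add_left measurable_const]
    refine lintegral_congr fun ω => ?_
    rw [constSub, indicator_of_mem (hmem ω)]
    exact (toENNReal_sub_add (hb _ (hmem ω))).resolve_right (not_lt.2 hC)
  have hPfin : P ≠ ∞ := by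
    refine ne_top_of_le_ne_top (ENNReal.mul_ne_top ENNReal.ofReal_ne_top hSt)
      (b := ENNReal.ofReal C * S) ?_
    rw [hS, ← lintegral_const]
    refine lintegral_mono fun ω => ?_
    refine (EReal.toENNReal_le_toENNReal (hb _ (hmem ω))).trans ?_
    rw [EReal.toENNReal_of_ne_top (EReal.coe_ne_top _), EReal.toReal_coe]
  have hmean : w x ≤ ((P / S : ℝ≥0∞) : EReal) - ((N / S : ℝ≥0∞) : EReal) := by
    simpa only [sphereMean, sphereMeanPos, laverage_eq] using hsub
  rw [constSub, indicator_of_mem hxm]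
  by_cases hNt : N = ∞
  · have : w x = ⊥ := by
      rw [hNt, ENNReal.top_div_of_ne_top hSt] at hmean
      simpa using hmean
    rw [this, EReal.coe_sub_bot, EReal.toENNReal_top, ENNReal.mul_top hS0]
    exact le_top
  · have hIt : I ≠ ∞ := by
      refine ne_top_of_le_ne_top (b := ENNReal.ofReal C * S + N) ?_ (hsum ▸ le_self_add)
      exact ENNReal.add_ne_top.2 ⟨ENNReal.mul_ne_top ENNReal.ofReal_ne_top hSt, hNt⟩
    have hSr : 0 < S.toReal := ENNReal.toReal_pos hS0 hSt
    have hr : I.toReal + P.toReal = C * S.toReal + N.toReal := by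
      have := congrArg ENNReal.toReal hsum
      rwa [ENNReal.toReal_add hIt hPfin, ENNReal.toReal_add
        (ENNReal.mul_ne_top ENNReal.ofReal_ne_top hSt) hNt, ENNReal.toReal_mul,
        ENNReal.toReal_ofReal hC] at this
    have hm2 : w x ≤ ((P.toReal / S.toReal - N.toReal / S.toReal : ℝ) : EReal) := by
      rw [EReal.coe_sub, ← ENNReal.toReal_div, ← ENNReal.toReal_div,
        EReal.coe_ennreal_toReal, EReal.coe_ennreal_toReal]
      · exact hmean
      · exact ENNReal.div_ne_top hNt hS0
      · exact ENNReal.div_ne_top hPfin hS0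
    have h3 : ENNReal.ofReal (C - (P.toReal / S.toReal - N.toReal / S.toReal)) ≤
        ((C : EReal) - w x).toENNReal := by
      refine le_trans (le_of_eq ?_) (antitone_const_sub_toENNReal C hm2)
      dsimp only
      rw [← EReal.coe_sub, EReal.toENNReal_of_ne_top (EReal.coe_ne_top _), EReal.toReal_coe]
    calc I = ENNReal.ofReal I.toReal := (ENNReal.ofReal_toReal hIt).symm
      _ = S * ENNReal.ofReal (C - (P.toReal / S.toReal - N.toReal / S.toReal)) := by
        rw [← ENNReal.ofReal_toReal (a := S) hSt, ENNReal.toReal_ofReal hSr.le,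
          ← ENNReal.ofReal_mul hSr.le]
        congr 1
        field_simp
        linarith
      _ ≤ _ := by gcongr

/-- Summability on the ball of radius `ρ` is obtained from the larger radius `ρ₁`: the propagation
of local summability only reaches closed balls strictly inside. -/
theorem isSuperharmonic_constSub {C : ℝ} (hC : 0 ≤ C) {w : E → EReal} {ρ ρ₁ ρ' : ℝ} (h : ρ < ρ₁)
    (h₁ : ρ₁ ≤ ρ') (hw : SubharmonicOn w (ball 0 ρ')) (hb : ∀ x ∈ ball (0 : E) ρ₁, w x ≤ C)
    {x₀ : E} (hx₀ : ‖x₀‖ < ρ₁) (hw₀ : w x₀ ≠ ⊥) : IsSuperharmonic (constSub C w ρ) ρ := by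
  refine ⟨lowerSemicontinuous_constSub C (h.le.trans h₁) hw.upperSemicontinuousOn,
    fun x t ht hxt => lintegral_sphere_constSub_le hC (h.le.trans h₁) hw
      (fun y hy => hb y (ball_subset_ball h.le hy)) x ht hxt, ne_of_lt ?_⟩
  have hfin : constSub C w ρ₁ x₀ ≠ ∞ := by
    rw [constSub, indicator_of_mem (mem_ball_zero_iff.2 hx₀), Ne, EReal.toENNReal_eq_top_iff]
    intro htop
    rcases eq_or_ne (w x₀) ⊤ with h' | h'
    · rw [h', EReal.sub_top] at htop; exact absurd htop (by simp)
    · lift w x₀ to ℝ using ⟨h', hw₀⟩ with a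
      exact EReal.coe_ne_top (C - a) (by rw [EReal.coe_sub]; exact htop)
  have := lintegral_closedBall_lt_top_of_mean_le
    (lowerSemicontinuous_constSub C h₁ hw.upperSemicontinuousOn).measurable
    (fun x t ht hxt => lintegral_sphere_constSub_le hC h₁ hw hb x ht hxt) hx₀ hfin h
  refine lt_of_le_of_lt ?_ this
  rw [← lintegral_indicator measurableSet_closedBall]
  refine lintegral_mono fun x => ?_
  by_cases hx : x ∈ ball (0 : E) ρ
  · rw [constSub, indicator_of_mem hx, indicator_of_mem (ball_subset_closedBall hx), constSub,
      indicator_of_mem (ball_subset_ball h.le hx)]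
  · rw [constSub, indicator_of_notMem hx]; exact zero_le

theorem SubharmonicOn.exists_bound {w : E → EReal} {ρ ρ' : ℝ} (h : ρ < ρ') (hρ : 0 ≤ ρ)
    (hw : SubharmonicOn w (ball 0 ρ')) : ∃ C : ℝ, 0 ≤ C ∧ ∀ x ∈ closedBall (0 : E) ρ, w x ≤ C := by
  obtain ⟨y, hy, hmax⟩ := UpperSemicontinuousOn.exists_isMaxOn (s := closedBall (0 : E) ρ)
    ⟨0, by simpa using hρ⟩ (isCompact_closedBall _ _)
    (hw.upperSemicontinuousOn.mono (closedBall_subset_ball h))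
  have hy' := hw.lt_top y (closedBall_subset_ball h hy)
  refine ⟨max 0 (w y).toReal, le_max_left _ _, fun x hx => (hmax hx).trans ?_⟩
  refine (EReal.le_coe_toReal hy'.ne).trans ?_
  exact_mod_cast le_max_right _ _

/-- Both sides are `d` times the volume of the unit ball, by `Γ(d / 2 + 1) = (d / 2) Γ(d / 2)`. -/
theorem sphereArea_eq : sphereArea (finrank ℝ E) = (surf E).real univ := by
  have hd : 0 < finrank ℝ E := finrank_pos
  rw [Measure.toSphere_real_apply_univ, measureReal_def, InnerProductSpace.volume_ball, sphereArea]
  have hG : Real.Gamma ((finrank ℝ E : ℝ) / 2 + 1) =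
      (finrank ℝ E : ℝ) / 2 * Real.Gamma ((finrank ℝ E : ℝ) / 2) :=
    Real.Gamma_add_one (by positivity)
  have hp : √Real.pi ^ finrank ℝ E = Real.pi ^ ((finrank ℝ E : ℝ) / 2) := by
    rw [Real.sqrt_eq_rpow, ← Real.rpow_natCast, ← Real.rpow_mul Real.pi_pos.le]
    congr 1; ring
  have hG0 : 0 < Real.Gamma ((finrank ℝ E : ℝ) / 2) := Real.Gamma_pos_of_pos (by positivity)
  rw [hG, hp, ENNReal.ofReal_one, one_pow, one_mul, ENNReal.toReal_ofReal (by positivity)]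
  field_simp

end DeltaSubharmonic

/-! ### Identification of the Riesz measure and the Poisson–Jensen formula for subharmonic
functions. -/

namespace DeltaSubharmonic

variable {E : Type*} [NormedAddCommGroup E] [InnerProductSpace ℝ E] [FiniteDimensional ℝ E]
  [MeasurableSpace E] [BorelSpace E] [Nontrivial E]

theorem sphereArea_mul_dHat_pos : 0 < sphereArea (finrank ℝ E) * dHat (finrank ℝ E) := by
  refine mul_pos ?_ ?_
  · rw [sphereArea_eq]
    exact ENNReal.toReal_pos surf_univ_ne_zero (measure_ne_top _ _)
  · exact_mod_cast lt_of_lt_of_le one_pos (le_max_left 1 (finrank ℝ E - 2))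

/-- Makes the additive constant `C` disappear from the distributional Laplacian. -/
theorem integral_laplacian_eq_zero {φ : E → ℝ} (hφ : ContDiff ℝ 2 φ) (hc : HasCompactSupport φ) :
    ∫ x, Laplacian.laplacian φ x = 0 := by
  have h := integral_mul_laplacian_comm (a := fun _ : E => (1 : ℝ)) contDiff_const hφ hc
  simpa using h.symm

theorem toReal_constSub {C : ℝ} {a : EReal} (ha : a ≤ C) (h : ((C : EReal) - a).toENNReal < ∞) :
    ((C : EReal) - a).toENNReal.toReal = C - a.toReal := by
  induction a with
  | bot => simp at h
  | top => exact absurd ha (by simp)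
  | coe a =>
    have ha' : a ≤ C := by exact_mod_cast ha
    rw [← EReal.coe_sub, EReal.toENNReal_of_ne_top (EReal.coe_ne_top _), EReal.toReal_coe,
      EReal.toReal_coe, ENNReal.toReal_ofReal (by linarith)]

/-- The Riesz measure of a subharmonic function on a ball. -/
theorem rieszMeasure_eq {C : ℝ} {u w : E → EReal} {R ρ ρ' : ℝ} (hR' : R < ρ') (hρ' : ρ' < ρ)
    (hs : IsSuperharmonic (constSub C w ρ) ρ) (hb : ∀ x ∈ ball (0 : E) ρ, w x ≤ C)
    (huw : EqOn u w (closedBall 0 R)) {ν : Measure E} [IsFiniteMeasure ν]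
    (hν : ∀ φ : E → ℝ, ContDiff ℝ 2 φ → HasCompactSupport φ → tsupport φ ⊆ ball 0 ρ' →
      ∫ x, φ x ∂ν = -∫ x, (constSub C w ρ x).toReal * Laplacian.laplacian φ x) :
    rieszMeasure u (ball 0 R) = (ENNReal.ofReal (sphereArea (finrank ℝ E) * dHat (finrank ℝ E))⁻¹ •
      ν).restrict (ball 0 R) := by
  set c := (sphereArea (finrank ℝ E) * dHat (finrank ℝ E))⁻¹ with hc
  have hc0 : 0 < c := inv_pos.2 sphereArea_mul_dHat_pos
  set τ := (ENNReal.ofReal c • ν).restrict (ball (0 : E) R) with hτ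
  have hτfin : IsFiniteMeasure τ :=
    ⟨by
      rw [hτ, Measure.restrict_apply_univ, Measure.smul_apply, smul_eq_mul]
      exact ENNReal.mul_lt_top ENNReal.ofReal_lt_top (measure_lt_top _ _)⟩
  have hRiesz : IsRieszMeasure u (ball 0 R) τ := by
    refine ⟨?_, fun K _ _ => measure_lt_top _ _, fun φ hφ hcs hsup => ?_⟩
    · rw [hτ, Measure.restrict_apply isOpen_ball.measurableSet.compl, compl_inter_self,
        measure_empty]
    · have hφ2 : ContDiff ℝ 2 φ := hφ.of_le two_le_smooth
      have hz : ∀ x, x ∉ ball (0 : E) R → φ x = 0 := fun x hx =>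
        image_eq_zero_of_notMem_tsupport fun h => hx (hsup h)
      have hzΔ : ∀ x, x ∉ ball (0 : E) R → Laplacian.laplacian φ x = 0 := fun x hx =>
        image_eq_zero_of_notMem_tsupport fun h => hx (hsup (tsupport_laplacian_subset hφ2 h))
      have hcsΔ : HasCompactSupport (Laplacian.laplacian φ) :=
        hcs.mono' ((subset_tsupport _).trans (tsupport_laplacian_subset hφ2))
      have hΔ := continuous_laplacian hφ2
      obtain ⟨B, hB⟩ := hΔ.bounded_above_of_compact_support hcsΔ
      have i1 : Integrable fun x => C * Laplacian.laplacian φ x :=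
        (hΔ.integrable_of_hasCompactSupport hcsΔ).const_mul C
      have i2 : Integrable fun x => (constSub C w ρ x).toReal * Laplacian.laplacian φ x :=
        hs.integrable.mul_bdd (c := B) hΔ.aestronglyMeasurable (Eventually.of_forall hB)
      rw [hτ, setIntegral_eq_integral_of_forall_compl_eq_zero hz, integral_smul_measure,
        ENNReal.toReal_ofReal hc0.le, smul_eq_mul,
        hν φ hφ2 hcs (hsup.trans (ball_subset_ball hR'.le))]
      congr 1
      have hae : ∀ᵐ x ∂(volume.restrict (ball (0 : E) R)), (u x).toReal * Laplacian.laplacian φ x =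
          C * Laplacian.laplacian φ x - (constSub C w ρ x).toReal * Laplacian.laplacian φ x := by
        filter_upwards [ae_restrict_mem measurableSet_ball,
          ae_restrict_of_ae (ae_lt_top hs.measurable hs.lintegral_ne_top)] with x hx hlt
        have hxρ : x ∈ ball (0 : E) ρ := ball_subset_ball (hR'.trans hρ').le hx
        rw [constSub, indicator_of_mem hxρ] at hlt ⊢
        rw [toReal_constSub (hb x hxρ) hlt, huw (ball_subset_closedBall hx)]
        ring
      rw [integral_congr_ae hae, setIntegral_eq_integral_of_forall_compl_eq_zero fun x hx => by
        rw [hzΔ x hx]; ring, integral_sub i1 i2, integral_const_mul,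
        integral_laplacian_eq_zero hφ2 hcs]
      ring
  have hex : ∃ ν, IsRieszMeasure u (ball 0 R) ν := ⟨τ, hRiesz⟩
  have h1 := hex.choose_spec
  rw [rieszMeasure, dif_pos hex]
  -- Uniqueness identifies the chosen Riesz measure with the constructed one.
  have h2 := restrict_ball_eq_of_integral_eq h1.lt_top_of_isCompact hRiesz.lt_top_of_isCompact
    fun φ hφ hcs hsup => (h1.integral_eq φ hφ hcs hsup).trans (hRiesz.integral_eq φ hφ hcs hsup).symm
  have h3 : ∀ m : Measure E, m (ball 0 R)ᶜ = 0 → m.restrict (ball 0 R) = m := fun m hm =>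
    Measure.restrict_eq_self_of_ae_mem (mem_ae_iff.2 hm)
  rwa [h3 _ h1.compl_eq_zero, h3 _ hRiesz.compl_eq_zero] at h2

/-- What is needed of a subharmonic function: up to sign and a constant it is a nonnegative
measurable function represented by the Poisson–Jensen formula. -/
theorem exists_poissonJensen (hd : 2 ≤ finrank ℝ E) {C : ℝ} (hC : 0 ≤ C) {u w : E → EReal}
    {R ρ₁ R' : ℝ} (hR : 0 < R) (hρ₁ : R < ρ₁) (hρ₁' : ρ₁ ≤ R') (hw : SubharmonicOn w (ball 0 R'))
    (huw : EqOn u w (closedBall 0 R)) (hb : ∀ x ∈ ball (0 : E) ρ₁, w x ≤ C)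
    (hne : ∃ x ∈ closedBall (0 : E) R, u x ≠ ⊥) :
    ∃ s : E → ℝ≥0∞, Measurable s ∧
      (∀ x ∈ closedBall (0 : E) R, u x ≤ C ∧ s x = ((C : EReal) - u x).toENNReal) ∧
      (∃ x, ‖x‖ < R ∧ s x ≠ ∞) ∧ IsFiniteMeasure (rieszMeasure u (ball 0 R)) ∧
      rieszMeasure u (ball 0 R) (ball 0 R)ᶜ = 0 ∧
      ∀ x, ‖x‖ < R → surf E univ * s x = ∫⁻ ω : sphere (0 : E) 1,
        ENNReal.ofReal (poissonKernel R x ω) * s (R • (ω : E)) ∂(surf E) +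
          surf E univ * dHat (finrank ℝ E) *
            ∫⁻ y, green (finrank ℝ E) R x y ∂(rieszMeasure u (ball 0 R)) := by
  obtain ⟨x₀, hx₀, hux₀⟩ := hne
  obtain ⟨ρ, hRρ, hρ⟩ := exists_between hρ₁
  obtain ⟨ρ', hRρ', hρ'⟩ := exists_between hRρ
  have hx₀' : ‖x₀‖ ≤ R := by simpa using hx₀
  have hs : IsSuperharmonic (constSub C w ρ) ρ :=
    isSuperharmonic_constSub hC hρ hρ₁' hw hb (hx₀'.trans_lt hρ₁) (huw hx₀ ▸ hux₀)
  have hbρ : ∀ x ∈ ball (0 : E) ρ, w x ≤ C := fun x hx => hb x (ball_subset_ball hρ.le hx)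
  obtain ⟨ν, hνfin, hν⟩ := hs.exists_measure (hR.trans hRρ') hρ'
  have hτ := rieszMeasure_eq hRρ' hρ' hs hbρ huw hν
  set c := sphereArea (finrank ℝ E) * dHat (finrank ℝ E) with hc
  have hc0 : 0 < c := sphereArea_mul_dHat_pos
  refine ⟨constSub C w ρ, hs.measurable, fun x hx => ?_, ?_, ?_, ?_, fun x hx => ?_⟩
  · have hxρ : x ∈ ball (0 : E) ρ := closedBall_subset_ball hRρ hx
    rw [huw hx, constSub, indicator_of_mem hxρ]
    exact ⟨hbρ x hxρ, rfl⟩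
  · have hne : (ae (volume.restrict (ball (0 : E) R))).NeBot := by
      rw [ae_neBot, Ne, Measure.restrict_eq_zero]
      exact (measure_ball_pos _ _ hR).ne'
    obtain ⟨x, hx, hxR⟩ := ((ae_restrict_of_ae (s := ball (0 : E) R)
      (ae_lt_top hs.measurable hs.lintegral_ne_top)).and (ae_restrict_mem measurableSet_ball)).exists
    exact ⟨x, by simpa using hxR, hx.ne⟩
  · rw [hτ]
    exact ⟨by
      rw [Measure.restrict_apply_univ, Measure.smul_apply, smul_eq_mul]
      exact ENNReal.mul_lt_top ENNReal.ofReal_lt_top (measure_lt_top _ _)⟩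
  · rw [hτ, Measure.restrict_apply isOpen_ball.measurableSet.compl, compl_inter_self, measure_empty]
  · rw [hs.poissonJensen hd hRρ' hρ' hν hx, hτ]
    congr 1
    rw [Measure.restrict_smul, lintegral_smul_measure, smul_eq_mul, ← mul_assoc]
    -- The prefactor of the potential cancels the normalization of the Riesz measure; restricting
    -- the measure to the ball costs nothing, as the Green function vanishes outside.
    have h1 : surf E univ * (dHat (finrank ℝ E) : ℝ≥0∞) = ENNReal.ofReal c := by
      rw [hc, sphereArea_eq, ENNReal.ofReal_mul measureReal_nonneg, ofReal_measureReal,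
        ENNReal.ofReal_natCast]
    rw [h1, ← ENNReal.ofReal_mul hc0.le, mul_inv_cancel₀ hc0.ne', ENNReal.ofReal_one, one_mul]
    symm
    refine setLIntegral_eq_of_support_subset ?_
    intro y hy
    by_contra h
    exact hy (green_eq_zero hR hx.le (by simpa using h))

end DeltaSubharmonic

/-! ### The estimate for δ-subharmonic functions. -/

namespace DeltaSubharmonic

variable {E : Type*} [NormedAddCommGroup E] [InnerProductSpace ℝ E] [FiniteDimensional ℝ E]
  [MeasurableSpace E] [BorelSpace E] [Nontrivial E]

/-- From `‖x - R ω‖ ≥ R - ‖x‖` the kernel is at most `((R + ‖x‖) / (R - ‖x‖)) ^ (d - 1)`, which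
increases with `‖x‖`; the factor `2` and the maximum in `constA` are not needed for this term. -/
theorem poissonKernel_le (hd : 2 ≤ finrank ℝ E) {r R : ℝ} (hr : 0 < r) (hrR : r < R) {x : E}
    (hx : ‖x‖ ≤ r) (ω : sphere (0 : E) 1) :
    poissonKernel R x ω ≤ constA (finrank ℝ E) r R := by
  obtain ⟨n, hn⟩ := Nat.exists_eq_add_of_le hd
  have hR : 0 < R := hr.trans hrR
  have hxR : ‖x‖ < R := hx.trans_lt hrR
  set q := ‖x‖ with hq
  have hq0 : 0 ≤ q := norm_nonneg x
  have hD := norm_sub_smul_pos hxR ω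
  have h1 : poissonKernel R x ω ≤ ((R + q) / (R - q)) ^ (n + 1) := by
    rw [poissonKernel, hn, show 2 + n - 1 = n + 1 by omega]
    have hRq : 0 < R - q := by linarith
    calc R ^ (n + 1) * ((R ^ 2 - q ^ 2) / R * (‖x - R • (ω : E)‖ ^ (2 + n))⁻¹)
        ≤ R ^ (n + 1) * ((R ^ 2 - q ^ 2) / R * ((R - q) ^ (2 + n))⁻¹) := by
          have : 0 ≤ R ^ 2 - q ^ 2 := by nlinarith
          gcongr
      _ = R ^ n * (R + q) / (R - q) ^ (n + 1) := by
          rw [show R ^ 2 - q ^ 2 = (R - q) * (R + q) by ring, show 2 + n = (n + 1) + 1 by ring,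
            pow_succ (R - q) (n + 1), pow_succ R n]
          field_simp
      _ ≤ (R + q) ^ n * (R + q) / (R - q) ^ (n + 1) := by
          gcongr; linarith
      _ = _ := by rw [← pow_succ, div_pow]
  have h2 : ((R + q) / (R - q)) ^ (n + 1) ≤ ((R + r) / (R - r)) ^ (n + 1) := by
    have : 0 < R - r := by linarith
    gcongr
  rw [constA, hn, show 2 + n - 1 = n + 1 by omega]
  have h3 : 0 ≤ ((R + r) / (R - r)) ^ (n + 1) := by
    have : 0 < R - r := by linarith
    positivity
  have h4 := le_max_left 1 ((R - r) ^ (2 + n - 2))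
  nlinarith

theorem lintegral_poissonKernel_le (hd : 2 ≤ finrank ℝ E) {r R : ℝ} (hr : 0 < r) (hrR : r < R)
    {x : E} (hx : ‖x‖ ≤ r) (g : sphere (0 : E) 1 → ℝ≥0∞) :
    ∫⁻ ω, ENNReal.ofReal (poissonKernel R x ω) * g ω ∂(surf E) ≤
      ENNReal.ofReal (constA (finrank ℝ E) r R) * ∫⁻ ω, g ω ∂(surf E) := by
  rw [← lintegral_const_mul' _ _ ENNReal.ofReal_ne_top]
  refine lintegral_mono fun ω => ?_
  gcongr
  exact poissonKernel_le hd hr hrR hx ω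

/-- By Tonelli the integral in `x` comes first; its bound depends on `y` only through the kernel
over `(max ‖y‖ r, R)`. -/
theorem lintegral_lintegral_green_le (hd : 2 ≤ finrank ℝ E) {r R : ℝ} (hr : 0 < r) (hrR : r < R)
    (μ : Measure E) [SFinite μ] (hμ : μ (closedBall 0 r)ᶜ = 0) (ν : Measure E) [SFinite ν]
    (hν : ν (ball 0 R)ᶜ = 0) :
    ∫⁻ x, ∫⁻ y, green (finrank ℝ E) R x y ∂ν ∂μ ≤ ENNReal.ofReal (constA (finrank ℝ E) r R) *
      (∫⁻ y, radialKernel (finrank ℝ E) (max ‖y‖ r) R ∂ν) *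
        (μ univ + diniIntegral (finrank ℝ E) μ (R + r)) := by
  rw [lintegral_lintegral_swap (measurable_green _ R).aemeasurable]
  have hm : Measurable fun y : E => radialKernel (finrank ℝ E) (max ‖y‖ r) R :=
    measurable_radialKernel _ (by fun_prop) measurable_const
  rw [← lintegral_const_mul _ hm, ← lintegral_mul_const _ (hm.const_mul _)]
  refine lintegral_mono_ae ?_
  filter_upwards [mem_ae_iff.2 hν] with y hy
  exact lintegral_green_le hd hr hrR μ hμ (by simpa using hy)

/-- Used on the sphere. Where `U` is undefined the right side is infinite, so no exceptional set has
to be removed. -/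
theorem toENNReal_const_sub_le {C : ℝ} {u v U : EReal} (hu : u ≤ C) (hv : v ≤ C)
    (hU : (u ≠ ⊥ ∨ v ≠ ⊥) → U = u - v) :
    ((C : EReal) - v).toENNReal ≤ ((C : EReal) - u).toENNReal + U.toENNReal := by
  induction u with
  | bot => simp
  | top => exact absurd hu (by simp)
  | coe u =>
    rw [hU (Or.inl (EReal.coe_ne_bot u))]
    induction v with
    | bot => simp
    | top => exact absurd hv (by simp)
    | coe v =>
      simp only [← EReal.coe_sub, EReal.toENNReal_of_ne_top (EReal.coe_ne_top _), EReal.toReal_coe]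
      refine le_trans (ENNReal.ofReal_le_ofReal ?_) ENNReal.ofReal_add_le
      linarith

/-- The way back from `C - u` and `C - v` to `U⁺`: finiteness of both functions permits cancelling
`C - u`. -/
theorem toENNReal_sub_le {C : ℝ} {u v U : EReal} {h : ℝ≥0∞} (hu : u ≤ C) (hv : v ≤ C)
    (hu' : u ≠ ⊥) (hv' : v ≠ ⊥) (hU : (u ≠ ⊥ ∨ v ≠ ⊥) → U = u - v)
    (hle : ((C : EReal) - v).toENNReal ≤ ((C : EReal) - u).toENNReal + h) : U.toENNReal ≤ h := by
  rw [hU (Or.inl hu')]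
  induction u with
  | bot => exact absurd rfl hu'
  | top => exact absurd hu (by simp)
  | coe u =>
    induction v with
    | bot => exact absurd rfl hv'
    | top => exact absurd hv (by simp)
    | coe v =>
      have hu2 : u ≤ C := by exact_mod_cast hu
      simp only [← EReal.coe_sub, EReal.toENNReal_of_ne_top (EReal.coe_ne_top _),
        EReal.toReal_coe] at hle ⊢
      rcases eq_or_ne h ∞ with rfl | hh
      · exact le_top
      · lift h to NNReal using hh
        rw [← ENNReal.ofReal_coe_nnreal, ← ENNReal.ofReal_add (sub_nonneg.2 hu2) h.coe_nonneg,
          ENNReal.ofReal_le_ofReal_iff (add_nonneg (sub_nonneg.2 hu2) h.coe_nonneg)] at hle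
        rw [← ENNReal.ofReal_coe_nnreal]
        exact ENNReal.ofReal_le_ofReal (by linarith)

theorem ne_bot_of_const_sub_ne_top {C : ℝ} {u : EReal} (h : ((C : EReal) - u).toENNReal ≠ ∞) :
    u ≠ ⊥ := by
  rintro rfl
  simp at h

/-- Summability of a function represented by the Poisson–Jensen formula. -/
theorem lintegral_ne_top_of_poissonJensen (hd : 2 ≤ finrank ℝ E) {r R : ℝ} (hr : 0 < r)
    (hrR : r < R) {μ : Measure E} [IsFiniteMeasure μ] (hμ : μ (closedBall 0 r)ᶜ = 0)
    (hD : DiniCondition (finrank ℝ E) μ) {s : E → ℝ≥0∞}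
    (hfin : ∃ x, ‖x‖ < R ∧ s x ≠ ∞) {ν : Measure E} [IsFiniteMeasure ν] (hν : ν (ball 0 R)ᶜ = 0)
    (hPJ : ∀ x, ‖x‖ < R → surf E univ * s x = ∫⁻ ω : sphere (0 : E) 1,
        ENNReal.ofReal (poissonKernel R x ω) * s (R • (ω : E)) ∂(surf E) +
          surf E univ * dHat (finrank ℝ E) * ∫⁻ y, green (finrank ℝ E) R x y ∂ν) :
    ∫⁻ x, s x ∂μ ≠ ∞ := by
  have hR : 0 < R := hr.trans hrR
  set S := surf E univ with hS
  have hS0 : S ≠ 0 := surf_univ_ne_zero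
  have hSt : S ≠ ∞ := measure_ne_top _ _
  set I := ∫⁻ ω : sphere (0 : E) 1, s (R • (ω : E)) ∂(surf E) with hI
  -- At a point where `s` is finite, Poisson–Jensen bounds the Poisson integral, and the Poisson
  -- kernel of that point is bounded below because `‖x - R ω‖ ≤ 2 R`.
  have hIt : I ≠ ∞ := by
    obtain ⟨x, hx, hsx⟩ := hfin
    obtain ⟨c, hcdef⟩ : ∃ c : ℝ, c = R ^ (finrank ℝ E - 1) *
      ((R ^ 2 - ‖x‖ ^ 2) / R * ((2 * R) ^ finrank ℝ E)⁻¹) := ⟨_, rfl⟩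
    have hc : 0 < c := by
      have : 0 < R ^ 2 - ‖x‖ ^ 2 := by nlinarith [norm_nonneg x]
      rw [hcdef]
      positivity
    have h1 : ENNReal.ofReal c * I ≤ S * s x := by
      rw [hPJ x hx, hI, ← lintegral_const_mul' _ _ ENNReal.ofReal_ne_top]
      refine le_trans (lintegral_mono fun ω => ?_) le_self_add
      gcongr
      have h2 : 0 ≤ R ^ 2 - ‖x‖ ^ 2 := by nlinarith [norm_nonneg x]
      have h4 : 0 < ‖x - R • (ω : E)‖ := lt_of_lt_of_le (by linarith) (norm_sub_smul_pos hx ω)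
      have h5 : ‖x - R • (ω : E)‖ ≤ 2 * R := by
        refine (norm_sub_le _ _).trans ?_
        rw [norm_smul, norm_eq_of_mem_sphere ω, mul_one, Real.norm_of_nonneg hR.le]
        linarith
      rw [hcdef, poissonKernel]
      gcongr
    intro htop
    rw [htop, ENNReal.mul_top (by simpa using hc), top_le_iff] at h1
    exact ENNReal.mul_ne_top hSt hsx h1
  have hDt := (diniIntegral_lt_top (measure_lt_top μ univ) hD (R + r)).ne
  have hg : ∫⁻ x, ∫⁻ y, green (finrank ℝ E) R x y ∂ν ∂μ ≠ ∞ := by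
    refine ne_top_of_le_ne_top ?_ (lintegral_lintegral_green_le hd hr hrR μ hμ ν hν)
    refine ENNReal.mul_ne_top (ENNReal.mul_ne_top ENNReal.ofReal_ne_top ?_)
      (ENNReal.add_ne_top.2 ⟨measure_ne_top _ _, hDt⟩)
    refine ne_top_of_le_ne_top ?_
      (lintegral_mono fun y => radialKernel_mono _ (le_max_right ‖y‖ r) (le_refl R))
    rw [lintegral_const]
    exact ENNReal.mul_ne_top (radialKernel_lt_top _ hr).ne (measure_ne_top _ _)
  have hle : S * ∫⁻ x, s x ∂μ ≤ ∫⁻ x, (ENNReal.ofReal (constA (finrank ℝ E) r R) * I +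
      S * dHat (finrank ℝ E) * ∫⁻ y, green (finrank ℝ E) R x y ∂ν) ∂μ := by
    rw [← lintegral_const_mul' _ _ hSt]
    refine lintegral_mono_ae ?_
    filter_upwards [mem_ae_iff.2 hμ] with x hx
    have hx' : ‖x‖ ≤ r := by simpa using hx
    rw [hPJ x (hx'.trans_lt hrR)]
    gcongr
    exact lintegral_poissonKernel_le hd hr hrR hx' _
  rw [lintegral_add_left measurable_const, lintegral_const, lintegral_const_mul' _ _
    (ENNReal.mul_ne_top hSt (ENNReal.natCast_ne_top _))] at hle
  intro htop
  rw [htop, ENNReal.mul_top hS0, top_le_iff] at hle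
  exact ENNReal.add_ne_top.2 ⟨ENNReal.mul_ne_top (ENNReal.mul_ne_top ENNReal.ofReal_ne_top hIt)
    (measure_ne_top _ _), ENNReal.mul_ne_top (ENNReal.mul_ne_top hSt (ENNReal.natCast_ne_top _)) hg⟩
    hle

theorem deltaSubharmonic_lintegral_le (hd : 2 ≤ finrank ℝ E) {r R : ℝ} (hr : 0 < r) (hrR : r < R)
    {μ : Measure E} (hμt : μ univ < ∞) (hμ : μ (closedBall 0 r)ᶜ = 0)
    (hD : DiniCondition (finrank ℝ E) μ) {U u v : E → EReal} (hU : IsDeltaSubharmonic U u v R) :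
    (∀ᵐ x ∂μ, u x ≠ ⊥ ∧ v x ≠ ⊥) ∧ Integrable (fun x => (U x).toReal) μ ∧
      ∀ r₀ ∈ Icc 0 r, ∫⁻ x in closedBall 0 r, (U x).toENNReal ∂μ ≤
        ENNReal.ofReal (constA (finrank ℝ E) r R) * nevanlinnaT U u v r₀ R *
          (μ univ + diniIntegral (finrank ℝ E) μ (R + r)) := by
  have : IsFiniteMeasure μ := ⟨hμt⟩
  have hR : 0 < R := hr.trans hrR
  obtain ⟨Ru, hRu, wu, hwu, huw⟩ := hU.subharmonic_left
  obtain ⟨Rv, hRv, wv, hwv, hvw⟩ := hU.subharmonic_right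
  obtain ⟨ρ, hRρ, hρ⟩ := exists_between (lt_min hRu hRv)
  obtain ⟨Cu, hCu0, hCu⟩ := hwu.exists_bound (hρ.trans_le (min_le_left _ _)) (hR.le.trans hRρ.le)
  obtain ⟨Cv, hCv0, hCv⟩ := hwv.exists_bound (hρ.trans_le (min_le_right _ _)) (hR.le.trans hRρ.le)
  -- One constant for both functions, so that `(C - v) - (C - u) = U`.
  set C := max Cu Cv with hC
  have hC0 : 0 ≤ C := hCu0.trans (le_max_left _ _)
  have cu : (Cu : EReal) ≤ C := by exact_mod_cast le_max_left Cu Cv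
  have cv : (Cv : EReal) ≤ C := by exact_mod_cast le_max_right Cu Cv
  obtain ⟨su, hsum, hsu, hsuf, hτuf, hτu0, hPJu⟩ := exists_poissonJensen hd hC0 hR hRρ
    (hρ.le.trans (min_le_left _ _)) hwu huw
    (fun x hx => (hCu x (ball_subset_closedBall hx)).trans cu) hU.nontrivial_left
  obtain ⟨sv, hsvm, hsv, hsvf, hτvf, hτv0, hPJv⟩ := exists_poissonJensen hd hC0 hR hRρ
    (hρ.le.trans (min_le_right _ _)) hwv hvw
    (fun x hx => (hCv x (ball_subset_closedBall hx)).trans cv) hU.nontrivial_right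
  have hIu := lintegral_ne_top_of_poissonJensen hd hr hrR hμ hD hsuf hτu0 hPJu
  have hIv := lintegral_ne_top_of_poissonJensen hd hr hrR hμ hD hsvf hτv0 hPJv
  have hmem : ∀ᵐ x ∂μ, x ∈ closedBall (0 : E) r := mem_ae_iff.2 hμ
  have hsub : closedBall (0 : E) r ⊆ closedBall 0 R := closedBall_subset_closedBall hrR.le
  have hbot : ∀ᵐ x ∂μ, u x ≠ ⊥ ∧ v x ≠ ⊥ := by
    filter_upwards [hmem, ae_lt_top hsum hIu, ae_lt_top hsvm hIv] with x hx h1 h2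
    rw [(hsu x (hsub hx)).2] at h1
    rw [(hsv x (hsub hx)).2] at h2
    exact ⟨ne_bot_of_const_sub_ne_top h1.ne, ne_bot_of_const_sub_ne_top h2.ne⟩
  refine ⟨hbot, ?_, fun r₀ hr₀ => ?_⟩
  · refine ((integrable_toReal_of_lintegral_ne_top hsvm.aemeasurable hIv).sub
      (integrable_toReal_of_lintegral_ne_top hsum.aemeasurable hIu)).congr ?_
    filter_upwards [hmem, hbot, ae_lt_top hsum hIu, ae_lt_top hsvm hIv] with x hx hb h1 h2
    obtain ⟨hu1, hu2⟩ := hsu x (hsub hx)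
    obtain ⟨hv1, hv2⟩ := hsv x (hsub hx)
    have ut : u x ≠ ⊤ := (hu1.trans_lt (EReal.coe_lt_top C)).ne
    have vt : v x ≠ ⊤ := (hv1.trans_lt (EReal.coe_lt_top C)).ne
    rw [hu2] at h1
    rw [hv2] at h2
    rw [Pi.sub_apply, hu2, hv2, toReal_constSub hu1 h1, toReal_constSub hv1 h2,
      hU.eq_sub x (hsub hx) (Or.inl hb.1), EReal.toReal_sub ut hb.1 vt hb.2]
    ring
  set A := ENNReal.ofReal (constA (finrank ℝ E) r R) with hA
  set τ := rieszChargeNeg u v (ball (0 : E) R) with hτ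
  set S := surf E univ with hS
  have hS0 : S ≠ 0 := surf_univ_ne_zero
  have hSt : S ≠ ∞ := measure_ne_top _ _
  -- This inequality and `τ ≤ rieszMeasure v` are all that is used of the lower variation; no Hahn
  -- decomposition is needed.
  have hτle : rieszMeasure v (ball 0 R) ≤ τ + rieszMeasure u (ball 0 R) :=
    Measure.sub_le_iff_le_add.1 le_rfl
  have hττ : τ ≤ rieszMeasure v (ball 0 R) := Measure.sub_le
  have hτf : IsFiniteMeasure τ := isFiniteMeasure_of_le _ hττ
  have hτ0 : τ (ball 0 R)ᶜ = 0 := le_antisymm ((hττ _).trans hτv0.le) zero_le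
  set m := sphereMeanPos U 0 R with hm
  have hmS : ∫⁻ ω : sphere (0 : E) 1, (U (R • (ω : E))).toENNReal ∂(surf E) = S * m := by
    rw [hm, sphereMeanPos, laverage_eq]
    simp only [zero_add]
    rw [ENNReal.mul_div_cancel hS0 hSt]
  -- The two Poisson–Jensen formulas compared in additive form, valid also at points where `u` or
  -- `v` is `⊥`. Only the measurability of `su` enters, not that of `U`.
  have key : ∀ x ∈ closedBall (0 : E) r, sv x ≤ su x + (A * m +
      dHat (finrank ℝ E) * ∫⁻ y, green (finrank ℝ E) R x y ∂τ) := by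
    intro x hx
    have hx' : ‖x‖ ≤ r := by simpa using hx
    have hxR : ‖x‖ < R := hx'.trans_lt hrR
    have hPm : Measurable fun ω : sphere (0 : E) 1 => ENNReal.ofReal (poissonKernel R x ω) :=
      (continuous_poissonKernel hxR).measurable.ennreal_ofReal
    have h1 : ∫⁻ ω : sphere (0 : E) 1,
        ENNReal.ofReal (poissonKernel R x ω) * sv (R • (ω : E)) ∂(surf E) ≤
        ∫⁻ ω : sphere (0 : E) 1,
          ENNReal.ofReal (poissonKernel R x ω) * su (R • (ω : E)) ∂(surf E) + A * (S * m) := by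
      rw [← hmS]
      refine le_trans ?_ (add_le_add le_rfl (lintegral_poissonKernel_le hd hr hrR hx' _))
      have hPs : Measurable fun ω : sphere (0 : E) 1 =>
          ENNReal.ofReal (poissonKernel R x ω) * su (R • (ω : E)) :=
        hPm.mul (hsum.comp (by fun_prop))
      rw [← lintegral_add_left hPs]
      refine lintegral_mono fun ω => ?_
      dsimp only
      rw [← mul_add]
      gcongr
      have hmω : R • (ω : E) ∈ closedBall (0 : E) R := by
        rw [mem_closedBall_zero_iff, norm_smul, norm_eq_of_mem_sphere ω, mul_one,
          Real.norm_of_nonneg hR.le]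
      rw [(hsu _ hmω).2, (hsv _ hmω).2]
      exact toENNReal_const_sub_le (hsu _ hmω).1 (hsv _ hmω).1 (hU.eq_sub _ hmω)
    have h2 : ∫⁻ y, green (finrank ℝ E) R x y ∂(rieszMeasure v (ball 0 R)) ≤
        ∫⁻ y, green (finrank ℝ E) R x y ∂τ +
          ∫⁻ y, green (finrank ℝ E) R x y ∂(rieszMeasure u (ball 0 R)) := by
      rw [← lintegral_add_measure]
      exact lintegral_mono' hτle le_rfl
    have h3 : S * sv x ≤ S * (su x + (A * m +
        dHat (finrank ℝ E) * ∫⁻ y, green (finrank ℝ E) R x y ∂τ)) := by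
      calc S * sv x ≤ _ := (hPJv x hxR).le.trans (add_le_add h1 (mul_le_mul' le_rfl h2))
        _ = S * su x + S * (A * m +
            dHat (finrank ℝ E) * ∫⁻ y, green (finrank ℝ E) R x y ∂τ) := by
          rw [hPJu x hxR]; ring
        _ = _ := by ring
    exact (ENNReal.mul_le_mul_iff_right hS0 hSt).1 h3
  have hUle : ∀ᵐ x ∂μ, (U x).toENNReal ≤ A * m +
      dHat (finrank ℝ E) * ∫⁻ y, green (finrank ℝ E) R x y ∂τ := by
    filter_upwards [hmem, hbot] with x hx hb
    have hk := key x hx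
    rw [(hsu _ (hsub hx)).2, (hsv _ (hsub hx)).2] at hk
    exact toENNReal_sub_le (hsu _ (hsub hx)).1 (hsv _ (hsub hx)).1 hb.1 hb.2
      (hU.eq_sub _ (hsub hx)) hk
  set M := μ univ + diniIntegral (finrank ℝ E) μ (R + r) with hM
  calc ∫⁻ x in closedBall 0 r, (U x).toENNReal ∂μ ≤ ∫⁻ x, (U x).toENNReal ∂μ :=
        setLIntegral_le_lintegral _ _
    _ ≤ ∫⁻ x, (A * m + dHat (finrank ℝ E) * ∫⁻ y, green (finrank ℝ E) R x y ∂τ) ∂μ :=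
        lintegral_mono_ae hUle
    _ = A * m * μ univ + dHat (finrank ℝ E) * ∫⁻ x, ∫⁻ y, green (finrank ℝ E) R x y ∂τ ∂μ := by
        rw [lintegral_add_left measurable_const, lintegral_const,
          lintegral_const_mul' _ _ (ENNReal.natCast_ne_top _)]
    _ ≤ A * m * M + dHat (finrank ℝ E) * (A * (∫⁻ t in Ioo r₀ R,
        τ (closedBall 0 t) / ENNReal.ofReal (t ^ (finrank ℝ E - 1))) * M) := by
        refine add_le_add (mul_le_mul' le_rfl le_self_add) (mul_le_mul' le_rfl ?_)
        refine (lintegral_lintegral_green_le hd hr hrR μ hμ τ hτ0).trans ?_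
        gcongr
        refine (lintegral_radialKernel_max_le _ τ r R).trans ?_
        -- The bound is obtained with the counting function from `r`; a smaller `r₀` only enlarges
        -- the interval.
        exact lintegral_mono_set (Ioo_subset_Ioo hr₀.2 le_rfl)
    _ = A * nevanlinnaT U u v r₀ R * M := by
        rw [nevanlinnaT, integratedCounting]; ring

end DeltaSubharmonic

/-! ### Meromorphic functions: null sets, canonical factors and counting functions. -/

namespace DeltaSubharmonic

/-- The Dini condition excludes atoms. -/
theorem DiniCondition.measure_singleton {X : Type*} [PseudoMetricSpace X] [MeasurableSpace X]
    {d : ℕ} (hd : 2 ≤ d) {μ : Measure X} (hD : DiniCondition d μ) (a : X) : μ {a} = 0 := by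
  obtain ⟨ε, hε, h⟩ := hD
  by_contra hne
  refine h.not_ge ?_
  calc ∞ = μ {a} * radialKernel d 0 ε := by rw [radialKernel_zero hd hε, ENNReal.mul_top hne]
    _ ≤ ∫⁻ t in Ioo 0 ε, μ {a} * (ENNReal.ofReal (t ^ (d - 1)))⁻¹ := lintegral_const_mul_le _ _
    _ ≤ ∫⁻ t in Ioo 0 ε, modulus μ t / ENNReal.ofReal (t ^ (d - 1)) := by
        refine setLIntegral_mono' measurableSet_Ioo fun t ht => ?_
        rw [div_eq_mul_inv]
        gcongr
        refine le_trans (measure_mono ?_) (le_iSup (fun y => μ (closedBall y t)) a)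
        simpa using ht.1.le
    _ ≤ diniIntegral d μ ε := lintegral_mono_set Ioo_subset_Ioc_self

theorem eventually_analyticAt_and_ne_zero {f : ℂ → ℂ} (hf : Meromorphic f)
    (h : ∀ z, meromorphicOrderAt f z ≠ ⊤) (x : ℂ) :
    ∀ᶠ z in 𝓝[≠] x, AnalyticAt ℂ f z ∧ f z ≠ 0 :=
  (hf x).eventually_analyticAt.and ((meromorphicOrderAt_ne_top_iff_eventually_ne_zero (hf x)).1 (h x))

/-- A property that holds on a punctured neighbourhood of every point holds almost everywhere with
respect to a measure without atoms. -/
theorem ae_of_eventually_punctured {X : Type*} [TopologicalSpace X] [SecondCountableTopology X]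
    [MeasurableSpace X] {μ : Measure X} (hμ : ∀ a, μ {a} = 0) {p : X → Prop}
    (h : ∀ x, ∀ᶠ z in 𝓝[≠] x, p z) : ∀ᵐ z ∂μ, p z := by
  rw [ae_iff]
  refine measure_null_of_locally_null _ fun x _ => ?_
  refine ⟨{x}, ?_, hμ x⟩
  filter_upwards [mem_nhdsWithin_of_mem_nhds (eventually_nhdsWithin_iff.1 (h x)),
    self_mem_nhdsWithin] with z hz hz'
  by_contra hzx
  exact hz' (hz hzx)

theorem kappa_two {t : ℝ} (ht : 0 < t) : kappa 2 t = -Real.log t := by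
  simp [kappa, integral_inv_of_pos ht one_pos]

/-- The modulus of the canonical factor is the quotient of the reflected distance by the direct one,
so its logarithm is the Green function of the disc with pole `p`. -/
theorem log_norm_canonicalFactor {R : ℝ} {z p : ℂ} (hR : 0 < R) (hp : ‖p‖ < R) (hz : ‖z‖ ≤ R)
    (hzp : z ≠ p) :
    ENNReal.ofReal (Real.log ‖Complex.canonicalFactor R p z‖) = green 2 R z p ∧
      0 ≤ Real.log ‖Complex.canonicalFactor R p z‖ := by
  have h0 : 0 < ‖z - p‖ := norm_pos_iff.2 (sub_ne_zero.2 hzp)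
  have hm : ‖z - p‖ ^ 2 ≤ mirrorSq R z p := by
    rw [mirrorSq_eq hR.ne']
    have : 0 ≤ (R ^ 2 - ‖z‖ ^ 2) * (R ^ 2 - ‖p‖ ^ 2) / R ^ 2 := by
      have := norm_nonneg z
      have := norm_nonneg p
      have h1 : 0 ≤ R ^ 2 - ‖z‖ ^ 2 := by nlinarith
      have h2 : 0 ≤ R ^ 2 - ‖p‖ ^ 2 := by nlinarith
      positivity
    linarith
  have hs : ‖z - p‖ ≤ √(mirrorSq R z p) := Real.le_sqrt_of_sq_le hm
  have hk : ‖Complex.canonicalFactor R p z‖ = √(mirrorSq R z p) / ‖z - p‖ := by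
    rw [Complex.canonicalFactor_apply, norm_div, norm_mul, Complex.norm_real, Real.norm_eq_abs,
      abs_of_pos hR, div_mul_eq_div_div]
    congr 1
    rw [div_eq_iff hR.ne', ← sq_eq_sq₀ (norm_nonneg _) (by positivity), mul_pow,
      Real.sq_sqrt (mirrorSq_nonneg hR.ne' z p), mirrorSq, ← Complex.normSq_eq_norm_sq, ← Complex.normSq_eq_norm_sq z,
      ← Complex.normSq_eq_norm_sq p, Complex.inner]
    simp only [Complex.normSq_apply, Complex.sub_re, Complex.sub_im, Complex.mul_re, Complex.mul_im,
      Complex.conj_re, Complex.conj_im, ← Complex.ofReal_pow, Complex.ofReal_re, Complex.ofReal_im]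
    field_simp
    ring
  have hl : Real.log ‖Complex.canonicalFactor R p z‖ =
      kappa 2 ‖z - p‖ - kappa 2 √(mirrorSq R z p) := by
    rw [hk, Real.log_div (h0.trans_le hs).ne' h0.ne']
    rw [kappa_two h0, kappa_two (h0.trans_le hs)]
    ring
  refine ⟨?_, ?_⟩
  · rw [hl, green, radialKernel_eq_ofReal' 2 h0 (h0.trans_le hs)]
  · rw [hk]
    exact Real.log_nonneg ((one_le_div h0).2 hs)

open Function in
/-- The counting function in terms of a finite set that contains the support in a disc. -/
theorem logCounting_eq_sum {D : locallyFinsupp ℂ ℤ} {ρ : ℝ} (hρ : 0 < ρ) {t : Finset ℂ}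
    (ht : ∀ z, ‖z‖ ≤ ρ → D z ≠ 0 → z ∈ t) :
    locallyFinsuppWithin.logCounting D ρ =
      ∑ z ∈ t, (D z : ℝ) * if ‖z‖ ≤ ρ then Real.log ρ - Real.log ‖z‖ else 0 := by
  classical
  have hev : ∀ z, (locallyFinsuppWithin.toClosedBall ρ D z : ℤ) = if ‖z‖ ≤ ρ then D z else 0 := by
    intro z
    split_ifs with h
    · exact locallyFinsuppWithin.toClosedBall_eval_within D (by simpa [abs_of_pos hρ] using h)
    · refine locallyFinsuppWithin.apply_eq_zero_of_notMem _ ?_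
      simpa [abs_of_pos hρ] using h
  have hfin : HasFiniteSupport (locallyFinsuppWithin.toClosedBall ρ D) :=
    (locallyFinsuppWithin.toClosedBall ρ D).finiteSupport (isCompact_closedBall 0 |ρ|)
  have h := countingFunction_finsum_eq_finsum_add (c := 0) hρ.ne' hfin
  simp only [zero_sub, norm_neg] at h
  have h0 : (locallyFinsuppWithin.toClosedBall ρ D 0 : ℤ) = D 0 := by
    rw [hev, if_pos (by simpa using hρ.le)]
  rw [h0] at h
  rw [locallyFinsuppWithin.logCounting, AddMonoidHom.coe_mk, ZeroHom.coe_mk, ← h,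
    finsum_eq_sum_of_support_subset (s := t)]
  · refine Finset.sum_congr rfl fun z _ => ?_
    rw [hev]
    split_ifs <;> simp
  · intro z hz
    rw [mem_support, hev] at hz
    split_ifs at hz with h1
    · exact ht z h1 fun h2 => hz (by simp [h2])
    · simp at hz

-- A comparison point by point of the divisor. For points within `r₀ > 0` the terms `log ‖z‖` cancel
-- in the difference, so the value `Real.log 0 = 0` at the origin is harmless. For `r₀ = 0` nothing
-- cancels, and the origin must carry no mass.
open Function in
theorem sum_log_sub_log_max_le {D : locallyFinsupp ℂ ℤ} (hD : 0 ≤ D) {r R r₀ : ℝ} (hr : 0 < r)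
    (hrR : r < R) (hr₀ : r₀ ∈ Icc 0 r) (h0 : r₀ = 0 → D 0 = 0) {s : Finset ℂ}
    (hs : ∀ z ∈ s, ‖z‖ < R) :
    ∑ z ∈ s, (D z : ℝ) * (Real.log R - Real.log (max ‖z‖ r)) ≤
      locallyFinsuppWithin.logCounting D R - locallyFinsuppWithin.logCounting D r₀ := by
  classical
  have hR := hr.trans hrR
  have hfin := (locallyFinsuppWithin.toClosedBall R D).finiteSupport (isCompact_closedBall 0 |R|)
  set t : Finset ℂ := s ∪ hfin.toFinset with ht
  have hmem : ∀ z, ‖z‖ ≤ R → D z ≠ 0 → z ∈ t := by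
    intro z hz hDz
    refine Finset.mem_union_right _ ((Set.Finite.mem_toFinset _).2 ?_)
    rw [mem_support, locallyFinsuppWithin.toClosedBall_eval_within D
      (by simpa [abs_of_pos hR] using hz)]
    exact hDz
  have hD' : ∀ z, (0 : ℝ) ≤ D z := fun z => by exact_mod_cast hD z
  have h1 := logCounting_eq_sum hR hmem
  have h2 : locallyFinsuppWithin.logCounting D r₀ =
      ∑ z ∈ t, (D z : ℝ) * if ‖z‖ ≤ r₀ ∧ 0 < r₀ then Real.log r₀ - Real.log ‖z‖ else 0 := by
    rcases hr₀.1.eq_or_lt with h | h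
    · simp [← h]
    · rw [logCounting_eq_sum h fun z hz => hmem z (hz.trans (hr₀.2.trans hrR.le))]
      simp [h]
  have hmax : ∀ z : ℂ, ‖z‖ ≤ R → Real.log (max ‖z‖ r) ≤ Real.log R := fun (z : ℂ) hz =>
    Real.log_le_log (lt_max_of_lt_right hr) (max_le hz hrR.le)
  rw [h1, h2, ← Finset.sum_sub_distrib]
  have hsum : ∑ z ∈ s, (D z : ℝ) * (Real.log R - Real.log (max ‖z‖ r)) ≤
      ∑ z ∈ t, (D z : ℝ) * if ‖z‖ ≤ R then Real.log R - Real.log (max ‖z‖ r) else 0 := by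
    refine le_trans (Finset.sum_le_sum fun z hz => ?_)
      (Finset.sum_le_sum_of_subset_of_nonneg Finset.subset_union_left fun z _ _ => ?_)
    · rw [if_pos (hs z hz).le]
    · split_ifs with h
      · exact mul_nonneg (hD' z) (sub_nonneg.2 (hmax z h))
      · simp
  refine hsum.trans (Finset.sum_le_sum fun z _ => ?_)
  rw [← mul_sub]
  rcases eq_or_ne (D z) 0 with hz | hz
  · simp [hz]
  refine mul_le_mul_of_nonneg_left ?_ (hD' z)
  have hz0 : r₀ = 0 → 0 < ‖z‖ := fun h => norm_pos_iff.2 fun h' => hz (h' ▸ h0 h)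
  by_cases h : ‖z‖ ≤ r₀ ∧ 0 < r₀
  · rw [if_pos h, if_pos (h.1.trans (hr₀.2.trans hrR.le)),
      max_eq_right (h.1.trans hr₀.2), if_pos (h.1.trans (hr₀.2.trans hrR.le))]
    linarith [Real.log_le_log h.2 hr₀.2]
  · rw [if_neg h]
    have hz1 : 0 < ‖z‖ := by
      rcases hr₀.1.eq_or_lt with h' | h'
      · exact hz0 h'.symm
      · exact h'.trans (not_le.1 fun hc => h ⟨hc, h'⟩)
    split_ifs
    · linarith [Real.log_le_log hz1 (le_max_left ‖z‖ r)]
    · simp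

end DeltaSubharmonic

/-! ### Poisson–Jensen for meromorphic functions from the canonical decomposition. -/

namespace DeltaSubharmonic

theorem circleIntegrable_re_herglotzRieszKernel_mul {R : ℝ} {w : ℂ} (hw : w ∈ ball (0 : ℂ) R)
    {g : ℂ → ℝ} (hg : CircleIntegrable g 0 R) :
    CircleIntegrable ((Complex.re ∘ herglotzRieszKernel 0 w) * g) 0 R := by
  refine IntervalIntegrable.continuousOn_mul hg (Continuous.continuousOn ?_)
  refine Complex.continuous_re.comp ?_
  exact (continuousOn_herglotzRieszKernel_sphere hw).comp_continuous
    (continuous_circleMap 0 R) fun θ => circleMap_mem_sphere' 0 R θ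

/-- The Poisson–Jensen formula, with the boundary term estimated by the proximity function. -/
theorem exists_log_norm_eq_sub_sum {f : ℂ → ℂ} (hf : Meromorphic f)
    (hord : ∀ z, meromorphicOrderAt f z ≠ ⊤) {R : ℝ} (hR : 0 < R) :
    ∃ (H : ℂ → ℝ) (s : Finset ℂ), (∀ i ∈ s, ‖i‖ < R) ∧ ContinuousOn H (ball 0 R) ∧
      (∀ z ∈ ball (0 : ℂ) R, H z ≤ (R + ‖z‖) / (R - ‖z‖) * ValueDistribution.proximity f ⊤ R) ∧
      ∀ z ∈ ball (0 : ℂ) R, AnalyticAt ℂ f z → f z ≠ 0 →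
        Real.log ‖f z‖ = H z - ∑ i ∈ s, (MeromorphicOn.divisor f univ i : ℝ) *
          Real.log ‖Complex.canonicalFactor R i z‖ := by
  obtain ⟨h, hD⟩ := (hf.meromorphicOn (s := closedBall 0 R)).exists_ecanonicalDecomp
    fun u => hord u
  have hfB : (MeromorphicOn.divisor f (ball 0 R)).support.Finite :=
    hD.meromorphicOn.divisor_ball_support_finite
  have hfS : (MeromorphicOn.divisor f (sphere 0 R)).support.Finite :=
    divisor_sphere_support_finite
  set DS := MeromorphicOn.divisor f (sphere 0 R) with hDS
  set DB := MeromorphicOn.divisor f (ball 0 R) with hDB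
  set s := hfB.toFinset with hs
  set t := hfS.toFinset with ht
  have hsR : ∀ i ∈ s, i ∈ ball (0 : ℂ) R := fun i hi =>
    DB.supportWithinDomain ((Set.Finite.mem_toFinset _).1 hi)
  have htR : ∀ i ∈ t, i ∈ sphere (0 : ℂ) R := fun i hi =>
    DS.supportWithinDomain ((Set.Finite.mem_toFinset _).1 hi)
  set H : ℂ → ℝ := (fun z => Real.log ‖h z‖) + ∑ i ∈ t, (fun z => (DS i : ℝ) * Real.log ‖z - i‖)
    with hH
  have hHapp : ∀ z, H z = Real.log ‖h z‖ + ∑ i ∈ t, (DS i : ℝ) * Real.log ‖z - i‖ := fun z => by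
    simp [hH]
  have hlog : ∀ z ∈ closedBall (0 : ℂ) R, AnalyticAt ℂ f z → f z ≠ 0 →
      Real.log ‖f z‖ = H z - ∑ i ∈ s, (DB i : ℝ) * Real.log ‖Complex.canonicalFactor R i z‖ := by
    intro z hz ha h0
    have h1 := hD.log_norm_eq hz
      ((ha.meromorphicNFAt.meromorphicOrderAt_eq_zero_iff).2 h0) hR
    rw [ha.meromorphicTrailingCoeffAt_of_ne_zero h0,
      finsum_eq_sum_of_support_subset (s := s) _ fun i hi => ?_,
      finsum_eq_sum_of_support_subset (s := t) _ fun i hi => ?_] at h1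
    · rw [hHapp, h1]; ring
    · refine (Set.Finite.mem_toFinset _).2 fun h2 => hi ?_
      simp [← hDS, h2]
    · refine (Set.Finite.mem_toFinset _).2 fun h2 => hi ?_
      simp [← hDB, h2]
  -- `H` is the Poisson integral of `log ‖f‖`: the canonical factors have modulus one on the circle,
  -- `log ‖h‖` is harmonic, and the factors `z - i` with `i` on the circle have their own Poisson
  -- formula.
  have hpois : ∀ z ∈ ball (0 : ℂ) R,
      Real.circleAverage ((Complex.re ∘ herglotzRieszKernel 0 z) *
        fun w => Real.log ‖f w‖) 0 R = H z := by
    intro z hz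
    have h1 : Real.circleAverage ((Complex.re ∘ herglotzRieszKernel 0 z) *
        fun w => Real.log ‖f w‖) 0 R =
        Real.circleAverage ((Complex.re ∘ herglotzRieszKernel 0 z) * H) 0 R := by
      refine Real.circleAverage_congr_codiscreteWithin ?_ hR.ne'
      rw [abs_of_pos hR]
      have hgood : {w | AnalyticAt ℂ f w ∧ f w ≠ 0} ∈ codiscreteWithin (sphere (0 : ℂ) R) := by
        rw [mem_codiscreteWithin_iff_forall_mem_nhdsNE]
        intro x _
        filter_upwards [eventually_analyticAt_and_ne_zero hf hord x] with w hw
        exact Or.inl hw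
      filter_upwards [hgood, self_mem_codiscreteWithin (sphere (0 : ℂ) R)] with w hw hwR
      rw [Pi.mul_apply, Pi.mul_apply, hlog w (sphere_subset_closedBall hwR) hw.1 hw.2,
        Finset.sum_eq_zero fun i hi => ?_, sub_zero]
      rw [Complex.norm_canonicalFactor_eval_circle_eq_one (hsR i hi) hwR, Real.log_one, mul_zero]
    have hl : CircleIntegrable (fun w => Real.log ‖h w‖) 0 R :=
      ((hD.analyticOnNhd.mono (by rw [abs_of_pos hR]; exact sphere_subset_closedBall)).meromorphicOn
        (U := sphere 0 |R|)).circleIntegrable_log_norm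
    have hh : Real.circleAverage ((Complex.re ∘ herglotzRieszKernel 0 z) *
        fun w => Real.log ‖h w‖) 0 R = Real.log ‖h z‖ :=
      InnerProductSpace.HarmonicOnNhd.circleAverage_re_herglotzRieszKernel_smul
        (fun w hw => (hD.analyticOnNhd w hw).harmonicAt_log_norm (hD.ne_zero w hw)) hz
    have hci : ∀ i, CircleIntegrable ((Complex.re ∘ herglotzRieszKernel 0 z) *
        fun w => (DS i : ℝ) * Real.log ‖w - i‖) 0 R := fun i =>
      circleIntegrable_re_herglotzRieszKernel_mul hz
        ((circleIntegrable_log_norm_sub_const R).const_mul _)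
    rw [h1, hH, mul_add, Finset.mul_sum, Real.circleAverage_add
      (circleIntegrable_re_herglotzRieszKernel_mul hz hl) (CircleIntegrable.sum _ fun i _ => hci i),
      Real.circleAverage_sum fun i _ => hci i, hh, ← hH, hHapp]
    congr 1
    refine Finset.sum_congr rfl fun i hi => ?_
    rw [← circleAverage_re_herglotzRieszKernel_mul_log (htR i hi) hz,
      ← smul_eq_mul (DS i : ℝ), ← Real.circleAverage_smul]
    congr 1
    ext w
    simp
    ring
  refine ⟨H, s, fun i hi => by simpa using hsR i hi, ?_, fun z hz => ?_, fun z hz ha h0 => ?_⟩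
  · intro z hz
    have hz' := ball_subset_closedBall hz
    refine ContinuousAt.continuousWithinAt ?_
    have e : H = fun z => Real.log ‖h z‖ + ∑ i ∈ t, (DS i : ℝ) * Real.log ‖z - i‖ := funext hHapp
    rw [e]
    refine ContinuousAt.add ((hD.analyticOnNhd z hz').continuousAt.norm.log
      (norm_ne_zero_iff.2 (hD.ne_zero z hz'))) (tendsto_finsetSum _ fun i hi => ?_)
    refine continuousAt_const.mul (ContinuousAt.log (by fun_prop) (norm_ne_zero_iff.2
      (sub_ne_zero.2 ?_)))
    rintro rfl
    have h1 := htR z hi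
    simp only [mem_sphere, mem_ball] at h1 hz
    exact hz.ne h1
  · rw [← hpois z hz, ValueDistribution.proximity_top,
      ← smul_eq_mul ((R + ‖z‖) / (R - ‖z‖)), ← Real.circleAverage_smul]
    have hfi : CircleIntegrable (fun w => Real.log ‖f w‖) 0 R :=
      (hf.meromorphicOn (s := sphere 0 |R|)).circleIntegrable_log_norm
    have hfp : CircleIntegrable (fun w => Real.posLog ‖f w‖) 0 R :=
      (hf.meromorphicOn (s := sphere 0 |R|)).circleIntegrable_posLog_norm
    refine Real.circleAverage_mono (circleIntegrable_re_herglotzRieszKernel_mul hz hfi)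
      (hfp.const_mul _) fun w hw => ?_
    rw [abs_of_pos hR] at hw
    have h1 := re_herglotzRieszKernel_le hw hz
    have h2 := le_re_herglotzRieszKernel hw hz
    simp only [sub_zero] at h1 h2
    have hzR : ‖z‖ < R := by simpa using hz
    have h3 : 0 ≤ (R - ‖z‖) / (R + ‖z‖) :=
      div_nonneg (by linarith) (by linarith [norm_nonneg z])
    simp only [Pi.mul_apply, Function.comp_apply, herglotzRieszKernel, sub_zero,
      Pi.smul_apply, smul_eq_mul]
    -- Since the Poisson kernel is nonnegative, `log` may be replaced by `log⁺` before the kernel is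
    -- bounded by its maximum.
    calc _ ≤ ((w + z) / (w - z)).re * Real.posLog ‖f w‖ :=
          mul_le_mul_of_nonneg_left (le_max_right _ _) (h3.trans h2)
      _ ≤ _ := mul_le_mul_of_nonneg_right h1 Real.posLog_nonneg
  · rw [hlog z (ball_subset_closedBall hz) ha h0]
    congr 1
    refine Finset.sum_congr rfl fun i hi => ?_
    rw [hDB, MeromorphicOn.divisor_apply hf.meromorphicOn (hsR i hi),
      MeromorphicOn.divisor_apply hf.meromorphicOn (mem_univ i)]

end DeltaSubharmonic

/-! ### The estimate for meromorphic functions. -/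

namespace DeltaSubharmonic

theorem constA_two (r R : ℝ) : constA 2 r R = 2 * ((R + r) / (R - r)) := by
  simp [constA]

theorem measurable_log_norm_canonicalFactor (R : ℝ) (p : ℂ) :
    Measurable fun z => Real.log ‖Complex.canonicalFactor R p z‖ := by
  simp only [Complex.canonicalFactor_apply]
  fun_prop

/-- The estimate of the integral of `ln⁺ |f|` over a disc by the Nevanlinna characteristic. -/
theorem meromorphic_lintegral_posLog_le {r R : ℝ} (hr : 0 < r) (hrR : r < R) {μ : Measure ℂ}
    (hμ : μ univ < ∞) (hμ0 : μ (closedBall 0 r)ᶜ = 0) (hD : DiniCondition 2 μ) {f : ℂ → ℂ}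
    (hf : Meromorphic f) (hf0 : ∃ z, meromorphicOrderAt f z ≠ ⊤) :
    Integrable (fun z => Real.log ‖f z‖) μ ∧
      ∀ r₀ ∈ Icc 0 r, (r₀ = 0 → 0 ≤ meromorphicOrderAt f 0) →
        ∫⁻ z in closedBall 0 r, ENNReal.ofReal (Real.posLog ‖f z‖) ∂μ ≤
          ENNReal.ofReal (2 * ((R + r) / (R - r))) *
            ENNReal.ofReal (ValueDistribution.characteristic f ⊤ R -
              ValueDistribution.logCounting f ⊤ r₀) * (μ univ + diniIntegral 2 μ (R + r)) := by
  have : IsFiniteMeasure μ := ⟨hμ⟩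
  have hR := hr.trans hrR
  have hord : ∀ z, meromorphicOrderAt f z ≠ ⊤ :=
    hf.exists_meromorphicOrderAt_ne_top_iff_forall.1 hf0
  obtain ⟨H, s, hs, hHc, hHle, hlog⟩ := exists_log_norm_eq_sub_sum hf hord hR
  have hatom := hD.measure_singleton le_rfl
  have hball : ∀ᵐ z ∂μ, z ∈ closedBall (0 : ℂ) r := mem_ae_iff.2 hμ0
  have hnot : ∀ᵐ z ∂μ, ∀ i ∈ s, z ≠ i := (ae_ball_iff s.countable_toSet).2 fun i _ => by
    rw [ae_iff]
    simpa using hatom i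
  have hgood := ae_of_eventually_punctured hatom (eventually_analyticAt_and_ne_zero hf hord)
  have hin : ∀ z ∈ closedBall (0 : ℂ) r, z ∈ ball (0 : ℂ) R := fun z hz =>
    closedBall_subset_ball hrR hz
  set c := μ univ + diniIntegral 2 μ (R + r) with hc
  have hct : c ≠ ∞ := ENNReal.add_ne_top.2 ⟨hμ.ne, (diniIntegral_lt_top hμ hD _).ne⟩
  set G : ℂ → ℂ → ℝ := fun i z => Real.log ‖Complex.canonicalFactor R i z‖ with hGdef
  have hGm : ∀ i, Measurable (G i) := measurable_log_norm_canonicalFactor R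
  have hG0 : ∀ i ∈ s, ∀ᵐ z ∂μ, 0 ≤ G i z := by
    intro i hi
    filter_upwards [hball, hnot] with z hz hz'
    exact (log_norm_canonicalFactor hR (hs i hi) (mem_closedBall_zero_iff.1 (ball_subset_closedBall
      (hin z hz))) (hz' i hi)).2
  have hGle : ∀ i ∈ s, ∫⁻ z, ENNReal.ofReal (G i z) ∂μ ≤ ENNReal.ofReal (2 * ((R + r) / (R - r))) *
      ENNReal.ofReal (Real.log R - Real.log (max ‖i‖ r)) * c := by
    intro i hi
    have hm : 0 < max ‖i‖ r := lt_max_of_lt_right hr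
    -- For `d = 2` the kernel over `(max ‖i‖ r, R)` is `log R - log (max ‖i‖ r)`, the contribution
    -- of one pole to the counting function beyond `r`.
    have h1 := lintegral_green_le le_rfl hr hrR μ hμ0 (hs i hi)
    rw [radialKernel_eq_ofReal' 2 hm hR, kappa_two hm, kappa_two hR, constA_two,
      neg_sub_neg] at h1
    refine le_trans (lintegral_mono_ae ?_) h1
    filter_upwards [hball, hnot] with z hz hz'
    exact (log_norm_canonicalFactor hR (hs i hi) (mem_closedBall_zero_iff.1 (ball_subset_closedBall
      (hin z hz))) (hz' i hi)).1.le
  have hGi : ∀ i ∈ s, Integrable (G i) μ := by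
    intro i hi
    refine ⟨(hGm i).aestronglyMeasurable, (hasFiniteIntegral_iff_ofReal (hG0 i hi)).2 ?_⟩
    exact (hGle i hi).trans_lt (ENNReal.mul_lt_top
      (ENNReal.mul_lt_top ENNReal.ofReal_lt_top ENNReal.ofReal_lt_top) hct.lt_top)
  have hHi : Integrable H μ := by
    have h1 : IntegrableOn H (closedBall 0 r) μ :=
      (hHc.mono fun z hz => hin z hz).integrableOn_compact (isCompact_closedBall 0 r)
    rwa [IntegrableOn, Measure.restrict_eq_self_of_ae_mem hball] at h1
  have heq : ∀ᵐ z ∂μ, Real.log ‖f z‖ =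
      H z - ∑ i ∈ s, (MeromorphicOn.divisor f univ i : ℝ) * G i z := by
    filter_upwards [hball, hgood] with z hz hz'
    exact hlog z (hin z hz) hz'.1 hz'.2
  refine ⟨(hHi.sub (integrable_finsetSum s fun i hi =>
    (hGi i hi).const_mul (MeromorphicOn.divisor f univ i : ℝ))).congr ?_,
    fun r₀ hr₀ h0 => ?_⟩
  · filter_upwards [heq] with z hz
    simp [hz]
  -- The divisor of poles. Zeros enter the formula with a nonpositive sign and are dropped.
  set D := (MeromorphicOn.divisor f univ)⁻ with hDdef
  have hDnn : 0 ≤ D := negPart_nonneg _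
  have hDi : ∀ i, (0 : ℝ) ≤ D i := fun i => by exact_mod_cast hDnn i
  have hDle : ∀ i, -(MeromorphicOn.divisor f univ i : ℝ) ≤ D i := fun i => by
    have h1 : -(MeromorphicOn.divisor f univ) ≤ D := neg_le_negPart _
    have h2 := h1 i
    simp only [Function.locallyFinsuppWithin.coe_neg, Pi.neg_apply] at h2
    exact_mod_cast h2
  set m := ValueDistribution.proximity f ⊤ R with hm
  have hm0 : 0 ≤ m := by
    rw [hm, ValueDistribution.proximity_top]
    exact Real.circleAverage_nonneg_of_nonneg fun _ _ => Real.posLog_nonneg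
  set K := (R + r) / (R - r) with hK
  have hK0 : 0 ≤ K := div_nonneg (by linarith) (by linarith)
  have hD0 : r₀ = 0 → D 0 = 0 := by
    intro h
    have h1 := h0 h
    rw [hDdef, Function.locallyFinsuppWithin.negPart_apply,
      MeromorphicOn.divisor_apply hf.meromorphicOn (mem_univ _)]
    refine negPart_eq_zero.2 ?_
    lift meromorphicOrderAt f 0 to ℤ using hord 0 with n
    simpa using h1
  have hcount := sum_log_sub_log_max_le hDnn hr hrR hr₀ hD0 hs
  have hpos : ∀ᵐ z ∂μ, ENNReal.ofReal (Real.posLog ‖f z‖) ≤ ENNReal.ofReal (K * m) +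
      ∑ i ∈ s, ENNReal.ofReal (D i) * ENNReal.ofReal (G i z) := by
    have hG0' : ∀ᵐ z ∂μ, ∀ i ∈ s, 0 ≤ G i z := (ae_ball_iff s.countable_toSet).2 hG0
    filter_upwards [heq, hball, hG0'] with z hz hzr hGz
    have hzr' : ‖z‖ ≤ r := by simpa using hzr
    have h1 : H z ≤ K * m := by
      refine (hHle z (hin z hzr)).trans (mul_le_mul_of_nonneg_right ?_ hm0)
      exact div_le_div₀ (by linarith) (by linarith) (by linarith) (by linarith)
    have h2 : ∀ i ∈ s, 0 ≤ (D i : ℝ) * G i z := fun i hi => mul_nonneg (hDi i) (hGz i hi)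
    have h3 : Real.log ‖f z‖ ≤ K * m + ∑ i ∈ s, (D i : ℝ) * G i z := by
      rw [hz, sub_eq_add_neg, ← Finset.sum_neg_distrib]
      refine add_le_add h1 (Finset.sum_le_sum fun i hi => ?_)
      rw [← neg_mul]
      exact mul_le_mul_of_nonneg_right (hDle i) (hGz i hi)
    have h4 : Real.posLog ‖f z‖ ≤ K * m + ∑ i ∈ s, (D i : ℝ) * G i z :=
      max_le (add_nonneg (mul_nonneg hK0 hm0) (Finset.sum_nonneg h2)) h3
    refine (ENNReal.ofReal_le_ofReal h4).trans (ENNReal.ofReal_add_le.trans ?_)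
    rw [ENNReal.ofReal_sum_of_nonneg h2]
    gcongr with i hi
    rw [ENNReal.ofReal_mul (hDi i)]
  have hterm : ∀ i ∈ s, 0 ≤ (D i : ℝ) * (Real.log R - Real.log (max ‖i‖ r)) := fun i hi =>
    mul_nonneg (hDi i) (sub_nonneg.2 (Real.log_le_log (lt_max_of_lt_right hr)
      (max_le (hs i hi).le hrR.le)))
  calc ∫⁻ z in closedBall 0 r, ENNReal.ofReal (Real.posLog ‖f z‖) ∂μ
      ≤ ∫⁻ z, ENNReal.ofReal (Real.posLog ‖f z‖) ∂μ := setLIntegral_le_lintegral _ _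
    _ ≤ ∫⁻ z, (ENNReal.ofReal (K * m) +
          ∑ i ∈ s, ENNReal.ofReal (D i) * ENNReal.ofReal (G i z)) ∂μ := lintegral_mono_ae hpos
    _ = ENNReal.ofReal (K * m) * μ univ +
          ∑ i ∈ s, ENNReal.ofReal (D i) * ∫⁻ z, ENNReal.ofReal (G i z) ∂μ := by
        rw [lintegral_add_left measurable_const, lintegral_const, lintegral_finsetSum _ fun i _ =>
          ((hGm i).ennreal_ofReal.const_mul _)]
        congr 1
        exact Finset.sum_congr rfl fun i _ => lintegral_const_mul _ (hGm i).ennreal_ofReal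
    _ ≤ ENNReal.ofReal (2 * K) * ENNReal.ofReal m * c + ∑ i ∈ s, ENNReal.ofReal (2 * K) *
          ENNReal.ofReal ((D i : ℝ) * (Real.log R - Real.log (max ‖i‖ r))) * c := by
        refine add_le_add ?_ (Finset.sum_le_sum fun i hi => ?_)
        · rw [← ENNReal.ofReal_mul (by positivity)]
          refine mul_le_mul' (ENNReal.ofReal_le_ofReal ?_) le_self_add
          -- The proximity term needs only `K`; the factor `2` is forced by the Green function
          -- bound.
          nlinarith [mul_nonneg hK0 hm0]
        · refine (mul_le_mul_right (hGle i hi) _).trans_eq ?_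
          rw [ENNReal.ofReal_mul (hDi i)]
          ring
    _ = ENNReal.ofReal (2 * K) * ENNReal.ofReal
          (m + ∑ i ∈ s, (D i : ℝ) * (Real.log R - Real.log (max ‖i‖ r))) * c := by
        rw [← Finset.sum_mul, ← Finset.mul_sum, ENNReal.ofReal_add hm0 (Finset.sum_nonneg hterm),
          ENNReal.ofReal_sum_of_nonneg hterm]
        ring
    _ ≤ _ := by
        gcongr
        rw [ValueDistribution.characteristic, Pi.add_apply, ValueDistribution.logCounting_top,
          ← hDdef, ← hm]
        linarith

end DeltaSubharmonic

theorem mainTheorem1 :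
    (∀ (d : ℕ), 2 ≤ d → ∀ (r R : ℝ), 0 < r → r < R →
      ∀ (μ : Measure (EuclideanSpace ℝ (Fin d))), μ univ < ∞ → μ (closedBall 0 r)ᶜ = 0 →
      DiniCondition d μ →
      ∀ (U u v : EuclideanSpace ℝ (Fin d) → EReal), IsDeltaSubharmonic U u v R →
        -- `U` is defined and finite almost everywhere and has a finite integral
        (∀ᵐ x ∂μ, u x ≠ ⊥ ∧ v x ≠ ⊥) ∧
        Integrable (fun x => (U x).toReal) μ ∧
        ∀ r₀ ∈ Icc 0 r,
          ∫⁻ x in closedBall 0 r, (U x).toENNReal ∂μ ≤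
            ENNReal.ofReal (constA d r R) * nevanlinnaT U u v r₀ R *
              (μ univ + diniIntegral d μ (R + r))) ∧
    (∀ (r R : ℝ), 0 < r → r < R →
      ∀ (μ : Measure ℂ), μ univ < ∞ → μ (closedBall 0 r)ᶜ = 0 → DiniCondition 2 μ →
      ∀ (f : ℂ → ℂ), Meromorphic f → (∃ z, meromorphicOrderAt f z ≠ ⊤) →
        Integrable (fun z => Real.log ‖f z‖) μ ∧
        ∀ r₀ ∈ Icc 0 r, (r₀ = 0 → 0 ≤ meromorphicOrderAt f 0) →
          ∫⁻ z in closedBall 0 r, ENNReal.ofReal (Real.posLog ‖f z‖) ∂μ ≤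
            ENNReal.ofReal (2 * ((R + r) / (R - r))) *
              ENNReal.ofReal (ValueDistribution.characteristic f ⊤ R -
                ValueDistribution.logCounting f ⊤ r₀) *
              (μ univ + diniIntegral 2 μ (R + r))) := by
  refine ⟨fun d hd r R hr hrR μ hμ hμ0 hD U u v hU => ?_, ?_⟩
  · have : Nonempty (Fin d) := ⟨⟨0, by omega⟩⟩
    have hfin : finrank ℝ (EuclideanSpace ℝ (Fin d)) = d := finrank_euclideanSpace_fin
    have h := deltaSubharmonic_lintegral_le (E := EuclideanSpace ℝ (Fin d)) (hfin.symm ▸ hd) hr hrR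
      hμ hμ0 (hfin.symm ▸ hD) hU
    simpa only [hfin] using h
  · exact fun r R hr hrR μ hμ hμ0 hD f hf hf0 =>
      meromorphic_lintegral_posLog_le hr hrR hμ hμ0 hD hf hf0
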